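/- **Conventions.** A real random variable $\xi$ is subgaussian if for some $B>0$ one has $\mathbb P(|\xi|>t)\le 2\exp(-t^2/B^2)$ for all $t>0$. Write $\log_+ s=\max\{\log s,0\}$, let $\|\cdot\|$ be the operator norm of a matrix and $\mathbb S^{n-1}$ the Euclidean unit sphere. For $L>0$ and $v\in\mathbb R^d$ put $$\mathrm{LCD}_L(v)=\inf\Bigl\{\theta>0:\ \mathrm{dist}(\theta v,\mathbb Z^d)<L\sqrt{\log_+(\|\theta v\|_2/L)}\Bigr\}.$$ For $v\in\mathbb R^n$ and $k\le n$ let $v_{[1:k]}\in\mathbb R^k$ be the vector of the $k$ coordinates of $v$ that are smallest in absolute value, in their original order (the value of $\mathrm{LCD}_L$ does not depend on how ties are broken), and let $$\mathrm{TS}_{D,k,n,L}=\Bigl\{x\in\mathbb S^{n-1}:\ D\le \mathrm{LCD}_L\bigl(x_{[1:k]}/\|x_{[1:k]}\|_2\bigr)\le 2D\Bigr\}.$$ A vector of $\mathbb R^n$ is sparse if it has at most $\delta n$ nonzero coordinates, and $\mathrm{Incomp}(\delta,\rho)$ is the set of all $x\in\mathbb S^{n-1}$ that are not within Euclidean distance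 $\rho$ from the set of sparse vectors. **Lemma 6.8 (Probability of Random Normal in Level Set).** Let $\xi$ be a centered subgaussian real random variable of unit variance, and let $L>1$, $0<\delta<1$ and $C>0$. There are constants $c_1,c_2>0$, depending only on the law of $\xi$ and on $L,\delta,C$, such that for every $\gamma_0<1$ there is $n_0\in\mathbb N$, depending only on the same data and on $\gamma_0$, for which the following holds. Let $1/2<\gamma\le\gamma_0$, let $n>n_0$, let $$\tfrac12\,C\,\frac{\sqrt n}{\log n}<D<\exp\bigl(c_1n^{2-2\gamma}\bigr),$$ and let $k$ be an integer with $n-\delta n/\log n\le k\le n$. Let $R_n$ be a random $n\times n$ matrix whose entries are independent copies of $\xi$, let $M$ be a deterministic real $n\times n$ matrix with $\|M\|\le n^\gamma$, let $X_1,\dots,X_n$ be the columns of $A_n=R_n+M$, and let $Z$ be a random unit vector such that $Z(\omega)$ is orthogonal to $\mathrm{span}(X_1(\omega),\dots,X_{n-1}(\omega))$ for every $\omega$. Then $$\mathbb P\bigl(Z\in \mathrm{TS}_{D,k,n,L}\cap\mathrm{Incomp}(\delta,\delta n^{1/2-\gamma})\bigr)<\exp(-c_2n).$$ -/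

import Mathlib

open MeasureTheory ProbabilityTheory

noncomputable section

/-- A real random variable is subgaussian if its tails satisfy
`P(|ξ| > t) ≤ 2 exp(-t² / B²)` for all `t > 0`, for some `B > 0`. -/
def IsSubgaussian {Ω : Type*} [MeasurableSpace Ω] (P : Measure Ω) (ξ : Ω → ℝ) : Prop :=
  ∃ B : ℝ, 0 < B ∧ ∀ t : ℝ, 0 < t → P.real {ω | t < |ξ ω|} ≤ 2 * Real.exp (-t ^ 2 / B ^ 2)

/-- The integer lattice `ℤ^d` in Euclidean space. -/
def integerLattice (d : ℕ) : Set (EuclideanSpace ℝ (Fin d)) :=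
  {p | ∀ i, ∃ m : ℤ, p i = (m : ℝ)}

/-- The log-plus least common denominator `LCD_{L,d}(v)`: the infimum of all `θ > 0` with
`dist (θ v, ℤ^d) < L √(log₊ (‖θ v‖ / L))`. It is valued in the extended reals, so that the
infimum over the empty set is `+∞`. -/
def LCD (L : ℝ) {d : ℕ} (v : EuclideanSpace ℝ (Fin d)) : EReal :=
  sInf ((fun θ : ℝ => (θ : EReal)) '' {θ : ℝ | 0 < θ ∧
    Metric.infDist (θ • v) (integerLattice d) < L * √(max (Real.log (‖θ • v‖ / L)) 0)})

/-- The truncated vector `TV_n(x, I)`: the coordinates of `x` with index in `I`, listed in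
increasing order of the index. -/
def truncVec {n : ℕ} (x : EuclideanSpace ℝ (Fin n)) (I : Finset (Fin n)) :
    EuclideanSpace ℝ (Fin I.card) :=
  WithLp.toLp 2 (fun i => x (I.orderEmbOfFin rfl i))

/-- The set `{σ(1), …, σ(k)}` of the indices of the `k` coordinates of `v` that are smallest in
absolute value, where `σ` is a permutation with `|v_{σ(1)}| ≤ … ≤ |v_{σ(n)}|`
(ties are broken by the index). -/
def smallIndices {n : ℕ} (v : EuclideanSpace ℝ (Fin n)) (k : ℕ) : Finset (Fin n) :=
  (Finset.univ.filter (fun i : Fin n => (i : ℕ) < k)).map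
    (Tuple.sort (fun i => |v i|)).toEmbedding

/-- The small part `v_{[1:k]}` of the vector `v`. -/
def smallPart {n : ℕ} (v : EuclideanSpace ℝ (Fin n)) (k : ℕ) :
    EuclideanSpace ℝ (Fin (smallIndices v k).card) :=
  truncVec v (smallIndices v k)

/-- The level set `TS_{D,k,n,L}` of the LCD of the normalized small part. -/
def levelSetTS (D : ℝ) (k n : ℕ) (L : ℝ) : Set (EuclideanSpace ℝ (Fin n)) :=
  {x | ‖x‖ = 1 ∧ (D : EReal) ≤ LCD L (‖smallPart x k‖⁻¹ • smallPart x k) ∧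
    LCD L (‖smallPart x k‖⁻¹ • smallPart x k) ≤ ((2 * D : ℝ) : EReal)}

/-- The vectors of `ℝ^n` with at most `δ n` nonzero coordinates. -/
def sparseVectors (n : ℕ) (δ : ℝ) : Set (EuclideanSpace ℝ (Fin n)) :=
  {x | ((Finset.univ.filter (fun i => x i ≠ 0)).card : ℝ) ≤ δ * n}

/-- The unit vectors within Euclidean distance `ρ` from the set of sparse vectors. -/
def compVectors (n : ℕ) (δ ρ : ℝ) : Set (EuclideanSpace ℝ (Fin n)) :=
  {x | ‖x‖ = 1 ∧ ∃ y ∈ sparseVectors n δ, ‖x - y‖ ≤ ρ}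

/-- The unit vectors that are not compressible. -/
def incompVectors (n : ℕ) (δ ρ : ℝ) : Set (EuclideanSpace ℝ (Fin n)) :=
  {x | ‖x‖ = 1 ∧ x ∉ compVectors n δ ρ}

/-- The `j`-th column of a square matrix, as a vector of Euclidean space. -/
def columnVec {n : ℕ} (A : Matrix (Fin n) (Fin n) ℝ) (j : Fin n) : EuclideanSpace ℝ (Fin n) :=
  WithLp.toLp 2 (fun i => A i j)

/-- The span of the first `n - 1` columns of an `n × n` matrix. -/
def spanFirstColumns {n : ℕ} (A : Matrix (Fin n) (Fin n) ℝ) :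
    Submodule ℝ (EuclideanSpace ℝ (Fin n)) :=
  Submodule.span ℝ {v | ∃ j : Fin n, (j : ℕ) + 1 < n ∧ v = columnVec A j}

end

/-! The normal vector `Z` satisfies `n - 1` independent equations `⟨X_j, Z⟩ = 0`. If `A_n` has
operator norm at most `Λ` and `x` is within `ε` of `Z`, then `∑ ⟨X_j, x⟩² ≤ (Λ ε)²`. The proof
bounds the probability of this for a fixed `x` and sums over a net of arithmetically structured
vectors. The norm bound, with `Λ = K n^γ`, fails with probability at most `e^{-2n}`
(`measureReal_norm_gt_le`).

Let `x` have a part on `S` that first approaches the integer lattice, to within `τ ≈ √(κ log D)`, at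
scale about `D`. Its multiples lie close to integer points of norm `O(D)`. Such vectors therefore
have a net of precision `ε ≈ σ τ / D`, with `σ` the size of the part on `S`, and of cardinality
about `(C max(1, D/√n))^n` (`exists_netPoint`, `card_latticeBox_le`). Up to scale `D` the part on
`S` keeps away from the lattice, so the characteristic function of `⟨X_j, x⟩` decays, and each
equation costs a factor `C Λ τ / (√n D)` (`integral_prod_norm_charFun_le`,
`measureReal_sum_linearForm_sq_le`).

In the product the powers of `D` cancel and about `(C Λ τ / (√n min(D, √n)))^n` remains. It is
exponentially small once `Λ τ / √n ≤ q₀ min(D, √n)` (`opNorm_mul_threshold_le`). For `D ≥ √n` and `Λ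
≈ n^γ` this says `log D ≤ c n^{2-2γ}`, which is the upper bound in the theorem. For smaller `D` it
follows from `D ≳ √n / log n` and `γ₀ < 1`.

The small part of a vector of the level set need not be spread, so its first scale of approach has
no a priori lower bound. Incompressibility yields a subset `S` of the small part, missing only `O(n
/ log n)` coordinates in all, on which `x` is spread (`exists_spread_subset`). This forces the first
scale for `S` above order `√n / log n`, while closeness of the whole small part forces it below
`3D`. The proof ends with a union bound over `S`, the dyadic size of the part on `S` and the dyadic
first scale: at most `2^n · n · 4n` classes, absorbed by a small `q₀`. -/

/-! ### Lattice distance, characteristic functions and the small ball bound for one linear form. -/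

/-- The squared distance of `r • x`, restricted to the coordinates in `S`, to the integer lattice. -/
noncomputable def latticeDistSq {ι : Type*} (S : Finset ι) (x : ι → ℝ) (r : ℝ) : ℝ :=
  ∑ i ∈ S, (r * x i - round (r * x i)) ^ 2

/-- The lower bound for the squared lattice distance at scale `θ` below the essential LCD. -/
noncomputable def latticeGap (κ θ : ℝ) : ℝ := min (θ ^ 2) (κ * Real.log (1 + θ ^ 2))

lemma latticeGap_mono {κ θ₁ θ₂ : ℝ} (hκ : 0 ≤ κ) (h : |θ₁| ≤ |θ₂|) :
    latticeGap κ θ₁ ≤ latticeGap κ θ₂ := by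
  have h2 : θ₁ ^ 2 ≤ θ₂ ^ 2 := sq_le_sq.2 h
  unfold latticeGap
  gcongr

lemma latticeGap_nonneg {κ θ : ℝ} (hκ : 0 ≤ κ) : 0 ≤ latticeGap κ θ := by
  have : 0 ≤ Real.log (1 + θ ^ 2) := Real.log_nonneg (by nlinarith [sq_nonneg θ])
  unfold latticeGap
  positivity

/-- The logarithmic branch gives `(1 + θ²)^{-cκ}`, so `1 ≤ c κ` is exactly what turns the distance
bound into a decay integrable in `θ`. -/
lemma exp_neg_latticeGap_le {c κ θ : ℝ} (hc : 0 < c) (hc1 : c ≤ 1) (hκ : 1 ≤ c * κ) :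
    Real.exp (-c * latticeGap κ θ) ≤ c⁻¹ * (1 + θ ^ 2)⁻¹ := by
  have hpos : 0 < 1 + θ ^ 2 := by positivity
  have hlog : 0 ≤ Real.log (1 + θ ^ 2) := Real.log_nonneg (by nlinarith [sq_nonneg θ])
  rcases min_choice (θ ^ 2) (κ * Real.log (1 + θ ^ 2)) with h | h <;> rw [latticeGap, h]
  · have h1 : c * (1 + θ ^ 2) ≤ Real.exp (c * θ ^ 2) := by
      nlinarith [Real.add_one_le_exp (c * θ ^ 2)]
    rw [neg_mul, Real.exp_neg, ← mul_inv]
    exact inv_anti₀ (by positivity) h1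
  · have h1 : Real.exp (-c * (κ * Real.log (1 + θ ^ 2))) ≤ (1 + θ ^ 2)⁻¹ := by
      rw [← Real.exp_log (inv_pos.2 hpos), Real.log_inv]
      exact Real.exp_le_exp.2 (by nlinarith)
    exact h1.trans (le_mul_of_one_le_left (by positivity) ((one_le_inv₀ hc).2 hc1))

/-- Periodicity reduces to `|y| ≤ π`, where `1 - cos y ≥ 2 y² / π²`. -/
lemma eight_mul_sub_round_sq_le (w : ℝ) :
    8 * (w - round w) ^ 2 ≤ 1 - Real.cos (2 * Real.pi * w) := by
  have h1 : Real.cos (2 * Real.pi * w) = Real.cos (2 * Real.pi * (w - round w)) := by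
    rw [← Real.cos_sub_int_mul_two_pi _ (round w)]
    ring_nf
  have h2 : |2 * Real.pi * (w - round w)| ≤ Real.pi := by
    rw [abs_mul, abs_of_pos (by positivity)]
    nlinarith [abs_sub_round w, Real.pi_pos]
  have h4 := Real.cos_le_one_sub_mul_cos_sq h2
  have h5 : 2 / Real.pi ^ 2 * (2 * Real.pi * (w - round w)) ^ 2 = 8 * (w - round w) ^ 2 := by
    field_simp
    ring
  linarith

/-- The squared modulus is the characteristic function of `ξ - ξ'` for an independent copy `ξ'`.
Symmetrization removes phases. -/
lemma one_sub_norm_charFun_sq (μ : Measure ℝ) [IsProbabilityMeasure μ] (u : ℝ) :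
    1 - ‖charFun μ u‖ ^ 2 = ∫ p, (1 - Real.cos (u * (p.1 - p.2))) ∂(μ.prod μ) := by
  have hint : Integrable (fun p : ℝ × ℝ => Complex.exp ((u * (p.1 - p.2) : ℝ) * Complex.I))
      (μ.prod μ) := by
    refine Integrable.of_bound (by fun_prop) 1 (ae_of_all _ fun p => ?_)
    rw [Complex.norm_exp_ofReal_mul_I]
  have h1 : ((‖charFun μ u‖ ^ 2 : ℝ) : ℂ)
      = ∫ p, Complex.exp ((u * (p.1 - p.2) : ℝ) * Complex.I) ∂(μ.prod μ) := by
    rw [Complex.ofReal_pow, ← Complex.mul_conj', ← charFun_neg, charFun_apply_real,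
      charFun_apply_real, ← integral_prod_mul]
    refine integral_congr_ae (ae_of_all _ fun p => ?_)
    simp only
    rw [← Complex.exp_add]
    congr 1
    push_cast
    ring
  have h2 : ‖charFun μ u‖ ^ 2 = ∫ p, Real.cos (u * (p.1 - p.2)) ∂(μ.prod μ) := by
    have h3 := congrArg Complex.re h1
    rw [Complex.ofReal_re] at h3
    rw [h3]
    have := integral_re hint
    simp only [RCLike.re_to_complex] at this
    rw [← this]
    refine integral_congr_ae (ae_of_all _ fun p => ?_)
    simp only [Complex.exp_ofReal_mul_I_re]
  rw [integral_sub (integrable_const _), h2]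
  · simp
  · refine Integrable.of_bound (by fun_prop) 1 (ae_of_all _ fun p => ?_)
    exact Real.abs_cos_le_one _

/-- Summing `1 - |φ(t x_i)|²` over `S` gives the mean over `z = ξ - ξ'` of `∑ (1 - cos(t z x_i))`,
at least eight times the squared lattice distance at `t z / 2π`. Only values `a ≤ |z| ≤ b`, of mass
at least `p₀`, are kept. -/
lemma prod_norm_charFun_le {ι : Type*} (μ : Measure ℝ) [IsProbabilityMeasure μ] (S : Finset ι)
    (x : ι → ℝ) (t a b p₀ G : ℝ) (hG : 0 ≤ G)
    (hp : p₀ ≤ (μ.prod μ).real {p | a ≤ |p.1 - p.2| ∧ |p.1 - p.2| ≤ b})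
    (h : ∀ z, a ≤ |z| → |z| ≤ b → G ≤ latticeDistSq S x (t * z / (2 * Real.pi))) :
    ∏ i ∈ S, ‖charFun μ (t * x i)‖ ≤ Real.exp (-4 * p₀ * G) := by
  have hms : MeasurableSet {p : ℝ × ℝ | a ≤ |p.1 - p.2| ∧ |p.1 - p.2| ≤ b} :=
    measurableSet_Icc.preimage (f := fun p : ℝ × ℝ => |p.1 - p.2|) (by fun_prop)
  have hintc : ∀ u : ℝ, Integrable (fun p : ℝ × ℝ => 1 - Real.cos (u * (p.1 - p.2)))
      (μ.prod μ) := by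
    intro u
    refine (integrable_const _).sub (Integrable.of_bound (by fun_prop) 1 (ae_of_all _ fun p => ?_))
    exact Real.abs_cos_le_one _
  have h1 : 8 * p₀ * G ≤ ∑ i ∈ S, (1 - ‖charFun μ (t * x i)‖ ^ 2) := by
    simp_rw [one_sub_norm_charFun_sq]
    rw [← integral_finsetSum _ (fun i _ => hintc _)]
    calc 8 * p₀ * G ≤ (μ.prod μ).real {p | a ≤ |p.1 - p.2| ∧ |p.1 - p.2| ≤ b} * (8 * G) := by
          nlinarith
      _ = ∫ p, Set.indicator {p : ℝ × ℝ | a ≤ |p.1 - p.2| ∧ |p.1 - p.2| ≤ b}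
            (fun _ => 8 * G) p ∂(μ.prod μ) := by
          rw [integral_indicator_const _ hms, smul_eq_mul]
      _ ≤ _ := by
          refine integral_mono ((integrable_const _).indicator hms)
            (integrable_finsetSum _ (fun i _ => hintc _)) fun p => ?_
          by_cases hpm : p ∈ {p : ℝ × ℝ | a ≤ |p.1 - p.2| ∧ |p.1 - p.2| ≤ b}
          · rw [Set.indicator_of_mem hpm]
            refine (mul_le_mul_of_nonneg_left (h _ hpm.1 hpm.2) (by norm_num)).trans ?_
            rw [latticeDistSq, Finset.mul_sum]
            refine Finset.sum_le_sum fun i _ => ?_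
            refine (eight_mul_sub_round_sq_le _).trans_eq ?_
            congr 2
            field_simp
          · rw [Set.indicator_of_notMem hpm]
            exact Finset.sum_nonneg fun i _ => by linarith [Real.cos_le_one (t * x i * (p.1 - p.2))]
  -- For `y ≥ 0` one has `y² ≤ exp(-(1 - y²))`; taking square roots halves the exponent, and `8 p₀`
  -- becomes `4 p₀`.
  have h2 : ∏ i ∈ S, ‖charFun μ (t * x i)‖ ≤
      ∏ i ∈ S, Real.exp (-(1 / 2) * (1 - ‖charFun μ (t * x i)‖ ^ 2)) := by
    refine Finset.prod_le_prod (fun _ _ => norm_nonneg _) fun i _ => ?_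
    set y := ‖charFun μ (t * x i)‖
    have hy : 0 ≤ y := norm_nonneg _
    have h4 := Real.add_one_le_exp (-(1 - y ^ 2))
    have h5 : Real.exp (-(1 / 2) * (1 - y ^ 2)) ^ 2 = Real.exp (-(1 - y ^ 2)) := by
      rw [← Real.exp_nat_mul]; congr 1; push_cast; ring
    refine abs_le_of_sq_le_sq' ?_ (Real.exp_pos _).le |>.2
    linarith
  refine h2.trans ?_
  rw [← Real.exp_sum, ← Finset.mul_sum]
  exact Real.exp_le_exp.2 (by linarith)

/-- If `ξ - ξ'` vanished almost surely, Fubini would make `ξ` almost surely constant, against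
nonzero variance. The cap `p₀ ≤ 1/4` serves to apply `exp_neg_latticeGap_le` with `c = 4 p₀ ≤ 1`. -/
lemma exists_symmetrized_mass {Ω : Type*} [MeasurableSpace Ω] (P : Measure Ω)
    [IsProbabilityMeasure P] (ξ : Ω → ℝ) (hξ : Measurable ξ) (hvar : variance ξ P ≠ 0) :
    ∃ a b p₀ : ℝ, 0 < a ∧ a ≤ b ∧ 0 < p₀ ∧ p₀ ≤ 1 / 4 ∧
      p₀ ≤ ((P.map ξ).prod (P.map ξ)).real {p | a ≤ |p.1 - p.2| ∧ |p.1 - p.2| ≤ b} := by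
  set μ := P.map ξ
  have : IsProbabilityMeasure μ := Measure.isProbabilityMeasure_map hξ.aemeasurable
  let A : ℕ → Set (ℝ × ℝ) := fun m => {p | ((m : ℝ) + 1)⁻¹ ≤ |p.1 - p.2| ∧ |p.1 - p.2| ≤ m + 1}
  by_cases hA : ∃ m, 0 < (μ.prod μ).real (A m)
  · obtain ⟨m, hm⟩ := hA
    refine ⟨((m : ℝ) + 1)⁻¹, m + 1, min (1 / 4) ((μ.prod μ).real (A m)), by positivity, ?_,
      lt_min (by norm_num) hm, min_le_left _ _, min_le_right _ _⟩
    have : (1 : ℝ) ≤ m + 1 := by linarith [(Nat.cast_nonneg m : (0 : ℝ) ≤ m)]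
    exact (inv_le_one_of_one_le₀ this).trans this
  · exfalso
    push Not at hA
    have h0 : ∀ m, (μ.prod μ) (A m) = 0 := fun m =>
      (measureReal_eq_zero_iff).1 (le_antisymm (hA m) measureReal_nonneg)
    have h1 : ∀ᵐ p ∂(μ.prod μ), p.1 = p.2 := by
      rw [ae_iff]
      refine measure_mono_null (fun p hp => ?_) (measure_iUnion_null h0)
      have hp' : 0 < |p.1 - p.2| := abs_pos.2 (sub_ne_zero.2 hp)
      obtain ⟨m, hm⟩ := exists_nat_ge (max |p.1 - p.2| |p.1 - p.2|⁻¹)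
      refine Set.mem_iUnion.2 ⟨m, ?_, ?_⟩
      · have : |p.1 - p.2|⁻¹ ≤ m + 1 := by linarith [le_max_right |p.1 - p.2| |p.1 - p.2|⁻¹]
        exact inv_le_of_inv_le₀ hp' this
      · linarith [le_max_left |p.1 - p.2| |p.1 - p.2|⁻¹]
    obtain ⟨y, hy⟩ := (Measure.ae_ae_of_ae_prod h1).exists
    apply hvar
    have h2 : ∀ᵐ ω ∂P, ξ ω = y := by
      have := ae_of_ae_map hξ.aemeasurable hy
      filter_upwards [this] with ω h using h.symm
    rw [variance_congr (Y := fun _ => y) h2]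
    simp [variance_eq_integral measurable_const.aemeasurable]

/-- A Gaussian is its own Fourier transform, so `exp(-v Y²/2)` is the mean of `exp(itY)` over `t ~
N(0, v)`. This plays the part of Esseen's inequality, and in Laplace form it multiplies over
independent columns. -/
lemma integral_exp_neg_sq_le_integral_norm_charFun {Ω : Type*} [MeasurableSpace Ω] (P : Measure Ω)
    [IsProbabilityMeasure P] (Y : Ω → ℝ) (hY : Measurable Y) (v : NNReal) :
    ∫ ω, Real.exp (-(v * Y ω ^ 2 / 2)) ∂P ≤ ∫ t, ‖charFun (P.map Y) t‖ ∂(gaussianReal 0 v) := by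
  have : IsProbabilityMeasure (P.map Y) := Measure.isProbabilityMeasure_map hY.aemeasurable
  have h1 : ((∫ ω, Real.exp (-(v * Y ω ^ 2 / 2)) ∂P : ℝ) : ℂ)
      = ∫ t, charFun (P.map Y) t ∂(gaussianReal 0 v) := by
    have h2 : ∫ ω, Real.exp (-(v * Y ω ^ 2 / 2)) ∂P
        = ∫ y, Real.exp (-(v * y ^ 2 / 2)) ∂(P.map Y) := by
      rw [integral_map hY.aemeasurable (by fun_prop)]
    rw [h2, ← integral_complex_ofReal]
    have h3 : ∀ y : ℝ, ((Real.exp (-(v * y ^ 2 / 2)) : ℝ) : ℂ)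
        = ∫ t, Complex.exp (y * t * Complex.I) ∂(gaussianReal 0 v) := by
      intro y
      rw [← charFun_apply_real, charFun_gaussianReal]
      push_cast
      congr 1
      ring
    simp_rw [h3, charFun_apply_real]
    rw [integral_integral_swap]
    · refine integral_congr_ae (ae_of_all _ fun t => integral_congr_ae (ae_of_all _ fun y => ?_))
      simp only
      ring_nf
    · refine Integrable.of_bound (by fun_prop) 1 (ae_of_all _ fun p => ?_)
      simp only [Function.uncurry]
      rw [← Complex.ofReal_mul, Complex.norm_exp_ofReal_mul_I]
  have h4 := congrArg norm h1
  rw [Complex.norm_real, Real.norm_of_nonneg (integral_nonneg fun _ => (Real.exp_pos _).le)] at h4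
  rw [h4]
  exact norm_integral_le_integral_norm _

/-- For `|t| ≤ T` the Gaussian density is at most `η⁻¹` and the decay of `f` integrates to `π/β`;
for `|t| > T` only `f ≤ 1` and the Gaussian tail are used. -/
lemma integral_gaussianReal_le_of_le_inv_one_add_sq (f : ℝ → ℝ) (hf0 : ∀ t, 0 ≤ f t)
    (hf1 : ∀ t, f t ≤ 1) (A β T η : ℝ) (hβ : 0 < β) (hT : 0 ≤ T) (hη : 0 < η)
    (hA : ∀ t, |t| ≤ T → f t ≤ A * (1 + (β * t) ^ 2)⁻¹) :
    ∫ t, f t ∂(gaussianReal 0 (Real.toNNReal (η ^ 2))) ≤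
      A * Real.pi * (η⁻¹ / β) + 2 * Real.exp (-(T ^ 2 / (4 * η ^ 2))) := by
  have hA0 : 0 ≤ A := by
    have := (hf0 0).trans (hA 0 (by simpa using hT))
    simpa using this
  have hv : (Real.toNNReal (η ^ 2)) ≠ 0 := by
    simp only [ne_eq, Real.toNNReal_eq_zero, not_le]; positivity
  have hvc : ((Real.toNNReal (η ^ 2) : NNReal) : ℝ) = η ^ 2 := Real.coe_toNNReal _ (by positivity)
  rw [integral_gaussianReal_eq_integral_smul hv]
  set E := Real.exp (-(T ^ 2 / (4 * η ^ 2))) with hE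
  have hi1 : Integrable (fun t : ℝ => (1 + (β * t) ^ 2)⁻¹) :=
    integrable_inv_one_add_sq.comp_mul_left' hβ.ne'
  have hi2 : Integrable (fun t : ℝ => Real.exp (-(1 / (4 * η ^ 2)) * t ^ 2)) :=
    integrable_exp_neg_mul_sq (by positivity)
  have e1 : ∫ t : ℝ, (1 + (β * t) ^ 2)⁻¹ = Real.pi / β := by
    rw [Measure.integral_comp_mul_left (fun t : ℝ => (1 + t ^ 2)⁻¹), integral_univ_inv_one_add_sq,
      abs_of_pos (inv_pos.2 hβ), smul_eq_mul]
    ring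
  have e2 : ∫ t : ℝ, Real.exp (-(1 / (4 * η ^ 2)) * t ^ 2) = 2 * η * √Real.pi := by
    rw [integral_gaussian]
    rw [show Real.pi / (1 / (4 * η ^ 2)) = (2 * η) ^ 2 * Real.pi by field_simp; ring,
      Real.sqrt_mul (by positivity), Real.sqrt_sq (by positivity)]
  have h2pi : (1 : ℝ) ≤ √(2 * Real.pi) := by
    rw [Real.one_le_sqrt]; linarith [Real.pi_gt_three]
  have hsqrt : √(2 * Real.pi * η ^ 2) = √(2 * Real.pi) * η := by
    rw [Real.sqrt_mul (by positivity), Real.sqrt_sq hη.le]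
  have hpt : ∀ t, gaussianPDFReal 0 (Real.toNNReal (η ^ 2)) t • f t ≤
      A * η⁻¹ * (1 + (β * t) ^ 2)⁻¹ +
        E * (√(2 * Real.pi) * η)⁻¹ * Real.exp (-(1 / (4 * η ^ 2)) * t ^ 2) := by
    intro t
    rw [gaussianPDFReal, hvc, hsqrt, smul_eq_mul, sub_zero]
    have hexp1 : Real.exp (-t ^ 2 / (2 * η ^ 2)) ≤ 1 := by
      rw [Real.exp_le_one_iff, neg_div]; have : 0 ≤ t ^ 2 / (2 * η ^ 2) := by positivity
      linarith
    rcases le_or_gt |t| T with ht | ht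
    · have h1 : (√(2 * Real.pi) * η)⁻¹ ≤ η⁻¹ := by
        apply inv_anti₀ hη; nlinarith
      have h3 := hA t ht
      have : (√(2 * Real.pi) * η)⁻¹ * Real.exp (-t ^ 2 / (2 * η ^ 2)) * f t ≤
          η⁻¹ * 1 * (A * (1 + (β * t) ^ 2)⁻¹) := by
        gcongr
        exact hf0 t
      have h5 : 0 ≤ E * (√(2 * Real.pi) * η)⁻¹ * Real.exp (-(1 / (4 * η ^ 2)) * t ^ 2) := by
        positivity
      linarith
    -- Half of the Gaussian exponent pays for the tail factor `E`; the other half stays integrable.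
    · have h1 : Real.exp (-t ^ 2 / (2 * η ^ 2)) ≤ E * Real.exp (-(1 / (4 * η ^ 2)) * t ^ 2) := by
        rw [hE, ← Real.exp_add]
        apply Real.exp_le_exp.2
        have h6 : T ^ 2 ≤ t ^ 2 := by
          rw [← sq_abs t]; gcongr
        have h7 : T ^ 2 / (4 * η ^ 2) ≤ t ^ 2 / (4 * η ^ 2) := by gcongr
        have h8 : -t ^ 2 / (2 * η ^ 2) = - (t ^ 2 / (4 * η ^ 2)) - 1 / (4 * η ^ 2) * t ^ 2 := by
          field_simp; ring
        linarith
      have : (√(2 * Real.pi) * η)⁻¹ * Real.exp (-t ^ 2 / (2 * η ^ 2)) * f t ≤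
          (√(2 * Real.pi) * η)⁻¹ * (E * Real.exp (-(1 / (4 * η ^ 2)) * t ^ 2)) * 1 := by
        gcongr
        · exact hf0 t
        · exact hf1 t
      have h5 : 0 ≤ A * η⁻¹ * (1 + (β * t) ^ 2)⁻¹ := by positivity
      nlinarith
  have hint := integral_mono_of_nonneg (ae_of_all _ fun t => ?_)
    ((hi1.const_mul (A * η⁻¹)).add (hi2.const_mul (E * (√(2 * Real.pi) * η)⁻¹)))
    (ae_of_all volume hpt)
  · refine hint.trans ?_
    simp only [Pi.add_apply]
    rw [integral_add (hi1.const_mul _) (hi2.const_mul _), integral_const_mul,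
      integral_const_mul, e1, e2]
    have h9 : √Real.pi ≤ √(2 * Real.pi) := Real.sqrt_le_sqrt (by linarith [Real.pi_pos])
    have h10 : E * (√(2 * Real.pi) * η)⁻¹ * (2 * η * √Real.pi) ≤ 2 * E := by
      have : (√(2 * Real.pi) * η)⁻¹ * (2 * η * √Real.pi) ≤ 2 := by
        rw [inv_mul_le_iff₀ (by positivity)]
        nlinarith
      have hEp : 0 < E := Real.exp_pos _
      nlinarith
    have h11 : A * η⁻¹ * (Real.pi / β) = A * Real.pi * (η⁻¹ / β) := by ring
    linarith
  · exact mul_nonneg (gaussianPDFReal_nonneg _ _ _) (hf0 t)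

/-- The small ball bound, in Laplace form, for the linear form attached to a vector whose
restriction to `S` stays away from the lattice up to scale `D`. -/
lemma integral_prod_norm_charFun_le {ι : Type*} (μ : Measure ℝ) [IsProbabilityMeasure μ]
    {a b p₀ κ : ℝ} (ha : 0 < a) (hab : a ≤ b) (hp₀ : 0 < p₀) (hp₁ : p₀ ≤ 1 / 4)
    (hp : p₀ ≤ (μ.prod μ).real {p | a ≤ |p.1 - p.2| ∧ |p.1 - p.2| ≤ b})
    (hκ : 1 ≤ 4 * p₀ * κ) (S : Finset ι) (x : ι → ℝ) (s D η : ℝ) (hs : 0 < s) (hD : 0 ≤ D)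
    (hη : 0 < η) (h : ∀ r, |r| * s ≤ D → latticeGap κ (r * s) ≤ latticeDistSq S x r) :
    ∫ t, ∏ i ∈ S, ‖charFun μ (t * x i)‖ ∂(gaussianReal 0 (Real.toNNReal (η⁻¹ ^ 2))) ≤
      (4 * p₀)⁻¹ * Real.pi * (2 * Real.pi * η / (a * s)) +
        2 * Real.exp (-(Real.pi * D * η / (b * s)) ^ 2) := by
  have hb : 0 < b := ha.trans_le hab
  have hκ0 : 0 ≤ κ := by
    by_contra hneg
    push Not at hneg
    nlinarith
  -- The cutoff `T = 2πD/(bs)` keeps the scale `|t z| s / 2π` below `D` for all `|z| ≤ b`, and `β =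
  -- as/2π` is the smallest such scale per unit `|t|` over `|z| ≥ a`. The Gaussian has deviation
  -- `η⁻¹`.
  have := integral_gaussianReal_le_of_le_inv_one_add_sq
    (fun t => ∏ i ∈ S, ‖charFun μ (t * x i)‖)
    (fun t => Finset.prod_nonneg fun _ _ => norm_nonneg _)
    (fun t => Finset.prod_le_one (fun _ _ => norm_nonneg _) fun _ _ => norm_charFun_le_one _)
    (4 * p₀)⁻¹ (a * s / (2 * Real.pi)) (2 * Real.pi * D / (b * s)) η⁻¹ (by positivity)
    (by positivity) (by positivity) ?_
  · refine this.trans_eq ?_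
    have e1 : η⁻¹⁻¹ / (a * s / (2 * Real.pi)) = 2 * Real.pi * η / (a * s) := by
      field_simp
    have e2 : (2 * Real.pi * D / (b * s)) ^ 2 / (4 * η⁻¹ ^ 2)
        = (Real.pi * D * η / (b * s)) ^ 2 := by
      field_simp; ring
    rw [e1, e2]
  · intro t ht
    have h1 := prod_norm_charFun_le μ S x t a b p₀ (latticeGap κ (a * s / (2 * Real.pi) * t))
      (latticeGap_nonneg hκ0) hp fun z hz1 hz2 => ?_
    · refine h1.trans ?_
      have := exp_neg_latticeGap_le (c := 4 * p₀) (κ := κ) (θ := a * s / (2 * Real.pi) * t)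
        (by positivity) (by linarith) hκ
      rwa [neg_mul]
    · have h2 : |t * z / (2 * Real.pi)| * s ≤ D := by
        rw [abs_div, abs_mul, abs_of_pos (show 0 < 2 * Real.pi by positivity), div_mul_eq_mul_div,
          div_le_iff₀ (by positivity)]
        rw [le_div_iff₀ (by positivity)] at ht
        calc |t| * |z| * s ≤ |t| * b * s := by gcongr
          _ = |t| * (b * s) := by ring
          _ ≤ _ := by linarith
      refine (latticeGap_mono hκ0 ?_).trans (h _ h2)
      have h2pi : 0 < 2 * Real.pi := by positivity
      rw [abs_mul, abs_mul, abs_div, abs_div, abs_mul, abs_mul t, abs_of_pos ha, abs_of_pos hs,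
        abs_of_pos h2pi]
      calc a * s / (2 * Real.pi) * |t| ≤ |z| * s / (2 * Real.pi) * |t| := by gcongr
        _ = |t| * |z| / (2 * Real.pi) * s := by ring

/-! ### Independence of the columns and the joint small ball bound. -/

lemma iIndepFun_columns {ι κ Ω : Type*} [Fintype ι] [Fintype κ] [MeasurableSpace Ω]
    {P : Measure Ω} [IsProbabilityMeasure P] {R : Ω → Matrix ι κ ℝ}
    (hind : iIndepFun (fun (p : ι × κ) ω => R ω p.1 p.2) P)
    (hmeas : ∀ i j, Measurable (fun ω => R ω i j)) :
    iIndepFun (fun j ω i => R ω i j) P := by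
  have hprob : ∀ j i, IsProbabilityMeasure (P.map (fun ω => R ω i j)) := fun j i =>
    Measure.isProbabilityMeasure_map (hmeas i j).aemeasurable
  have hswap : iIndepFun (fun (p : κ × ι) (ω : Ω) => R ω p.2 p.1) P :=
    hind.precomp (g := Prod.swap) Prod.swap_injective
  have hcol : ∀ j, iIndepFun (fun i ω => R ω i j) P := fun j =>
    hind.precomp (g := fun i => (i, j)) (Prod.mk_left_injective j)
  rw [iIndepFun_iff_map_fun_eq_infinitePi_map (fun j => measurable_pi_iff.2 fun i => hmeas i j)]
  have h1 := hswap.map_fun_eq_infinitePi_map (fun (p : κ × ι) => hmeas p.2 p.1)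
  have h2 : ∀ j, P.map (fun ω i => R ω i j)
      = Measure.infinitePi fun i => P.map (fun ω => R ω i j) := fun j =>
    (hcol j).map_fun_eq_infinitePi_map (fun i => hmeas i j)
  simp_rw [h2]
  rw [← Measure.infinitePi_map_curry (fun j i => P.map (fun ω => R ω i j)), ← h1,
    Measure.map_map (by fun_prop) (measurable_pi_iff.2 fun (p : κ × ι) => hmeas p.2 p.1)]
  rfl

/-- Markov's inequality for `exp(-v ∑ Y_j² / 2)`, whose expectation factors by independence. -/
lemma measureReal_sum_sq_le_of_iIndepFun {κ Ω : Type*} [MeasurableSpace Ω]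
    {P : Measure Ω} [IsProbabilityMeasure P] {Y : κ → Ω → ℝ} (hind : iIndepFun Y P)
    (hmeas : ∀ j, Measurable (Y j)) (T : Finset κ) (v q N : ℝ) (hq0 : 0 ≤ v)
    (hq : ∀ j ∈ T, ∫ ω, Real.exp (-(v * Y j ω ^ 2 / 2)) ∂P ≤ q) :
    P.real {ω | v * ∑ j ∈ T, Y j ω ^ 2 ≤ N} ≤ Real.exp (N / 2) * q ^ T.card := by
  have hT : iIndepFun (fun j : T => Y j) P := hind.precomp Subtype.val_injective
  have h1 : ∫ ω, ∏ j : T, Real.exp (-(v * Y j ω ^ 2 / 2)) ∂P ≤ q ^ T.card := by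
    rw [hT.integral_fun_prod_comp (f := fun _ y => Real.exp (-(v * y ^ 2 / 2)))
      (fun j => (hmeas j).aemeasurable) (fun j => by fun_prop)]
    calc _ ≤ ∏ j : T, q := by
          refine Finset.prod_le_prod (fun j _ => integral_nonneg fun _ => (Real.exp_pos _).le)
            fun j _ => hq j j.2
      _ = _ := by simp
  have h2 : ∀ ω, ∏ j : T, Real.exp (-(v * Y j ω ^ 2 / 2))
      = Real.exp (-(v * ∑ j ∈ T, Y j ω ^ 2) / 2) := by
    intro ω
    rw [← Real.exp_sum]
    congr 1
    rw [Finset.univ_eq_attach, Finset.sum_attach T (fun j => -(v * Y j ω ^ 2 / 2)),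
      Finset.mul_sum, neg_div, Finset.sum_div, Finset.sum_neg_distrib]
  have hms : Measurable fun ω => Real.exp (-(v * ∑ j ∈ T, Y j ω ^ 2) / 2) := by
    have : Measurable fun ω => ∑ j ∈ T, Y j ω ^ 2 :=
      Finset.measurable_fun_sum _ fun j _ => (hmeas j).pow_const 2
    fun_prop
  have hint : Integrable (fun ω => Real.exp (-(v * ∑ j ∈ T, Y j ω ^ 2) / 2)) P := by
    refine Integrable.of_bound hms.aestronglyMeasurable 1 (ae_of_all _ fun ω => ?_)
    rw [Real.norm_of_nonneg (Real.exp_pos _).le, Real.exp_le_one_iff]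
    have : 0 ≤ ∑ j ∈ T, Y j ω ^ 2 := Finset.sum_nonneg fun _ _ => sq_nonneg _
    nlinarith [mul_nonneg hq0 this]
  have h3 := mul_meas_ge_le_integral_of_nonneg (μ := P)
    (ae_of_all _ fun ω => (Real.exp_pos (-(v * ∑ j ∈ T, Y j ω ^ 2) / 2)).le) hint
    (Real.exp (-(N / 2)))
  simp_rw [h2] at h1
  have h4 : {ω | v * ∑ j ∈ T, Y j ω ^ 2 ≤ N}
      = {ω | Real.exp (-(N / 2)) ≤ Real.exp (-(v * ∑ j ∈ T, Y j ω ^ 2) / 2)} := by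
    ext ω
    simp only [Set.mem_ofPred_eq, Real.exp_le_exp]
    constructor <;> intro h <;> linarith
  rw [h4]
  have h5 := h3.trans h1
  rw [Real.exp_neg (N / 2), inv_mul_le_iff₀ (Real.exp_pos _), ← Real.exp_neg] at h5
  exact h5

/-- The deterministic shift only contributes a phase, so `M` plays no role in the small ball bound.
The factors outside `S` are bounded by one. -/
lemma norm_charFun_linearForm_le {ι Ω : Type*} [Fintype ι] [MeasurableSpace Ω]
    {P : Measure Ω} [IsProbabilityMeasure P] {μ : Measure ℝ} [IsProbabilityMeasure μ] {X : ι → Ω → ℝ}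
    (hind : iIndepFun X P) (hmeas : ∀ i, Measurable (X i)) (hμ : ∀ i, P.map (X i) = μ)
    (m x : ι → ℝ) (S : Finset ι) (t : ℝ) :
    ‖charFun (P.map fun ω => ∑ i, (X i ω + m i) * x i) t‖
      ≤ ∏ i ∈ S, ‖charFun μ (t * x i)‖ := by
  have hind' : iIndepFun (fun i ω => (X i ω + m i) * x i) P :=
    hind.comp (fun i y => (y + m i) * x i) (fun i => by fun_prop)
  have hprob : ∀ i, IsProbabilityMeasure (P.map (X i)) := fun i =>
    Measure.isProbabilityMeasure_map (hmeas i).aemeasurable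
  rw [hind'.charFun_map_fun_sum_eq_prod
    (fun i => (((hmeas i).add_const _).mul_const _).aemeasurable), Finset.prod_apply, norm_prod]
  have h1 : ∀ i, ‖charFun (P.map fun ω => (X i ω + m i) * x i) t‖ = ‖charFun μ (t * x i)‖ := by
    intro i
    have e1 : (fun ω => (X i ω + m i) * x i) = fun ω => x i * (X i ω + m i) := by
      ext; ring
    rw [e1, charFun_map_mul_comp ((hmeas i).add_const _).aemeasurable]
    have e2 : P.map (fun ω => X i ω + m i) = (P.map (X i)).map (fun y => y + m i) := by
      rw [Measure.map_map (by fun_prop) (hmeas i)]; rfl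
    rw [e2, charFun_map_add_const, hμ, norm_mul, mul_comm (x i)]
    have : ‖Complex.exp (((inner ℝ (m i) (t * x i) : ℝ) : ℂ) * Complex.I)‖ = 1 :=
      Complex.norm_exp_ofReal_mul_I _
    simp only [this, mul_one]
  simp_rw [h1]
  exact Finset.prod_le_prod_of_subset_of_le_one (Finset.subset_univ S) (fun _ _ => norm_nonneg _)
    fun _ _ _ => norm_charFun_le_one _

lemma measureReal_sum_linearForm_sq_le {ι κ Ω : Type*} [Fintype ι] [Fintype κ]
    [MeasurableSpace Ω] {P : Measure Ω} [IsProbabilityMeasure P] {μ : Measure ℝ}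
    [IsProbabilityMeasure μ] {R : Ω → Matrix ι κ ℝ}
    (hind : iIndepFun (fun (p : ι × κ) ω => R ω p.1 p.2) P)
    (hmeas : ∀ i j, Measurable (fun ω => R ω i j)) (hμ : ∀ i j, P.map (fun ω => R ω i j) = μ)
    (M : Matrix ι κ ℝ) {a b p₀ c : ℝ} (ha : 0 < a) (hab : a ≤ b) (hp₀ : 0 < p₀) (hp₁ : p₀ ≤ 1 / 4)
    (hp : p₀ ≤ (μ.prod μ).real {p | a ≤ |p.1 - p.2| ∧ |p.1 - p.2| ≤ b})
    (hc : 1 ≤ 4 * p₀ * c) (S : Finset ι) (x : ι → ℝ) (s D η : ℝ) (hs : 0 < s) (hD : 0 ≤ D)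
    (hη : 0 < η) (h : ∀ r, |r| * s ≤ D → latticeGap c (r * s) ≤ latticeDistSq S x r)
    (T : Finset κ) (N : ℝ) :
    P.real {ω | ∑ j ∈ T, (∑ i, (R ω i j + M i j) * x i) ^ 2 ≤ N * η ^ 2} ≤
      Real.exp (N / 2) * ((4 * p₀)⁻¹ * Real.pi * (2 * Real.pi * η / (a * s)) +
        2 * Real.exp (-(Real.pi * D * η / (b * s)) ^ 2)) ^ T.card := by
  have hcols : iIndepFun (fun j ω => ∑ i, (R ω i j + M i j) * x i) P :=
    (iIndepFun_columns hind hmeas).comp (fun j (y : ι → ℝ) => ∑ i, (y i + M i j) * x i)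
      (fun j => by fun_prop)
  have hYm : ∀ j, Measurable fun ω => ∑ i, (R ω i j + M i j) * x i := fun j =>
    Finset.measurable_fun_sum _ fun i _ => ((hmeas i j).add_const _).mul_const _
  have hv : ((Real.toNNReal (η⁻¹ ^ 2) : NNReal) : ℝ) = η⁻¹ ^ 2 := Real.coe_toNNReal _ (by positivity)
  refine (measureReal_mono (fun ω hω => ?_)).trans
    (measureReal_sum_sq_le_of_iIndepFun hcols hYm T (η⁻¹ ^ 2) _ N (by positivity) fun j _ => ?_)
  · simp only [Set.mem_ofPred_eq] at hω ⊢
    rw [inv_pow, inv_mul_le_iff₀ (by positivity)]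
    linarith
  · have h1 := integral_exp_neg_sq_le_integral_norm_charFun P _ (hYm j) (Real.toNNReal (η⁻¹ ^ 2))
    rw [hv] at h1
    refine h1.trans (le_trans ?_
      (integral_prod_norm_charFun_le μ ha hab hp₀ hp₁ hp hc S x s D η hs hD hη h))
    have hY : IsProbabilityMeasure (P.map fun ω => ∑ i, (R ω i j + M i j) * x i) :=
      Measure.isProbabilityMeasure_map (hYm j).aemeasurable
    refine integral_mono ?_ ?_ fun t => ?_
    · exact Integrable.of_bound (by fun_prop) 1 (ae_of_all _ fun t => by
        simpa using norm_charFun_le_one _)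
    · refine Integrable.of_bound (by fun_prop) 1 (ae_of_all _ fun t => ?_)
      rw [Real.norm_of_nonneg (Finset.prod_nonneg fun _ _ => norm_nonneg _)]
      exact Finset.prod_le_one (fun _ _ => norm_nonneg _) fun _ _ => norm_charFun_le_one _
    · exact norm_charFun_linearForm_le (hind.precomp (g := fun i => (i, j))
        (Prod.mk_left_injective j)) (fun i => hmeas i j) (fun i => hμ i j) (fun i => M i j) x S t

/-! ### Subgaussian tails and moment generating functions. -/

/-- Isolates a linear term, which a centered variable integrates to zero. -/
lemma exp_le_add_exp_sq (x : ℝ) : Real.exp x ≤ x + Real.exp (x ^ 2) := by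
  have h1 := Real.add_one_le_exp (x ^ 2)
  rcases le_or_gt |x| 1 with h | h
  · have := abs_le.1 (Real.abs_exp_sub_one_sub_id_le h)
    linarith
  · rcases lt_abs.1 h with h | h
    · have : Real.exp x ≤ Real.exp (x ^ 2) := Real.exp_le_exp.2 (by nlinarith)
      linarith
    · have : Real.exp x ≤ 1 := Real.exp_le_one_iff.2 (by linarith)
      nlinarith

lemma IsSubgaussian.exists_integrable_exp_sq {Ω : Type*} [MeasurableSpace Ω] {P : Measure Ω}
    [IsProbabilityMeasure P] {ξ : Ω → ℝ} (hξ : Measurable ξ) (hsub : IsSubgaussian P ξ) :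
    ∃ α : ℝ, 0 < α ∧ Integrable (fun ω => Real.exp (α * ξ ω ^ 2)) P := by
  obtain ⟨B, hB, htail⟩ := hsub
  -- Half the tail exponent: in the layer-cake integral, `exp(-t²/B²)` beats `exp(α t²)` and leaves
  -- `exp(-α t²)`.
  refine ⟨1 / (2 * B ^ 2), by positivity, ?_⟩
  set α : ℝ := 1 / (2 * B ^ 2) with hα
  have hα0 : 0 < α := by positivity
  have hderiv : ∀ x : ℝ, HasDerivAt (fun x => Real.exp (α * x ^ 2))
      (2 * α * x * Real.exp (α * x ^ 2)) x := by
    intro x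
    have := ((hasDerivAt_pow 2 x).const_mul α).exp
    convert this using 1
    simp; ring
  have hcont : Continuous fun x : ℝ => 2 * α * x * Real.exp (α * x ^ 2) := by fun_prop
  have hG : ∀ t : ℝ, ∫ x in (0 : ℝ)..t, 2 * α * x * Real.exp (α * x ^ 2)
      = Real.exp (α * t ^ 2) - 1 := by
    intro t
    rw [intervalIntegral.integral_eq_sub_of_hasDerivAt (fun x _ => hderiv x)
      (hcont.intervalIntegrable _ _)]
    simp
  have hlc := lintegral_comp_eq_lintegral_meas_lt_mul P (f := fun ω => |ξ ω|)
    (g := fun x => 2 * α * x * Real.exp (α * x ^ 2)) (ae_of_all _ fun ω => abs_nonneg _)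
    (hξ.norm.aemeasurable) (fun t _ => hcont.intervalIntegrable _ _)
    (by
      filter_upwards [ae_restrict_mem measurableSet_Ioi] with t ht
      have : (0 : ℝ) < t := ht
      positivity)
  simp_rw [hG, sq_abs] at hlc
  have hfin : ∫⁻ t in Set.Ioi (0 : ℝ), P {a | t < |ξ a|} *
      ENNReal.ofReal (2 * α * t * Real.exp (α * t ^ 2)) < ⊤ := by
    have hle : ∀ t ∈ Set.Ioi (0 : ℝ), P {a | t < |ξ a|} *
        ENNReal.ofReal (2 * α * t * Real.exp (α * t ^ 2)) ≤
        ENNReal.ofReal (4 * α * (t * Real.exp (-α * t ^ 2))) := by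
      intro t ht
      have ht0 : (0 : ℝ) < t := ht
      have h1 : P {a | t < |ξ a|} ≤ ENNReal.ofReal (2 * Real.exp (-t ^ 2 / B ^ 2)) := by
        rw [← ofReal_measureReal]
        exact ENNReal.ofReal_le_ofReal (htail t ht0)
      calc _ ≤ ENNReal.ofReal (2 * Real.exp (-t ^ 2 / B ^ 2)) *
            ENNReal.ofReal (2 * α * t * Real.exp (α * t ^ 2)) := by gcongr
        _ = _ := by
          rw [← ENNReal.ofReal_mul (by positivity)]
          congr 1
          have : Real.exp (-α * t ^ 2) = Real.exp (-t ^ 2 / B ^ 2) * Real.exp (α * t ^ 2) := by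
            rw [← Real.exp_add]; congr 1; rw [hα]; field_simp; ring
          rw [this]; ring
    refine (setLIntegral_mono (by fun_prop) hle).trans_lt ?_
    have hint : Integrable fun t : ℝ => 4 * α * (t * Real.exp (-α * t ^ 2)) :=
      (integrable_mul_exp_neg_mul_sq hα0).const_mul _
    exact (setLIntegral_le_lintegral _ _).trans_lt (by
      refine lt_of_le_of_lt (lintegral_mono fun t => ?_) hint.2
      exact Real.ofReal_le_enorm _)
  have hint1 : Integrable (fun ω => Real.exp (α * ξ ω ^ 2) - 1) P := by
    refine ⟨by fun_prop, ?_⟩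
    rw [hasFiniteIntegral_iff_ofReal (ae_of_all _ fun ω => ?_)]
    · rw [hlc]; exact hfin
    · have : 0 ≤ α * ξ ω ^ 2 := by positivity
      simpa using this
  refine (hint1.add (integrable_const (1 : ℝ))).congr (ae_of_all _ fun ω => ?_)
  simp

/-- With `u = t²/α`: for `u ≤ 1`, `exp_le_add_exp_sq` and convexity give `exp(tξ) ≤ tξ + (1 - u) + u
exp(αξ²)`, and the mean kills the linear term. For `u > 1`, `tξ ≤ αξ² + t²/(4α)` suffices. Both are
below `exp((I + 1) u)`, hence the variance proxy `2(I + 1)/α`. -/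
lemma IsSubgaussian.exists_hasSubgaussianMGF {Ω : Type*} [MeasurableSpace Ω] {P : Measure Ω}
    [IsProbabilityMeasure P] {ξ : Ω → ℝ} (hξ : Measurable ξ) (hsub : IsSubgaussian P ξ)
    (hmean : ∫ ω, ξ ω ∂P = 0) : ∃ c : NNReal, 0 < c ∧ HasSubgaussianMGF ξ c P := by
  obtain ⟨α, hα, hint⟩ := hsub.exists_integrable_exp_sq hξ
  set I := ∫ ω, Real.exp (α * ξ ω ^ 2) ∂P with hI
  have hI1 : 1 ≤ I := by
    have : ∫ ω, (1 : ℝ) ∂P ≤ I := integral_mono (integrable_const _) hint fun ω =>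
      Real.one_le_exp (by positivity)
    simpa using this
  have hpt : ∀ t y : ℝ, t * y ≤ α * y ^ 2 + t ^ 2 / (4 * α) := by
    intro t y
    have : α * y ^ 2 + t ^ 2 / (4 * α) - t * y = α * (y - t / (2 * α)) ^ 2 := by
      field_simp; ring
    nlinarith [mul_nonneg hα.le (sq_nonneg (y - t / (2 * α)))]
  have hdom : ∀ t y : ℝ, Real.exp (t * y) ≤ Real.exp (t ^ 2 / (4 * α)) * Real.exp (α * y ^ 2) := by
    intro t y
    rw [← Real.exp_add]
    exact Real.exp_le_exp.2 (by linarith [hpt t y])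
  have hexp : ∀ t : ℝ, Integrable (fun ω => Real.exp (t * ξ ω)) P := by
    intro t
    refine (hint.const_mul (Real.exp (t ^ 2 / (4 * α)))).mono' (by fun_prop) (ae_of_all _ fun ω => ?_)
    rw [Real.norm_of_nonneg (Real.exp_pos _).le]
    exact hdom _ _
  have hξint : Integrable ξ P := by
    refine (hint.const_mul (1 + 1 / α)).mono' (by fun_prop) (ae_of_all _ fun ω => ?_)
    have h1 := Real.add_one_le_exp (α * ξ ω ^ 2)
    have h2 : |ξ ω| ≤ 1 + ξ ω ^ 2 := by
      rw [abs_le]; constructor <;> nlinarith [sq_nonneg (ξ ω + 1), sq_nonneg (ξ ω - 1)]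
    have h3 : ξ ω ^ 2 = 1 / α * (α * ξ ω ^ 2) := by field_simp
    have h4 : 0 < 1 / α := by positivity
    have h5 : 0 ≤ α * ξ ω ^ 2 := by positivity
    rw [Real.norm_eq_abs]
    nlinarith
  refine ⟨Real.toNNReal (2 * ((I + 1) / α)), Real.toNNReal_pos.2 (by positivity), hexp,
    fun t => ?_⟩
  rw [Real.coe_toNNReal _ (by positivity), mgf]
  have hexpo : 2 * ((I + 1) / α) * t ^ 2 / 2 = (I + 1) * (t ^ 2 / α) := by ring
  rw [hexpo]
  set u := t ^ 2 / α with hu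
  have hu0 : 0 ≤ u := by positivity
  rcases le_or_gt u 1 with h | h
  · have hpw : ∀ ω, Real.exp (t * ξ ω) ≤ t * ξ ω + ((1 - u) + u * Real.exp (α * ξ ω ^ 2)) := by
      intro ω
      refine (exp_le_add_exp_sq _).trans ?_
      have h1 := convexOn_exp.2 (Set.mem_univ 0) (Set.mem_univ (α * ξ ω ^ 2))
        (sub_nonneg.2 h) hu0 (by ring)
      simp only [smul_eq_mul, mul_zero, zero_add, Real.exp_zero, mul_one] at h1
      have h2 : u * (α * ξ ω ^ 2) = (t * ξ ω) ^ 2 := by rw [hu]; field_simp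
      rw [h2] at h1
      linarith
    have h3 : Integrable (fun ω => (1 - u) + u * Real.exp (α * ξ ω ^ 2)) P :=
      (integrable_const _).add (hint.const_mul u)
    calc ∫ ω, Real.exp (t * ξ ω) ∂P
        ≤ ∫ ω, (t * ξ ω + ((1 - u) + u * Real.exp (α * ξ ω ^ 2))) ∂P :=
          integral_mono (hexp t) ((hξint.const_mul t).add h3) hpw
      _ = (1 - u) + u * I := by
          rw [integral_add (hξint.const_mul t) h3, integral_const_mul, hmean,
            integral_add (integrable_const _) (hint.const_mul u), integral_const_mul, ← hI]
          simp
      _ ≤ Real.exp ((I + 1) * u) := by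
          have := Real.add_one_le_exp ((I + 1) * u)
          nlinarith
  · calc ∫ ω, Real.exp (t * ξ ω) ∂P
        ≤ ∫ ω, Real.exp (t ^ 2 / (4 * α)) * Real.exp (α * ξ ω ^ 2) ∂P :=
          integral_mono (hexp t) (hint.const_mul _) fun ω => hdom _ _
      _ = Real.exp (t ^ 2 / (4 * α)) * I := integral_const_mul _ _
      _ ≤ Real.exp (t ^ 2 / (4 * α)) * Real.exp I := by
          gcongr
          linarith [Real.add_one_le_exp I]
      _ ≤ Real.exp ((I + 1) * u) := by
          rw [← Real.exp_add]
          apply Real.exp_le_exp.2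
          have : t ^ 2 / (4 * α) = u / 4 := by rw [hu]; field_simp
          nlinarith

/-! ### Counting integer points. -/

lemma sum_Icc_pow_natAbs_le {q : ℝ} (hq0 : 0 ≤ q) (hq1 : q < 1) (B : ℕ) :
    ∑ m ∈ Finset.Icc (-(B : ℤ)) B, q ^ m.natAbs ≤ 2 / (1 - q) := by
  have h1 : ∑ m ∈ Finset.Icc (-(B : ℤ)) B, q ^ m.natAbs ≤ 2 * ∑ k ∈ Finset.range (B + 1), q ^ k := by
    induction B with
    | zero => simp
    | succ B ih =>
      have e : Finset.Icc (-((B + 1 : ℕ) : ℤ)) ((B + 1 : ℕ) : ℤ) =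
          insert (-((B + 1 : ℕ) : ℤ)) (insert ((B + 1 : ℕ) : ℤ) (Finset.Icc (-(B : ℤ)) B)) := by
        ext m
        simp only [Finset.mem_Icc, Finset.mem_insert]
        push_cast
        omega
      rw [e, Finset.sum_insert, Finset.sum_insert, Finset.sum_range_succ, Int.natAbs_neg,
        Int.natAbs_natCast]
      · linarith
      · simp
      · simp only [Finset.mem_insert, Finset.mem_Icc]; push_cast; omega
  have h2 : ∑ k ∈ Finset.range (B + 1), q ^ k ≤ (1 - q)⁻¹ := by
    rw [← tsum_geometric_of_lt_one hq0 hq1]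
    exact (summable_geometric_of_lt_one hq0 hq1).sum_le_tsum _ (fun _ _ => by positivity)
  calc _ ≤ _ := h1
    _ ≤ 2 * (1 - q)⁻¹ := by gcongr
    _ = _ := by ring

/-- The integer points whose restriction to `S` has `ℓ¹` norm at most `A` and whose remaining
coordinates are at most `B`. -/
noncomputable def latticeBox {n : ℕ} (S : Finset (Fin n)) (A : ℝ) (B : ℕ) :
    Finset (Fin n → ℤ) := by
  classical
  exact (Fintype.piFinset fun i => if i ∈ S then Finset.Icc (-(⌊A⌋₊ : ℤ)) ⌊A⌋₊
    else Finset.Icc (-(B : ℤ)) B).filter fun p => ∑ i ∈ S, |(p i : ℝ)| ≤ A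

lemma mem_latticeBox {n : ℕ} {S : Finset (Fin n)} {A : ℝ} {B : ℕ} {p : Fin n → ℤ}
    (h1 : ∑ i ∈ S, |(p i : ℝ)| ≤ A) (h2 : ∀ i ∉ S, |p i| ≤ B) : p ∈ latticeBox S A B := by
  classical
  rw [latticeBox, Finset.mem_filter, Fintype.mem_piFinset]
  refine ⟨fun i => ?_, h1⟩
  split_ifs with hi
  · rw [Finset.mem_Icc, ← abs_le]
    have h3 : |(p i : ℝ)| ≤ A :=
      (Finset.single_le_sum (f := fun i => |(p i : ℝ)|) (fun _ _ => abs_nonneg _) hi).trans h1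
    have h4 : ((p i).natAbs : ℝ) ≤ A := by rwa [Nat.cast_natAbs, Int.cast_abs]
    have h5 := Nat.le_floor h4
    rw [Int.abs_eq_natAbs]
    exact_mod_cast h5
  · rw [Finset.mem_Icc, ← abs_le]
    exact h2 i hi

/-- Chernoff-type counting: with weight `exp(-(n/A) ∑_S |p_i|)` every counted point weighs at least
`e^{-n}`, while the total weight is at most a product of geometric series. No volume comparison is
needed, so the bound also works when `A/n` is small. -/
lemma card_latticeBox_le {n : ℕ} (hn : 0 < n) (S : Finset (Fin n)) {A : ℝ} (hA : 0 < A) (B : ℕ) :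
    ((latticeBox S A B).card : ℝ) ≤
      Real.exp n * (2 * (1 + A / n)) ^ S.card * (2 * B + 1) ^ Sᶜ.card := by
  classical
  have hn' : (0 : ℝ) < n := Nat.cast_pos.2 hn
  set a : ℝ := n / A with ha
  have ha0 : 0 < a := by positivity
  set q : ℝ := Real.exp (-a) with hq
  have hq1 : q < 1 := Real.exp_lt_one_iff.2 (by linarith)
  let w : Fin n → ℤ → ℝ := fun i m => if i ∈ S then q ^ m.natAbs else 1
  have hw0 : ∀ i m, 0 ≤ w i m := fun i m => by
    simp only [w]; split_ifs <;> positivity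
  have hgeo : 2 / (1 - q) ≤ 2 * (1 + A / n) := by
    rw [div_le_iff₀ (by linarith)]
    have h1 : q * (1 + a) ≤ 1 := by
      rw [hq, Real.exp_neg, inv_mul_le_iff₀ (Real.exp_pos _), mul_one]
      linarith [Real.add_one_le_exp a]
    have h2 : A / n * a = 1 := by rw [ha]; field_simp
    have h3 : 0 < A / n := by positivity
    have h4 : A / n * (q * (1 + a)) ≤ A / n := by nlinarith
    have h5 : A / n * (q * (1 + a)) = q * (A / n) + q * (A / n * a) := by ring
    rw [h2] at h5
    nlinarith
  have h1 : ∀ p ∈ latticeBox S A B, Real.exp (-n) ≤ ∏ i, w i (p i) := by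
    intro p hp
    have hp2 : ∑ i ∈ S, |(p i : ℝ)| ≤ A := (Finset.mem_filter.1 hp).2
    have e : ∏ i, w i (p i) = Real.exp (-(a * ∑ i ∈ S, |(p i : ℝ)|)) := by
      simp only [w]
      rw [Finset.prod_ite, Finset.prod_const_one, mul_one, Finset.filter_mem_eq_inter,
        Finset.univ_inter, Finset.mul_sum, ← Finset.sum_neg_distrib, Real.exp_sum]
      refine Finset.prod_congr rfl fun i _ => ?_
      rw [hq, ← Real.exp_nat_mul, Nat.cast_natAbs, Int.cast_abs]
      congr 1; ring
    rw [e]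
    apply Real.exp_le_exp.2
    have : a * ∑ i ∈ S, |(p i : ℝ)| ≤ a * A := by gcongr
    have e2 : a * A = n := by rw [ha]; field_simp
    linarith
  have h2 : Real.exp (-n) * (latticeBox S A B).card ≤
      (2 * (1 + A / n)) ^ S.card * (2 * B + 1) ^ Sᶜ.card := by
    calc Real.exp (-n) * (latticeBox S A B).card
        = ∑ p ∈ latticeBox S A B, Real.exp (-n) := by rw [Finset.sum_const, nsmul_eq_mul, mul_comm]
      _ ≤ ∑ p ∈ latticeBox S A B, ∏ i, w i (p i) := Finset.sum_le_sum h1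
      _ ≤ ∑ p ∈ Fintype.piFinset (fun i => if i ∈ S then Finset.Icc (-(⌊A⌋₊ : ℤ)) ⌊A⌋₊
            else Finset.Icc (-(B : ℤ)) B), ∏ i, w i (p i) := by
          refine Finset.sum_le_sum_of_subset_of_nonneg (Finset.filter_subset _ _) fun p _ _ =>
            Finset.prod_nonneg fun i _ => hw0 i _
      _ = ∏ i, ∑ m ∈ (if i ∈ S then Finset.Icc (-(⌊A⌋₊ : ℤ)) ⌊A⌋₊
            else Finset.Icc (-(B : ℤ)) B), w i m := by rw [Finset.prod_univ_sum]
      _ ≤ ∏ i, (if i ∈ S then 2 * (1 + A / n) else (2 * B + 1 : ℝ)) := by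
          refine Finset.prod_le_prod (fun i _ => Finset.sum_nonneg fun _ _ => hw0 _ _) fun i _ => ?_
          by_cases hi : i ∈ S
          · simp only [hi, if_true, w]
            exact (sum_Icc_pow_natAbs_le (Real.exp_pos _).le hq1 _).trans hgeo
          · simp only [hi, if_false, w, Finset.sum_const, Int.card_Icc, nsmul_eq_mul, mul_one]
            have : ((B : ℤ) + 1 - -(B : ℤ)).toNat = 2 * B + 1 := by omega
            rw [this]; push_cast; exact le_rfl
      _ = _ := by
          rw [Finset.prod_ite, Finset.prod_const, Finset.prod_const]
          congr 3
          · simp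
          · rw [← Finset.compl_filter]; simp
  rw [Real.exp_neg, inv_mul_le_iff₀ (Real.exp_pos _)] at h2
  linarith

/-! ### The operator norm of the random matrix. -/

lemma sum_abs_le_sqrt_mul {n : ℕ} (x : EuclideanSpace ℝ (Fin n)) :
    ∑ i, |x i| ≤ √n * ‖x‖ := by
  have h := sq_sum_le_card_mul_sum_sq (s := Finset.univ) (f := fun i => |x i|)
  rw [EuclideanSpace.norm_eq, ← Real.sqrt_mul (by positivity)]
  apply Real.le_sqrt_of_sq_le
  simpa using h

lemma norm_le_sqrt_mul_of_abs_le {n : ℕ} (x : EuclideanSpace ℝ (Fin n)) {c : ℝ} (hc : 0 ≤ c)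
    (h : ∀ i, |x i| ≤ c) : ‖x‖ ≤ √n * c := by
  rw [EuclideanSpace.norm_eq]
  apply Real.sqrt_le_iff.2 ⟨by positivity, ?_⟩
  rw [mul_pow, Real.sq_sqrt (by positivity)]
  calc ∑ i, ‖x i‖ ^ 2 ≤ ∑ i : Fin n, c ^ 2 := by
        refine Finset.sum_le_sum fun i _ => ?_
        rw [Real.norm_eq_abs]; gcongr; exact h i
    _ = _ := by simp

/-- The point of the scaled lattice `h ℤⁿ` with integer coordinates `p`. -/
noncomputable def scaledLatticePoint {n : ℕ} (h : ℝ) (p : Fin n → ℤ) : EuclideanSpace ℝ (Fin n) :=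
  WithLp.toLp 2 fun i => h * p i

/-- Rounding at mesh `h = 1/(2√n)` moves a vector by at most `√n h/2 = 1/4`. The rounded vector has
norm at most `5/4`, and `ℓ¹ ≤ √n ℓ²` puts its integer coordinates in the `ℓ¹` ball of radius `5n/2`.
Since `S` is everything, the bound `0` on the other coordinates is vacuous. -/
lemma exists_scaledLatticePoint {n : ℕ} (hn : 0 < n) (x : EuclideanSpace ℝ (Fin n))
    (hx : ‖x‖ = 1) : ∃ p ∈ latticeBox (n := n) Finset.univ (5 / 2 * n) 0,
      ‖x - scaledLatticePoint (2 * √n)⁻¹ p‖ ≤ 1 / 4 ∧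
      ‖scaledLatticePoint (2 * √n)⁻¹ p‖ ≤ 5 / 4 := by
  have hn' : (0 : ℝ) < n := Nat.cast_pos.2 hn
  have hsn : 0 < √(n : ℝ) := Real.sqrt_pos.2 hn'
  set h : ℝ := (2 * √n)⁻¹ with hh
  have hh0 : 0 < h := by positivity
  set p : Fin n → ℤ := fun i => round (x i / h)
  have h1 : ‖x - scaledLatticePoint h p‖ ≤ 1 / 4 := by
    have := norm_le_sqrt_mul_of_abs_le (x - scaledLatticePoint h p) (c := h / 2) (by positivity)
      (fun i => by
        have h2 := abs_sub_round (x i / h)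
        have h3 : (x - scaledLatticePoint h p) i = h * (x i / h - p i) := by
          simp only [scaledLatticePoint, PiLp.sub_apply]; field_simp
        rw [h3, abs_mul, abs_of_pos hh0]
        calc h * |x i / h - p i| ≤ h * (1 / 2) := by gcongr
          _ = h / 2 := by ring)
    refine this.trans_eq ?_
    rw [hh]; field_simp; norm_num
  have h2 : ‖scaledLatticePoint h p‖ ≤ 5 / 4 := by
    have : scaledLatticePoint h p = x - (x - scaledLatticePoint h p) := by abel
    rw [this]
    refine (norm_sub_le _ _).trans ?_
    rw [hx]; linarith
  refine ⟨p, mem_latticeBox ?_ (by simp), h1, h2⟩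
  have h3 := sum_abs_le_sqrt_mul (scaledLatticePoint h p)
  have h4 : ∑ i, |(scaledLatticePoint h p) i| = h * ∑ i, |(p i : ℝ)| := by
    rw [Finset.mul_sum]
    refine Finset.sum_congr rfl fun i _ => ?_
    simp only [scaledLatticePoint]
    rw [abs_mul, abs_of_pos hh0]
  rw [h4] at h3
  have h5 : h * ∑ i, |(p i : ℝ)| ≤ √n * (5 / 4) := h3.trans (by gcongr)
  rw [hh, inv_mul_le_iff₀ (by positivity)] at h5
  have h6 : 2 * √(n : ℝ) * (√n * (5 / 4)) = 5 / 2 * n := by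
    rw [show 2 * √(n : ℝ) * (√n * (5 / 4)) = 5 / 2 * (√n * √n) by ring, Real.mul_self_sqrt hn'.le]
  linarith

/-- Replacing both unit vectors by net points costs `(1/4)(5/4) + 1/4 = 9/16` of the norm, so `‖A‖ ≤
(16/7) B`. -/
lemma norm_le_of_inner_scaledLatticePoint_le {n : ℕ} (hn : 0 < n)
    (A : EuclideanSpace ℝ (Fin n) →L[ℝ] EuclideanSpace ℝ (Fin n)) (B : ℝ) (hB : 0 ≤ B)
    (h : ∀ p ∈ latticeBox (n := n) Finset.univ (5 / 2 * n) 0,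
      ∀ q ∈ latticeBox (n := n) Finset.univ (5 / 2 * n) 0,
      ‖scaledLatticePoint (2 * √n)⁻¹ p‖ ≤ 5 / 4 → ‖scaledLatticePoint (2 * √n)⁻¹ q‖ ≤ 5 / 4 →
      inner ℝ (scaledLatticePoint (2 * √n)⁻¹ p) (A (scaledLatticePoint (2 * √n)⁻¹ q)) ≤ B) :
    ‖A‖ ≤ 3 * B := by
  have key : ∀ x y : EuclideanSpace ℝ (Fin n), ‖x‖ = 1 → ‖y‖ = 1 →
      inner ℝ y (A x) ≤ B + 9 / 16 * ‖A‖ := by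
    intro x y hx hy
    obtain ⟨p, hp, hp1, hp2⟩ := exists_scaledLatticePoint hn y hy
    obtain ⟨q, hq, hq1, hq2⟩ := exists_scaledLatticePoint hn x hx
    set u := scaledLatticePoint (2 * √n)⁻¹ p
    set w := scaledLatticePoint (2 * √n)⁻¹ q
    have e : inner ℝ y (A x) = inner ℝ u (A w) + inner ℝ (y - u) (A w) + inner ℝ y (A (x - w)) := by
      rw [map_sub, inner_sub_right, inner_sub_left]; ring
    have h1 : inner ℝ u (A w) ≤ B := h p hp q hq hp2 hq2
    have h2 : inner ℝ (y - u) (A w) ≤ 1 / 4 * (‖A‖ * (5 / 4)) :=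
      (real_inner_le_norm _ _).trans (by
        gcongr
        exact (A.le_opNorm _).trans (by gcongr))
    have h3 : inner ℝ y (A (x - w)) ≤ 1 * (‖A‖ * (1 / 4)) :=
      (real_inner_le_norm _ _).trans (by
        rw [hy]
        gcongr
        exact (A.le_opNorm _).trans (by gcongr))
    linarith
  have h2 : ‖A‖ ≤ B + 9 / 16 * ‖A‖ := by
    refine A.opNorm_le_bound (by positivity) fun x => ?_
    by_cases hx : x = 0
    · simp [hx]
    by_cases hAx : A x = 0
    · rw [hAx, norm_zero]; positivity
    have hx' : 0 < ‖x‖ := norm_pos_iff.2 hx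
    have hAx' : 0 < ‖A x‖ := norm_pos_iff.2 hAx
    have := key (‖x‖⁻¹ • x) (‖A x‖⁻¹ • A x) (norm_smul_inv_norm (𝕜 := ℝ) hx)
      (norm_smul_inv_norm (𝕜 := ℝ) hAx)
    rw [map_smul, inner_smul_left, inner_smul_right, real_inner_self_eq_norm_sq] at this
    have e : (starRingEnd ℝ) ‖A x‖⁻¹ * (‖x‖⁻¹ * ‖A x‖ ^ 2) = ‖A x‖ / ‖x‖ := by
      simp only [conj_trivial]; field_simp
    rw [e, div_le_iff₀ hx'] at this
    exact this
  linarith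

lemma HasSubgaussianMGF.mono {Ω : Type*} [MeasurableSpace Ω] {P : Measure Ω} {X : Ω → ℝ}
    {c c' : NNReal} (h : HasSubgaussianMGF X c P) (hc : c ≤ c') : HasSubgaussianMGF X c' P :=
  ⟨h.integrable_exp_mul, fun t => (h.mgf_le t).trans (Real.exp_le_exp.2 (by gcongr))⟩

/-- The form is a sum of independent subgaussian terms with total proxy `c ‖u‖² ‖w‖² ≤ (5/4)⁴ c ≤
3c`. -/
lemma measureReal_bilinear_ge_le {n : ℕ} {Ω : Type*} [MeasurableSpace Ω] {P : Measure Ω}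
    [IsProbabilityMeasure P] {R : Ω → Matrix (Fin n) (Fin n) ℝ}
    (hind : iIndepFun (fun (p : Fin n × Fin n) ω => R ω p.1 p.2) P) {c : NNReal}
    (hsub : ∀ i j, HasSubgaussianMGF (fun ω => R ω i j) c P)
    (u w : EuclideanSpace ℝ (Fin n)) (hu : ‖u‖ ≤ 5 / 4) (hw : ‖w‖ ≤ 5 / 4) {ε : ℝ} (hε : 0 ≤ ε) :
    P.real {ω | ε ≤ inner ℝ u (Matrix.toEuclideanCLM (n := Fin n) (𝕜 := ℝ) (R ω) w)} ≤
      Real.exp (-ε ^ 2 / (6 * c)) := by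
  have hind' : iIndepFun (fun (p : Fin n × Fin n) ω => (u p.1 * w p.2) * R ω p.1 p.2) P :=
    hind.comp (fun p y => (u p.1 * w p.2) * y) (fun p => by fun_prop)
  have hs := HasSubgaussianMGF.sum_of_iIndepFun hind' (s := Finset.univ)
    (c := fun p => Real.toNNReal ((u p.1 * w p.2) ^ 2) * c)
    (fun p _ => by
      convert (hsub p.1 p.2).const_mul (u p.1 * w p.2) using 2
      ext
      rw [NNReal.coe_mul, Real.coe_toNNReal _ (sq_nonneg _)]
      rfl)
  have hs' := HasSubgaussianMGF.mono hs (c' := 3 * c) (by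
    rw [← Finset.sum_mul]
    gcongr
    rw [← NNReal.coe_le_coe, NNReal.coe_sum]
    simp_rw [Real.coe_toNNReal _ (sq_nonneg _)]
    have e1 : ∑ p : Fin n × Fin n, (u p.1 * w p.2) ^ 2 = ‖u‖ ^ 2 * ‖w‖ ^ 2 := by
      rw [EuclideanSpace.real_norm_sq_eq, EuclideanSpace.real_norm_sq_eq, Finset.sum_mul_sum,
        Fintype.sum_prod_type]
      simp_rw [mul_pow]
    calc _ = ‖u‖ ^ 2 * ‖w‖ ^ 2 := e1
      _ ≤ (5 / 4) ^ 2 * (5 / 4) ^ 2 := by gcongr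
      _ ≤ _ := by norm_num)
  have e : ∀ ω, inner ℝ u (Matrix.toEuclideanCLM (n := Fin n) (𝕜 := ℝ) (R ω) w)
      = ∑ p : Fin n × Fin n, (u p.1 * w p.2) * R ω p.1 p.2 := by
    intro ω
    rw [Matrix.inner_toEuclideanCLM, Fintype.sum_prod_type]
    simp only [dotProduct, Matrix.mulVec, Finset.mul_sum]
    refine Finset.sum_congr rfl fun i _ => Finset.sum_congr rfl fun j _ => by ring
  simp_rw [e]
  refine (hs'.measure_ge_le hε).trans_eq ?_
  congr 2
  push_cast; ring

/-- Each of the two nets has at most `e^n 7^n ≤ e^{3n}` points. The constant `48` makes each tail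
`e^{-8n}`, leaving `e^{-2n}` after the union. -/
lemma measureReal_norm_gt_le {n : ℕ} (hn : 0 < n) {Ω : Type*} [MeasurableSpace Ω] {P : Measure Ω}
    [IsProbabilityMeasure P] {R : Ω → Matrix (Fin n) (Fin n) ℝ}
    (hind : iIndepFun (fun (p : Fin n × Fin n) ω => R ω p.1 p.2) P) {c : NNReal} (hc : 0 < c)
    (hsub : ∀ i j, HasSubgaussianMGF (fun ω => R ω i j) c P) :
    P.real {ω | 3 * √(48 * c) * √n < ‖Matrix.toEuclideanCLM (n := Fin n) (𝕜 := ℝ) (R ω)‖} ≤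
      Real.exp (-2 * n) := by
  classical
  have hn' : (0 : ℝ) < n := Nat.cast_pos.2 hn
  have hc' : (0 : ℝ) < c := hc
  set ε : ℝ := √(48 * c) * √n with hε
  have hε0 : 0 ≤ ε := by positivity
  let N := (latticeBox (n := n) Finset.univ (5 / 2 * n) 0).filter
    fun p => ‖scaledLatticePoint (2 * √n)⁻¹ p‖ ≤ 5 / 4
  have hcard : (N.card : ℝ) ≤ Real.exp (3 * n) := by
    have h1 : (N.card : ℝ) ≤ (latticeBox (n := n) Finset.univ (5 / 2 * n) 0).card := by
      exact_mod_cast Finset.card_filter_le _ _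
    refine h1.trans ((card_latticeBox_le hn _ (by positivity) 0).trans ?_)
    have e1 : (2 * (1 + 5 / 2 * (n : ℝ) / n)) = 7 := by field_simp; norm_num
    rw [e1]
    simp only [Finset.compl_univ, Finset.card_empty, pow_zero, mul_one, Finset.card_univ,
      Fintype.card_fin]
    have h7 : (7 : ℝ) ≤ Real.exp 2 := by
      have := Real.exp_one_gt_d9
      rw [show (2 : ℝ) = 1 + 1 by norm_num, Real.exp_add]; nlinarith
    calc Real.exp n * 7 ^ n ≤ Real.exp n * Real.exp 2 ^ n := by gcongr
      _ = _ := by rw [← Real.exp_nat_mul, ← Real.exp_add]; congr 1; ring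
  have hsubset : {ω | 3 * √(48 * c) * √n < ‖Matrix.toEuclideanCLM (n := Fin n) (𝕜 := ℝ) (R ω)‖} ⊆
      ⋃ z ∈ N ×ˢ N, {ω | ε ≤ inner ℝ (scaledLatticePoint (2 * √n)⁻¹ z.1)
        (Matrix.toEuclideanCLM (n := Fin n) (𝕜 := ℝ) (R ω)
          (scaledLatticePoint (2 * √n)⁻¹ z.2))} := by
    intro ω hω
    by_contra hno
    simp only [Set.mem_iUnion, not_exists] at hno
    have : ‖Matrix.toEuclideanCLM (n := Fin n) (𝕜 := ℝ) (R ω)‖ ≤ 3 * ε := by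
      refine norm_le_of_inner_scaledLatticePoint_le hn _ ε hε0 fun p hp q hq hp1 hq1 => ?_
      have h1 := hno (p, q) (Finset.mem_product.2
        ⟨Finset.mem_filter.2 ⟨hp, hp1⟩, Finset.mem_filter.2 ⟨hq, hq1⟩⟩)
      exact (not_le.1 h1).le
    have hω' : 3 * √(48 * c) * √n < ‖Matrix.toEuclideanCLM (n := Fin n) (𝕜 := ℝ) (R ω)‖ := hω
    rw [hε] at this
    linarith
  have hε2 : -ε ^ 2 / (6 * c) = -(8 * n) := by
    rw [hε, mul_pow, Real.sq_sqrt (by positivity), Real.sq_sqrt (by positivity)]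
    field_simp; norm_num
  calc _ ≤ P.real (⋃ z ∈ N ×ˢ N, {ω | ε ≤ inner ℝ (scaledLatticePoint (2 * √n)⁻¹ z.1)
        (Matrix.toEuclideanCLM (n := Fin n) (𝕜 := ℝ) (R ω)
          (scaledLatticePoint (2 * √n)⁻¹ z.2))}) := measureReal_mono hsubset (measure_ne_top _ _)
    _ ≤ ∑ z ∈ N ×ˢ N, _ := measureReal_biUnion_finset_le _ _
    _ ≤ ∑ z ∈ N ×ˢ N, Real.exp (-(8 * n)) := by
        refine Finset.sum_le_sum fun z hz => ?_
        obtain ⟨h1, h2⟩ := Finset.mem_product.1 hz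
        rw [← hε2]
        exact measureReal_bilinear_ge_le hind hsub _ _ (Finset.mem_filter.1 h1).2
          (Finset.mem_filter.1 h2).2 hε0
    _ = N.card * N.card * Real.exp (-(8 * n)) := by
        rw [Finset.sum_const, Finset.card_product, nsmul_eq_mul]; push_cast; ring
    _ ≤ Real.exp (3 * n) * Real.exp (3 * n) * Real.exp (-(8 * n)) := by gcongr
    _ = _ := by rw [← Real.exp_add, ← Real.exp_add]; congr 1; ring

/-! ### Classes of vectors with a given first scale, and their nets. -/

/-- The vector `x` with the coordinates outside `S` set to zero. -/
noncomputable def coordRestrict {n : ℕ} (S : Finset (Fin n)) (x : Fin n → ℝ) :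
    EuclideanSpace ℝ (Fin n) :=
  open Classical in WithLp.toLp 2 fun i => if i ∈ S then x i else 0

lemma coordRestrict_apply {n : ℕ} {S : Finset (Fin n)} {x : Fin n → ℝ} {i : Fin n} (hi : i ∈ S) :
    coordRestrict S x i = x i := by simp [coordRestrict, hi]

lemma coordRestrict_apply_of_notMem {n : ℕ} {S : Finset (Fin n)} {x : Fin n → ℝ} {i : Fin n}
    (hi : i ∉ S) : coordRestrict S x i = 0 := by simp [coordRestrict, hi]

lemma norm_coordRestrict_sq {n : ℕ} (S : Finset (Fin n)) (x : Fin n → ℝ) :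
    ‖coordRestrict S x‖ ^ 2 = ∑ i ∈ S, x i ^ 2 := by
  classical
  rw [EuclideanSpace.real_norm_sq_eq, ← Finset.sum_subset (Finset.subset_univ S)]
  · exact Finset.sum_congr rfl fun i hi => by rw [coordRestrict_apply hi]
  · intro i _ hi
    rw [coordRestrict_apply_of_notMem hi]; simp

lemma norm_coordRestrict_mono {n : ℕ} {S T : Finset (Fin n)} (h : S ⊆ T) (x : Fin n → ℝ) :
    ‖coordRestrict S x‖ ≤ ‖coordRestrict T x‖ := by
  refine abs_le_of_sq_le_sq' ?_ (norm_nonneg _) |>.2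
  rw [norm_coordRestrict_sq, norm_coordRestrict_sq]
  exact Finset.sum_le_sum_of_subset_of_nonneg h fun _ _ _ => sq_nonneg _

lemma norm_coordRestrict_le {n : ℕ} (S : Finset (Fin n)) (x : EuclideanSpace ℝ (Fin n)) :
    ‖coordRestrict S x‖ ≤ ‖x‖ := by
  refine abs_le_of_sq_le_sq' ?_ (norm_nonneg _) |>.2
  rw [norm_coordRestrict_sq, EuclideanSpace.real_norm_sq_eq]
  exact Finset.sum_le_sum_of_subset_of_nonneg (Finset.subset_univ _) fun _ _ _ => sq_nonneg _

lemma norm_coordRestrict_smul {n : ℕ} (S : Finset (Fin n)) (r : ℝ) (x : Fin n → ℝ) :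
    ‖coordRestrict S fun i => r * x i‖ = |r| * ‖coordRestrict S x‖ := by
  rw [← Real.norm_eq_abs, ← norm_smul]
  congr 1
  ext i
  by_cases hi : i ∈ S
  · rw [PiLp.smul_apply, coordRestrict_apply hi, coordRestrict_apply hi, smul_eq_mul]
  · rw [PiLp.smul_apply, coordRestrict_apply_of_notMem hi, coordRestrict_apply_of_notMem hi,
      smul_zero]

/-- The unit vectors whose restriction to `S` has norm about `σ` and essential LCD about `D`,
with squared threshold `κ log (1 + θ²)` at scale `θ`. -/
def lcdLevelClass {n : ℕ} (κ D σ : ℝ) (S : Finset (Fin n)) : Set (EuclideanSpace ℝ (Fin n)) :=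
  {x | ‖x‖ = 1 ∧ σ / 2 ≤ ‖coordRestrict S x‖ ∧ ‖coordRestrict S x‖ ≤ σ ∧
    (∀ r, |r| * ‖coordRestrict S x‖ ≤ D →
      latticeGap κ (r * ‖coordRestrict S x‖) ≤ latticeDistSq S x r) ∧
    ∃ r, 0 < r ∧ D ≤ r * ‖coordRestrict S x‖ ∧ r * ‖coordRestrict S x‖ ≤ 2 * D ∧
      latticeDistSq S x r ≤ κ * Real.log (1 + 4 * D ^ 2)}

/-- The point with coordinates `l u p i` for `i ∈ S` and `h p i` otherwise. -/
noncomputable def netPoint {n : ℕ} (S : Finset (Fin n)) (u h : ℝ) (z : (Fin n → ℤ) × ℕ) :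
    EuclideanSpace ℝ (Fin n) :=
  coordRestrict S (fun i => z.2 * u * z.1 i) + coordRestrict Sᶜ (fun i => h * z.1 i)

/-- On `S`, `r x` is within `τ` of an integer point `p`, so `x` is near `p / r`; the unknown `1/r ≤
σ/D` is rounded to a multiple of `u = στ/D²`. Off `S`, `x` is rounded to mesh `h = στ/(D√n)`. The
three errors are `r⁻¹τ`, `(u/2)·3D` and `√n h/2`, that is `1`, `3/2` and `1/2` times `στ/D`. -/
lemma exists_netPoint {n : ℕ} (hn : 0 < n) {κ D σ τ : ℝ} {S : Finset (Fin n)}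
    (hτ : κ * Real.log (1 + 4 * D ^ 2) = τ ^ 2) (hτ1 : 1 ≤ τ) (hτD : τ ≤ D) (hσ : 0 < σ)
    {x : EuclideanSpace ℝ (Fin n)} (hx : x ∈ lcdLevelClass κ D σ S) :
    ∃ z ∈ latticeBox S (3 * D * √n) (⌈√n * D / (σ * τ)⌉₊ + 1) ×ˢ Finset.range (⌈D / τ⌉₊ + 2),
      ‖x - netPoint S (σ * τ / D ^ 2) (σ * τ / (D * √n)) z‖ ≤ 3 * (σ * τ / D) := by
  classical
  obtain ⟨hx1, -, hsσ, -, r, hr, hr1, hr2, hdist⟩ := hx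
  rw [hτ] at hdist
  set s := ‖coordRestrict S x‖ with hs
  have hn' : (0 : ℝ) < n := Nat.cast_pos.2 hn
  have hsn : 0 < √(n : ℝ) := Real.sqrt_pos.2 hn'
  have hτ0 : 0 < τ := by linarith
  have hD0 : 0 < D := by linarith
  set u : ℝ := σ * τ / D ^ 2 with hu
  set h : ℝ := σ * τ / (D * √n) with hh
  have hu0 : 0 < u := by positivity
  have hh0 : 0 < h := by positivity
  set l : ℤ := round (1 / r / u) with hl
  have hl0 : 0 ≤ l := by
    rw [hl, round_eq]
    exact Int.floor_nonneg.2 (by positivity)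
  obtain ⟨l', hl'⟩ := Int.eq_ofNat_of_zero_le hl0
  set p : Fin n → ℤ := fun i => if i ∈ S then round (r * x i) else round (x i / h) with hp
  have hpS : ∀ i ∈ S, p i = round (r * x i) := fun i hi => by simp [hp, hi]
  have hpN : ∀ i ∉ S, p i = round (x i / h) := fun i hi => by simp [hp, hi]
  have hrinv : 1 / r ≤ σ / D := by
    rw [div_le_div_iff₀ hr hD0]
    nlinarith
  have hE : ‖coordRestrict S fun i => r * x i - p i‖ ≤ τ := by
    refine abs_le_of_sq_le_sq' ?_ hτ0.le |>.2
    rw [norm_coordRestrict_sq]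
    refine le_trans (le_of_eq ?_) hdist
    exact Finset.sum_congr rfl fun i hi => by rw [hpS i hi]
  have hpnorm : ‖coordRestrict S fun i => (p i : ℝ)‖ ≤ 3 * D := by
    have e : (coordRestrict S fun i => (p i : ℝ)) =
        coordRestrict S (fun i => r * x i) - coordRestrict S fun i => r * x i - p i := by
      ext i
      by_cases hi : i ∈ S
      · simp only [PiLp.sub_apply, coordRestrict_apply hi]; ring
      · simp only [PiLp.sub_apply, coordRestrict_apply_of_notMem hi]; ring
    rw [e]
    refine (norm_sub_le _ _).trans ?_
    rw [norm_coordRestrict_smul, abs_of_pos hr]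
    linarith
  have habs : ∀ i, |x i| ≤ 1 := fun i => by
    have := PiLp.norm_apply_le x i
    rwa [hx1, Real.norm_eq_abs] at this
  refine ⟨(p, l'), Finset.mem_product.2 ⟨mem_latticeBox ?_ ?_, ?_⟩, ?_⟩
  · have h1 := sum_abs_le_sqrt_mul (coordRestrict S fun i => (p i : ℝ))
    have h2 : ∑ i ∈ S, |(p i : ℝ)| ≤ ∑ i, |(coordRestrict S fun i => (p i : ℝ)) i| := by
      refine le_trans (le_of_eq ?_) (Finset.sum_le_sum_of_subset_of_nonneg (Finset.subset_univ S)
        fun _ _ _ => abs_nonneg _)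
      exact Finset.sum_congr rfl fun i hi => by rw [coordRestrict_apply hi]
    calc _ ≤ _ := h2
      _ ≤ _ := h1
      _ ≤ √n * (3 * D) := by gcongr
      _ = _ := by ring
  · intro i hi
    change |p i| ≤ _
    rw [hpN i hi]
    have h1 := abs_sub_round (x i / h)
    have h2 : |x i / h| ≤ √n * D / (σ * τ) := by
      rw [abs_div, abs_of_pos hh0, hh, div_div_eq_mul_div]
      refine div_le_div_of_nonneg_right ?_ (by positivity)
      nlinarith [habs i, mul_pos hsn hD0]
    have h3 : |(round (x i / h) : ℝ)| ≤ √n * D / (σ * τ) + 1 := by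
      have : (round (x i / h) : ℝ) = x i / h - (x i / h - round (x i / h)) := by ring
      rw [this]
      refine (abs_sub _ _).trans ?_
      linarith
    have h4 : (|round (x i / h)| : ℝ) ≤ ((⌈√n * D / (σ * τ)⌉₊ + 1 : ℕ) : ℝ) := by
      push_cast
      linarith [Nat.le_ceil (√n * D / (σ * τ))]
    exact_mod_cast h4
  · rw [Finset.mem_range]
    have h1 := abs_sub_round (1 / r / u)
    have h2 : 1 / r / u ≤ D / τ := by
      rw [div_le_iff₀ hu0]
      refine hrinv.trans_eq ?_
      rw [hu]; field_simp
    have h3 : (l : ℝ) ≤ ⌈D / τ⌉₊ + 1 := by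
      have := (abs_le.1 h1).1
      rw [← hl] at this
      linarith [Nat.le_ceil (D / τ)]
    have h4 : l' ≤ ⌈D / τ⌉₊ + 1 := by
      rw [hl'] at h3
      exact_mod_cast h3
    omega
  · have hlr : ((l' : ℕ) : ℝ) = (l : ℝ) := by rw [hl']; simp
    have e : x - netPoint S u h (p, l') =
        coordRestrict S (fun i => r⁻¹ * (r * x i - p i)) +
          coordRestrict S (fun i => (1 / r - l * u) * p i) +
          coordRestrict Sᶜ (fun i => x i - h * p i) := by
      ext i
      by_cases hi : i ∈ S
      · have hi' : i ∉ Sᶜ := by simpa using hi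
        simp only [netPoint, PiLp.sub_apply, PiLp.add_apply, coordRestrict_apply hi,
          coordRestrict_apply_of_notMem hi', hlr]
        field_simp; ring
      · have hi' : i ∈ Sᶜ := by simpa using hi
        simp only [netPoint, PiLp.sub_apply, PiLp.add_apply, coordRestrict_apply hi',
          coordRestrict_apply_of_notMem hi]
        ring
    have b1 : ‖coordRestrict S fun i => r⁻¹ * (r * x i - p i)‖ ≤ σ * τ / D := by
      rw [norm_coordRestrict_smul, abs_of_pos (inv_pos.2 hr)]
      calc r⁻¹ * _ ≤ (σ / D) * τ := by
            gcongr
            rwa [← one_div]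
        _ = _ := by ring
    have b2 : ‖coordRestrict S fun i => (1 / r - l * u) * p i‖ ≤ 3 / 2 * (σ * τ / D) := by
      rw [norm_coordRestrict_smul]
      have h1 : |1 / r - l * u| ≤ u / 2 := by
        have h2 := abs_sub_round (1 / r / u)
        have h3 : 1 / r - l * u = (1 / r / u - l) * u := by field_simp
        rw [h3, abs_mul, abs_of_pos hu0]
        rw [← hl] at h2
        nlinarith
      calc _ ≤ u / 2 * (3 * D) := by gcongr
        _ = _ := by rw [hu]; field_simp
    have b3 : ‖coordRestrict Sᶜ fun i => x i - h * p i‖ ≤ 1 / 2 * (σ * τ / D) := by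
      refine (norm_le_sqrt_mul_of_abs_le _ (c := h / 2) (by positivity) fun i => ?_).trans_eq ?_
      · by_cases hi : i ∈ S
        · have hi' : i ∉ Sᶜ := by simpa using hi
          rw [coordRestrict_apply_of_notMem hi', abs_zero]; positivity
        · have hi' : i ∈ Sᶜ := by simpa using hi
          rw [coordRestrict_apply hi', hpN i hi]
          have h2 := abs_sub_round (x i / h)
          have h3 : x i - h * round (x i / h) = h * (x i / h - round (x i / h)) := by field_simp
          rw [h3, abs_mul, abs_of_pos hh0]
          nlinarith
      · rw [hh]; field_simp
    rw [e]
    refine (norm_add₃_le).trans ?_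
    linarith

/-- The transpose of `A` sends `z` to zero on `T`, so there it sends `x` to the image of `x - z`. -/
lemma sum_sq_column_le {n : ℕ} (A : Matrix (Fin n) (Fin n) ℝ) (T : Finset (Fin n))
    {z x : EuclideanSpace ℝ (Fin n)} (hz : ∀ j ∈ T, ∑ i, A i j * z i = 0) {Λ ε : ℝ}
    (hA : ‖Matrix.toEuclideanCLM (n := Fin n) (𝕜 := ℝ) A‖ ≤ Λ) (hε : ‖z - x‖ ≤ ε) :
    ∑ j ∈ T, (∑ i, A i j * x i) ^ 2 ≤ (Λ * ε) ^ 2 := by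
  set B := Matrix.toEuclideanCLM (n := Fin n) (𝕜 := ℝ) (star A)
  have hB : ‖B‖ ≤ Λ := by
    rw [show B = star (Matrix.toEuclideanCLM (n := Fin n) (𝕜 := ℝ) A) from map_star _ _,
      ContinuousLinearMap.star_eq_adjoint, LinearIsometryEquiv.norm_map]
    exact hA
  have happ : ∀ (w : EuclideanSpace ℝ (Fin n)) j, B w j = ∑ i, A i j * w i := by
    intro w j
    change ((star A).mulVec w.ofLp) j = _
    simp [Matrix.mulVec, dotProduct, Matrix.star_apply]
  have h1 : ∀ j ∈ T, (∑ i, A i j * x i) ^ 2 = (B (x - z) j) ^ 2 := by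
    intro j hj
    rw [map_sub, PiLp.sub_apply, happ, happ, hz j hj, sub_zero]
  rw [Finset.sum_congr rfl h1]
  calc ∑ j ∈ T, (B (x - z) j) ^ 2 ≤ ∑ j, (B (x - z) j) ^ 2 :=
        Finset.sum_le_sum_of_subset_of_nonneg (Finset.subset_univ _) fun _ _ _ => sq_nonneg _
    _ = ‖B (x - z)‖ ^ 2 := (EuclideanSpace.real_norm_sq_eq _).symm
    _ ≤ (Λ * ε) ^ 2 := by
        have h0 : 0 ≤ Λ := (norm_nonneg _).trans hB
        gcongr
        refine (B.le_opNorm _).trans ?_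
        rw [norm_sub_rev]
        gcongr

lemma sum_mul_eq_zero_of_mem_orthogonal {n : ℕ} {A : Matrix (Fin n) (Fin n) ℝ}
    {z : EuclideanSpace ℝ (Fin n)} (hz : z ∈ (spanFirstColumns A)ᗮ) {j : Fin n}
    (hj : (j : ℕ) + 1 < n) : ∑ i, A i j * z i = 0 := by
  have h := (Submodule.mem_orthogonal _ _).1 hz (columnVec A j)
    (Submodule.subset_span ⟨j, hj, rfl⟩)
  rw [PiLp.inner_apply] at h
  rw [← h]
  refine Finset.sum_congr rfl fun i _ => ?_
  simp [columnVec, mul_comm]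

lemma card_filter_succ_lt (n : ℕ) :
    (Finset.univ.filter fun j : Fin n => (j : ℕ) + 1 < n).card = n - 1 := by
  cases n with
  | zero => simp
  | succ n =>
    simp only [Nat.add_lt_add_iff_right, Nat.add_sub_cancel]
    rw [Fin.card_filter_val_lt]
    omega

/-- The probability that a random normal vector lies in an essential LCD class, on the event
that the operator norm of the matrix is at most `Λ`. -/
lemma measureReal_mem_lcdLevelClass_le {n : ℕ} (hn : 0 < n) {Ω : Type*} [MeasurableSpace Ω]
    {P : Measure Ω} [IsProbabilityMeasure P] {μ : Measure ℝ} [IsProbabilityMeasure μ]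
    {R : Ω → Matrix (Fin n) (Fin n) ℝ}
    (hind : iIndepFun (fun (p : Fin n × Fin n) ω => R ω p.1 p.2) P)
    (hmeas : ∀ i j, Measurable (fun ω => R ω i j)) (hμ : ∀ i j, P.map (fun ω => R ω i j) = μ)
    (M : Matrix (Fin n) (Fin n) ℝ) {a b p₀ κ : ℝ} (ha : 0 < a) (hab : a ≤ b) (hp₀ : 0 < p₀)
    (hp₁ : p₀ ≤ 1 / 4) (hp : p₀ ≤ (μ.prod μ).real {p | a ≤ |p.1 - p.2| ∧ |p.1 - p.2| ≤ b})
    (hκ : 1 ≤ 4 * p₀ * κ) {Z : Ω → EuclideanSpace ℝ (Fin n)}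
    (hZ : ∀ ω, Z ω ∈ (spanFirstColumns (R ω + M))ᗮ) {D σ τ Λ : ℝ} (S : Finset (Fin n))
    (hτ : κ * Real.log (1 + 4 * D ^ 2) = τ ^ 2) (hτ1 : 1 ≤ τ) (hτD : τ ≤ D) (hσ : 0 < σ)
    (hΛ : 0 < Λ) :
    P.real {ω | ‖Matrix.toEuclideanCLM (n := Fin n) (𝕜 := ℝ) (R ω + M)‖ ≤ Λ ∧
        Z ω ∈ lcdLevelClass κ D σ S} ≤
      (latticeBox S (3 * D * √n) (⌈√n * D / (σ * τ)⌉₊ + 1)).card * (⌈D / τ⌉₊ + 2) *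
        (Real.exp (n / 2) * ((4 * p₀)⁻¹ * Real.pi * (24 * Real.pi / a * (Λ * τ / (D * √n))) +
          2 * Real.exp (-(6 * Real.pi * (Λ * τ / √n) / b) ^ 2)) ^ (n - 1)) := by
  classical
  have hn' : (0 : ℝ) < n := Nat.cast_pos.2 hn
  have hsn : 0 < √(n : ℝ) := Real.sqrt_pos.2 hn'
  have hτ0 : 0 < τ := by linarith
  have hD0 : 0 < D := by linarith
  have hb : 0 < b := ha.trans_le hab
  set T := Finset.univ.filter fun j : Fin n => (j : ℕ) + 1 < n
  set W := latticeBox S (3 * D * √n) (⌈√n * D / (σ * τ)⌉₊ + 1) ×ˢ Finset.range (⌈D / τ⌉₊ + 2)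
  set y := netPoint S (σ * τ / D ^ 2) (σ * τ / (D * √n))
  -- Chosen so that `n η² = (Λ · 6στ/D)²`; the `6 = 3 + 3` comes from going from `Z` to `x` through
  -- the net point.
  set η : ℝ := 6 * Λ * (σ * τ / D) / √n with hη
  have hη0 : 0 < η := by positivity
  set β : ℝ := Real.exp (n / 2) * ((4 * p₀)⁻¹ * Real.pi *
    (24 * Real.pi / a * (Λ * τ / (D * √n))) +
      2 * Real.exp (-(6 * Real.pi * (Λ * τ / √n) / b) ^ 2)) ^ (n - 1) with hβ
  have hβ0 : 0 ≤ β := by positivity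
  -- A net point need not lie in the class, so it has no small ball bound of its own. It is replaced
  -- by a class member `x` near it, and if there is none, its event is empty.
  have hE : ∀ z, ∃ E : Set Ω, P.real E ≤ β ∧ ∀ ω,
      ‖Matrix.toEuclideanCLM (n := Fin n) (𝕜 := ℝ) (R ω + M)‖ ≤ Λ →
      Z ω ∈ lcdLevelClass κ D σ S → ‖Z ω - y z‖ ≤ 3 * (σ * τ / D) → ω ∈ E := by
    intro z
    by_cases hz : ∃ x ∈ lcdLevelClass κ D σ S, ‖x - y z‖ ≤ 3 * (σ * τ / D)
    · obtain ⟨x, hx, hxy⟩ := hz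
      refine ⟨{ω | ∑ j ∈ T, (∑ i, (R ω i j + M i j) * x i) ^ 2 ≤ n * η ^ 2}, ?_, ?_⟩
      · obtain ⟨-, hx1, hx2, hx3, -⟩ := hx
        set s := ‖coordRestrict S x‖
        have hs : 0 < s := by linarith
        refine (measureReal_sum_linearForm_sq_le hind hmeas hμ M ha hab hp₀ hp₁ hp hκ S x s D η hs
          hD0.le hη0 hx3 T n).trans ?_
        rw [hβ, card_filter_succ_lt]
        have g1 : 2 * Real.pi * η / (a * s) ≤ 24 * Real.pi / a * (Λ * τ / (D * √n)) := by
          have : 2 * Real.pi * η / (a * s) ≤ 2 * Real.pi * η / (a * (σ / 2)) := by gcongr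
          refine this.trans_eq ?_
          rw [hη]; field_simp; norm_num
        have g2 : 6 * Real.pi * (Λ * τ / √n) / b ≤ Real.pi * D * η / (b * s) := by
          have : Real.pi * D * η / (b * σ) ≤ Real.pi * D * η / (b * s) := by gcongr
          refine le_trans (le_of_eq ?_) this
          rw [hη]; field_simp
        gcongr
      · intro ω hω _ hωz
        have h1 : ‖Z ω - x‖ ≤ 6 * (σ * τ / D) := by
          have : Z ω - x = (Z ω - y z) - (x - y z) := by abel
          rw [this]
          refine (norm_sub_le _ _).trans ?_
          linarith
        have h2 := sum_sq_column_le (R ω + M) T (z := Z ω) (x := x) (fun j hj =>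
          sum_mul_eq_zero_of_mem_orthogonal (hZ ω) (Finset.mem_filter.1 hj).2) hω h1
        refine le_trans h2 (le_of_eq ?_)
        rw [hη, div_pow, Real.sq_sqrt hn'.le]
        field_simp
    · refine ⟨∅, by simpa using hβ0, fun ω _ hω hωz => hz ⟨_, hω, hωz⟩⟩
  choose E hEβ hEmem using hE
  have hsub : {ω | ‖Matrix.toEuclideanCLM (n := Fin n) (𝕜 := ℝ) (R ω + M)‖ ≤ Λ ∧
      Z ω ∈ lcdLevelClass κ D σ S} ⊆ ⋃ z ∈ W, E z := by
    rintro ω ⟨h1, h2⟩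
    obtain ⟨z, hzW, hz⟩ := exists_netPoint hn hτ hτ1 hτD hσ h2
    exact Set.mem_biUnion hzW (hEmem z ω h1 h2 hz)
  calc _ ≤ P.real (⋃ z ∈ W, E z) := measureReal_mono hsub (measure_ne_top _ _)
    _ ≤ ∑ z ∈ W, P.real (E z) := measureReal_biUnion_finset_le _ _
    _ ≤ ∑ z ∈ W, β := Finset.sum_le_sum fun z _ => hEβ z
    _ = _ := by
        rw [Finset.sum_const, Finset.card_product, Finset.card_range, nsmul_eq_mul]
        push_cast; ring

/-! ### Spread subsets of the small part and the first scale of approach. -/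

lemma card_smallIndices {n : ℕ} (v : EuclideanSpace ℝ (Fin n)) {k : ℕ} (hk : k ≤ n) :
    (smallIndices v k).card = k := by
  rw [smallIndices, Finset.card_map, Fin.card_filter_val_lt]
  omega

lemma mem_smallIndices {n : ℕ} {v : EuclideanSpace ℝ (Fin n)} {k : ℕ} {i : Fin n} :
    i ∈ smallIndices v k ↔ (((Tuple.sort fun i => |v i|)⁻¹ i : Fin n) : ℕ) < k := by
  rw [smallIndices, Finset.mem_map]
  constructor
  · rintro ⟨a, ha, rfl⟩
    simpa using ha
  · intro h
    exact ⟨_, by simpa using h, by simp⟩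

lemma smallIndices_mono {n : ℕ} (v : EuclideanSpace ℝ (Fin n)) {k l : ℕ} (h : k ≤ l) :
    smallIndices v k ⊆ smallIndices v l := fun _ hi =>
  mem_smallIndices.2 ((mem_smallIndices.1 hi).trans_le h)

lemma abs_le_abs_of_mem_smallIndices {n : ℕ} {v : EuclideanSpace ℝ (Fin n)} {k : ℕ} {i l : Fin n}
    (hi : i ∈ smallIndices v k) (hl : l ∉ smallIndices v k) : |v i| ≤ |v l| := by
  have hmono := Tuple.monotone_sort fun i => |v i|
  set e := Tuple.sort fun i => |v i|
  have h1 : e⁻¹ i ≤ e⁻¹ l := by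
    have h1 := mem_smallIndices.1 hi
    have h2 := mt mem_smallIndices.2 hl
    exact Fin.le_def.2 (h1.trans_le (not_lt.1 h2)).le
  have h2 := hmono h1
  simpa using h2

/-- Otherwise zeroing the coordinates in `S` would give a sparse vector within `ρ`. -/
lemma lt_norm_coordRestrict_of_mem_incompVectors {n : ℕ} {δ ρ : ℝ} {x : EuclideanSpace ℝ (Fin n)}
    (hx : x ∈ incompVectors n δ ρ) (S : Finset (Fin n)) (hS : (n : ℝ) - S.card ≤ δ * n) :
    ρ < ‖coordRestrict S x‖ := by
  classical
  by_contra hle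
  push Not at hle
  refine hx.2 ⟨hx.1, coordRestrict Sᶜ x, ?_, ?_⟩
  · refine le_trans ?_ hS
    have h1 : (Finset.univ.filter fun i => coordRestrict Sᶜ x i ≠ 0) ⊆ Sᶜ := by
      intro i hi
      by_contra h
      exact (Finset.mem_filter.1 hi).2 (coordRestrict_apply_of_notMem h)
    have h2 := Finset.card_le_card h1
    rw [Finset.card_compl, Fintype.card_fin] at h2
    have h3 : S.card ≤ n := by simpa using S.card_le_univ
    rw [← Nat.cast_sub h3]
    exact_mod_cast h2
  · have : x - coordRestrict Sᶜ x = coordRestrict S x := by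
      ext i
      by_cases hi : i ∈ S
      · have hi' : i ∉ Sᶜ := by simpa using hi
        rw [PiLp.sub_apply, coordRestrict_apply hi, coordRestrict_apply_of_notMem hi', sub_zero]
      · have hi' : i ∈ Sᶜ := by simpa using hi
        rw [PiLp.sub_apply, coordRestrict_apply hi', coordRestrict_apply_of_notMem hi, sub_self]
    rw [this]; exact hle

/-- Removing boundedly many blocks of `b` coordinates from the small part of an incompressible
vector leaves a spread vector. -/
lemma exists_spread_subset {n k b J : ℕ} {δ ρ : ℝ} {x : EuclideanSpace ℝ (Fin n)}
    (hx : x ∈ incompVectors n δ ρ) (hk : k ≤ n) (hJk : J * b ≤ k)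
    (hδ : (n : ℝ) - k + J * b ≤ δ * n) (hJ : (2 : ℝ)⁻¹ ^ J ≤ ρ) :
    ∃ S ⊆ smallIndices x k, k - J * b ≤ S.card ∧ ρ < ‖coordRestrict S x‖ ∧
      ∀ i ∈ S, √b * |x i| ≤ 2 * ‖coordRestrict S x‖ := by
  have hρ : ∀ j ≤ J, ρ < ‖coordRestrict (smallIndices x (k - j * b)) x‖ := by
    intro j hj
    refine lt_norm_coordRestrict_of_mem_incompVectors hx _ ?_
    have hjb : j * b ≤ J * b := Nat.mul_le_mul_right _ hj
    rw [card_smallIndices x (by omega), Nat.cast_sub (by omega)]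
    have : (j * b : ℝ) ≤ J * b := by exact_mod_cast hjb
    push_cast
    linarith
  -- If every removal of a block of the `b` largest remaining coordinates more than halved the norm,
  -- `J` removals would leave at most `2^{-J} ≤ ρ`, against incompressibility.
  obtain ⟨j, hj, hjs⟩ : ∃ j < J, ‖coordRestrict (smallIndices x (k - j * b)) x‖ ≤
      2 * ‖coordRestrict (smallIndices x (k - (j + 1) * b)) x‖ := by
    by_contra hno
    push Not at hno
    have : ∀ j ≤ J, ‖coordRestrict (smallIndices x (k - j * b)) x‖ ≤ (2 : ℝ)⁻¹ ^ j := by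
      intro j
      induction j with
      | zero => exact fun _ => by simpa [hx.1] using norm_coordRestrict_le (smallIndices x k) x
      | succ j ih =>
        intro hj
        have h1 := ih (by omega)
        have h2 := hno j (by omega)
        rw [pow_succ]; linarith
    linarith [this J le_rfl, hρ J le_rfl]
  have hjb : (j + 1) * b ≤ J * b := Nat.mul_le_mul_right _ hj
  have hjb' : (j + 1) * b = j * b + b := by ring
  refine ⟨smallIndices x (k - (j + 1) * b), smallIndices_mono x (by omega), ?_, hρ _ hj, ?_⟩
  · rw [card_smallIndices x (by omega)]; omega
  · intro i hi
    set A := smallIndices x (k - j * b)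
    set B := smallIndices x (k - (j + 1) * b)
    have hBA : B ⊆ A := smallIndices_mono x (by omega)
    have hcard : (A \ B).card = b := by
      rw [Finset.card_sdiff_of_subset hBA, card_smallIndices x (by omega),
        card_smallIndices x (by omega)]
      omega
    -- The `b` coordinates of the removed block dominate every surviving one, and the norm with the
    -- block is at most twice the norm without it.
    have h1 : (b : ℝ) * x i ^ 2 ≤ ‖coordRestrict A x‖ ^ 2 := by
      rw [norm_coordRestrict_sq]
      calc (b : ℝ) * x i ^ 2 = ∑ l ∈ A \ B, x i ^ 2 := by
            rw [Finset.sum_const, hcard, nsmul_eq_mul]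
        _ ≤ ∑ l ∈ A \ B, x l ^ 2 := by
            refine Finset.sum_le_sum fun l hl => ?_
            exact sq_le_sq.2 (abs_le_abs_of_mem_smallIndices hi (Finset.mem_sdiff.1 hl).2)
        _ ≤ ∑ l ∈ A, x l ^ 2 := Finset.sum_le_sum_of_subset_of_nonneg Finset.sdiff_subset
            fun _ _ _ => sq_nonneg _
    have h2 : √b * |x i| ≤ ‖coordRestrict A x‖ := by
      refine abs_le_of_sq_le_sq' ?_ (norm_nonneg _) |>.2
      rw [mul_pow, Real.sq_sqrt (by positivity), sq_abs]
      exact h1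
    linarith

lemma latticeDistSq_neg {n : ℕ} (S : Finset (Fin n)) (x : Fin n → ℝ) (r : ℝ) :
    latticeDistSq S x (-r) = latticeDistSq S x r := by
  have h : ∀ w : ℝ, (-w - round (-w)) ^ 2 ≤ (w - round w) ^ 2 := by
    intro w
    rw [sq_le_sq]
    refine (round_le (-w) (-round w)).trans_eq ?_
    rw [← abs_neg]; congr 1; push_cast; ring
  refine Finset.sum_congr rfl fun i _ => le_antisymm ?_ ?_
  · rw [neg_mul]; exact h _
  · have := h (-(r * x i))
    rw [neg_neg] at this
    rwa [neg_mul]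

/-- At such scales every coordinate satisfies `|r x_i| ≤ 1/2`, so the origin is a nearest lattice
point. A spread vector gains no lattice proximity below scale `√b/4`. -/
lemma latticeDistSq_eq_of_le {n b : ℕ} {S : Finset (Fin n)} {x : Fin n → ℝ}
    (hb : 0 < b)
    (hspread : ∀ i ∈ S, √b * |x i| ≤ 2 * ‖coordRestrict S x‖) {r : ℝ}
    (hr : |r| * ‖coordRestrict S x‖ ≤ √b / 4) :
    latticeDistSq S x r = (r * ‖coordRestrict S x‖) ^ 2 := by
  have hb' : 0 < √(b : ℝ) := Real.sqrt_pos.2 (Nat.cast_pos.2 hb)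
  rw [mul_pow, norm_coordRestrict_sq, Finset.mul_sum]
  refine Finset.sum_congr rfl fun i hi => ?_
  have h1 : |r * x i| ≤ 1 / 2 := by
    rw [abs_mul]
    have h2 := mul_le_mul_of_nonneg_left (hspread i hi) (abs_nonneg r)
    have h3 : √b * (|r| * |x i|) ≤ √b * (1 / 2) := by nlinarith
    exact le_of_mul_le_mul_left h3 hb'
  rw [← mul_pow, ← sq_abs, ← sq_abs (r * x i)]
  congr 1
  refine le_antisymm ?_ ?_
  · simpa using round_le (r * x i) 0
  · by_cases h0 : round (r * x i) = 0
    · simp [h0]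
    · have h2 : (1 : ℝ) ≤ |(round (r * x i) : ℝ)| := by
        rw [← Int.cast_abs]
        exact_mod_cast Int.one_le_abs h0
      have h3 := abs_sub_abs_le_abs_sub (round (r * x i) : ℝ) (r * x i)
      rw [abs_sub_comm] at h3
      linarith

/-- Dyadic localization of the first scale at which a spread vector comes close to the lattice. -/
lemma exists_dyadic_mem_lcdLevelClass {n b : ℕ} {κ σ : ℝ} {S : Finset (Fin n)}
    {x : EuclideanSpace ℝ (Fin n)} (hx : ‖x‖ = 1) (hκ : 0 ≤ κ) (hb : 0 < b)
    (hσ : 0 < σ) (hσ1 : σ / 2 ≤ ‖coordRestrict S x‖) (hσ2 : ‖coordRestrict S x‖ ≤ σ)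
    (hspread : ∀ i ∈ S, √b * |x i| ≤ 2 * ‖coordRestrict S x‖) {r₀ : ℝ}
    (h1 : √b / 4 ≤ r₀ * ‖coordRestrict S x‖)
    (h2 : latticeDistSq S x r₀ ≤ κ * Real.log (1 + (r₀ * ‖coordRestrict S x‖) ^ 2)) :
    ∃ j : ℕ, 2 ^ j * (√b / 4) ≤ r₀ * ‖coordRestrict S x‖ ∧
      x ∈ lcdLevelClass κ (2 ^ j * (√b / 4)) σ S := by
  classical
  set s := ‖coordRestrict S x‖ with hs
  have hs0 : 0 < s := by linarith
  set m : ℝ := √b / 4 with hm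
  have hb' : 0 < √(b : ℝ) := Real.sqrt_pos.2 (Nat.cast_pos.2 hb)
  have hm0 : 0 < m := by positivity
  have hex : ∃ j : ℕ, ∃ r, m ≤ r * s ∧ r * s ≤ 2 ^ (j + 1) * m ∧
      latticeDistSq S x r ≤ κ * Real.log (1 + (r * s) ^ 2) := by
    obtain ⟨j, hj⟩ := pow_unbounded_of_one_lt (r₀ * s / m) one_lt_two
    refine ⟨j, r₀, h1, ?_, h2⟩
    rw [div_lt_iff₀ hm0] at hj
    refine hj.le.trans ?_
    gcongr
    · norm_num
    · omega
  -- Minimality of the dyadic index yields the lower bounds at all smaller scales: failure of the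
  -- predicate at `j - 1` covers scales up to `2^j m`.
  set j := Nat.find hex with hj
  obtain ⟨r, hr1, hr2, hr3⟩ := Nat.find_spec hex
  have hprev : ∀ r, m ≤ r * s → r * s ≤ 2 ^ j * m → 0 < j →
      κ * Real.log (1 + (r * s) ^ 2) < latticeDistSq S x r := by
    intro r hr1 hr2 hj0
    by_contra hle
    push Not at hle
    refine Nat.find_min hex (m := j - 1) (by omega) ⟨r, hr1, ?_, hle⟩
    rwa [Nat.sub_add_cancel (by omega)]
  have hlow : ∀ r, m ≤ r * s → latticeDistSq S x r ≤ κ * Real.log (1 + (r * s) ^ 2) →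
      2 ^ j * m ≤ r * s := by
    intro r hr1 hr3
    rcases Nat.eq_zero_or_pos j with h0 | h0
    · simpa [h0] using hr1
    · by_contra hlt
      push Not at hlt
      linarith [hprev r hr1 hlt.le h0]
  refine ⟨j, hlow r₀ h1 h2, hx, hσ1, hσ2, ?_, r, ?_, hlow r hr1 hr3, ?_, ?_⟩
  · have hpos : ∀ r, 0 ≤ r → r * s ≤ 2 ^ j * m → latticeGap κ (r * s) ≤ latticeDistSq S x r := by
      intro r hr0 hr
      rcases le_or_gt (r * s) m with h | h
      · rw [latticeDistSq_eq_of_le hb hspread (by rwa [abs_of_nonneg hr0])]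
        exact min_le_left _ _
      · rcases Nat.eq_zero_or_pos j with h0 | h0
        · rw [h0, pow_zero, one_mul] at hr
          linarith
        · exact (min_le_right _ _).trans (hprev r h.le hr h0).le
    intro r hr
    rcases le_or_gt 0 r with h0 | h0
    · exact hpos r h0 (by rwa [abs_of_nonneg h0] at hr)
    · rw [abs_of_neg h0] at hr
      have := hpos (-r) (by linarith) hr
      rw [latticeDistSq_neg] at this
      simpa [latticeGap] using this
  · by_contra hle
    push Not at hle
    nlinarith
  · refine hr2.trans_eq ?_
    rw [← hj, pow_succ]; ring
  · refine hr3.trans ?_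
    have h0 : 0 ≤ r * s := hm0.le.trans hr1
    have h5 : r * s ≤ 2 * (2 ^ j * m) := by
      refine hr2.trans_eq ?_
      rw [← hj, pow_succ]; ring
    have h6 : 1 + (r * s) ^ 2 ≤ 1 + 4 * (2 ^ j * m) ^ 2 := by nlinarith
    gcongr

/-! ### From the level set of the LCD to the dyadic classes. -/

lemma sum_orderEmbOfFin {n : ℕ} (I : Finset (Fin n)) (f : Fin n → ℝ) :
    ∑ l : Fin I.card, f (I.orderEmbOfFin rfl l) = ∑ i ∈ I, f i := by
  conv_rhs => rw [← Finset.map_orderEmbOfFin_univ I rfl]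
  rw [Finset.sum_map]
  rfl

lemma norm_truncVec {n : ℕ} (x : EuclideanSpace ℝ (Fin n)) (I : Finset (Fin n)) :
    ‖truncVec x I‖ = ‖coordRestrict I x‖ := by
  rw [← sq_eq_sq₀ (norm_nonneg _) (norm_nonneg _), norm_coordRestrict_sq,
    EuclideanSpace.real_norm_sq_eq]
  exact sum_orderEmbOfFin I fun i => x i ^ 2

lemma exists_latticeDistSq_lt_of_mem_levelSetTS {n k : ℕ} {D L : ℝ} (hD : 0 < D)
    {x : EuclideanSpace ℝ (Fin n)} (hx : x ∈ levelSetTS D k n L)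
    (hs : 0 < ‖coordRestrict (smallIndices x k) x‖) :
    ∃ θ, D ≤ θ ∧ θ ≤ 3 * D ∧
      latticeDistSq (smallIndices x k) x (θ / ‖coordRestrict (smallIndices x k) x‖) ≤
        L ^ 2 * max (Real.log (θ / L)) 0 := by
  obtain ⟨-, hx1, hx2⟩ := hx
  set I := smallIndices x k
  set s := ‖coordRestrict I x‖
  have hnorm : ‖smallPart x k‖ = s := norm_truncVec x I
  -- The infimum need not be attained, so `2D` is relaxed to `3D` to extract an actual scale.
  have hlt : LCD L (‖smallPart x k‖⁻¹ • smallPart x k) < ((3 * D : ℝ) : EReal) :=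
    hx2.trans_lt (EReal.coe_lt_coe_iff.2 (by linarith))
  obtain ⟨_, ⟨θ, ⟨hθ0, hθ⟩, rfl⟩, hθ3⟩ := sInf_lt_iff.1 hlt
  have hθ3' : θ ≤ 3 * D := (EReal.coe_lt_coe_iff.1 hθ3).le
  have hθ1 : D ≤ θ := by
    have := hx1.trans (sInf_le ⟨θ, ⟨hθ0, hθ⟩, rfl⟩)
    exact EReal.coe_le_coe_iff.1 this
  refine ⟨θ, hθ1, hθ3', ?_⟩
  have hne : (integerLattice I.card).Nonempty := ⟨0, fun i => ⟨0, by simp⟩⟩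
  obtain ⟨p, hp, hpd⟩ := (Metric.infDist_lt_iff hne).1 hθ
  have hunit : ‖θ • ‖smallPart x k‖⁻¹ • smallPart x k‖ = θ := by
    rw [norm_smul, norm_smul, norm_inv, norm_norm, inv_mul_cancel₀ (by rw [hnorm]; exact hs.ne'),
      Real.norm_of_nonneg hθ0.le, mul_one]
  rw [hunit] at hpd
  have hsq : dist (θ • ‖smallPart x k‖⁻¹ • smallPart x k) p ^ 2 ≤
      L ^ 2 * max (Real.log (θ / L)) 0 := by
    have h1 := pow_le_pow_left₀ dist_nonneg hpd.le 2
    rwa [mul_pow, Real.sq_sqrt (le_max_right _ _)] at h1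
  refine le_trans ?_ hsq
  rw [dist_eq_norm, EuclideanSpace.real_norm_sq_eq, latticeDistSq, ← sum_orderEmbOfFin]
  refine Finset.sum_le_sum fun l _ => ?_
  obtain ⟨m, hm⟩ := hp l
  have e : (θ • ‖smallPart x k‖⁻¹ • smallPart x k) l = θ / s * x (I.orderEmbOfFin rfl l) := by
    rw [PiLp.smul_apply, PiLp.smul_apply, hnorm, smul_eq_mul, smul_eq_mul]
    change θ * (s⁻¹ * x (I.orderEmbOfFin rfl l)) = _
    ring
  have e2 : (θ • ‖smallPart x k‖⁻¹ • smallPart x k - p) l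
      = θ / s * x (I.orderEmbOfFin rfl l) - m := by
    rw [PiLp.sub_apply, e, hm]
  rw [e2]
  exact sq_le_sq.2 (round_le _ m)

/-- An incompressible vector of the level set of the LCD lies in one of the dyadic classes. -/
lemma exists_mem_lcdLevelClass {n k b J : ℕ} {D L δ ρ κ : ℝ} {x : EuclideanSpace ℝ (Fin n)}
    (hxT : x ∈ levelSetTS D k n L) (hxI : x ∈ incompVectors n δ ρ) (hk : k ≤ n) (hJk : J * b ≤ k)
    (hδ : (n : ℝ) - k + J * b ≤ δ * n) (hJ : (2 : ℝ)⁻¹ ^ J ≤ ρ) (hb : 16 ≤ b) (hL : 1 < L)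
    (hD : 0 < D) (hκ : 3 * L ^ 2 ≤ κ) (hρ : ρ⁻¹ ≤ (√b / 4) ^ 4)
    (hDρ : 5 * L ^ 2 * Real.log (√b / 4) < (D * ρ) ^ 2) :
    ∃ S : Finset (Fin n), k - J * b ≤ S.card ∧ ∃ i < J, ∃ j : ℕ,
      ρ ≤ 2⁻¹ ^ i ∧ 2 ^ j * (√b / 4) ≤ 3 * D ∧
        x ∈ lcdLevelClass κ (2 ^ j * (√b / 4)) (2⁻¹ ^ i) S := by
  obtain ⟨S, hSk, hScard, hsρ, hspread⟩ := exists_spread_subset hxI hk hJk hδ hJ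
  have hρ0 : 0 < ρ := lt_of_lt_of_le (by positivity) hJ
  set s := ‖coordRestrict S x‖ with hs
  set s' := ‖coordRestrict (smallIndices x k) x‖ with hs'
  have hs0 : 0 < s := hρ0.trans hsρ
  have hss' : s ≤ s' := norm_coordRestrict_mono hSk x
  have hs'0 : 0 < s' := hs0.trans_le hss'
  have hs'1 : s' ≤ 1 := (norm_coordRestrict_le _ x).trans_eq hxI.1
  set m : ℝ := √b / 4 with hm
  have hm1 : 1 ≤ m := by
    have : √(16 : ℝ) ≤ √b := Real.sqrt_le_sqrt (by exact_mod_cast hb)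
    rw [show (16 : ℝ) = 4 ^ 2 by norm_num, Real.sqrt_sq (by norm_num)] at this
    rw [hm]; linarith
  have hL2 : 1 ≤ L ^ 2 := one_le_pow₀ hL.le
  obtain ⟨θ, hθ1, hθ2, hθ⟩ := exists_latticeDistSq_lt_of_mem_levelSetTS hD hxT hs'0
  have hθ0 : 0 < θ := hD.trans_le hθ1
  -- The same dilation `r` is used on `S`, where its scale drops from `θ = r s'` to `r s`. Since `s
  -- > ρ` and `s' ≤ 1`, the loss is at most the factor `ρ⁻¹`.
  set r := θ / s' with hr
  have hr0 : 0 < r := by positivity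
  have hrs : r * s ≤ θ := by
    rw [hr, div_mul_eq_mul_div, div_le_iff₀ hs'0]
    gcongr
  have hθrs : θ ≤ r * s * ρ⁻¹ := by
    rw [← div_eq_mul_inv, le_div_iff₀ hρ0, hr, div_mul_eq_mul_div, le_div_iff₀ hs'0]
    calc θ * ρ * s' ≤ θ * s * 1 := by gcongr
      _ = _ := by ring
  have hDrs : D * ρ ≤ r * s := by
    have h1 : θ ≤ r := by
      rw [hr, le_div_iff₀ hs'0]; nlinarith
    exact mul_le_mul (by linarith) hsρ.le hρ0.le hr0.le
  have hdS : latticeDistSq S x r ≤ L ^ 2 * max (Real.log (θ / L)) 0 :=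
    (Finset.sum_le_sum_of_subset_of_nonneg hSk fun _ _ _ => sq_nonneg _).trans hθ
  -- As `ρ⁻¹ ≤ m⁴ ≤ y⁴`, the lost factor only multiplies the logarithm by `5`. Then `5 log(rs) ≤
  -- (5/2) log(1 + (rs)²)`, which `κ ≥ 3L²` absorbs.
  have hlogθ : ∀ y, m ≤ y → r * s ≤ y → max (Real.log (θ / L)) 0 ≤ 5 * Real.log y := by
    intro y hy hry
    have hy0 : 0 < y := by linarith
    have hlog0 : 0 ≤ Real.log y := Real.log_nonneg (by linarith)
    refine max_le ?_ (by linarith)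
    have h1 : θ / L ≤ y ^ 5 := by
      rw [div_le_iff₀ (by linarith)]
      calc θ ≤ r * s * ρ⁻¹ := hθrs
        _ ≤ y * y ^ 4 := by
          gcongr
          exact hρ.trans (by gcongr)
        _ = y ^ 5 * 1 := by ring
        _ ≤ y ^ 5 * L := by gcongr
    calc Real.log (θ / L) ≤ Real.log (y ^ 5) := Real.log_le_log (by positivity) h1
      _ = 5 * Real.log y := by rw [Real.log_pow]; norm_num
  -- Below `m` the lattice distance on `S` would be the full `rs ≥ Dρ`, too large by `hDρ`.
  have hmrs : m ≤ r * s := by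
    by_contra hlt
    push Not at hlt
    have h1 := latticeDistSq_eq_of_le (by omega) hspread (r := r)
      (by rw [abs_of_pos hr0]; exact hlt.le)
    rw [← hs] at h1
    have h2 := hlogθ m le_rfl hlt.le
    have h3 : (D * ρ) ^ 2 ≤ (r * s) ^ 2 := pow_le_pow_left₀ (by positivity) hDrs 2
    have h4 := mul_le_mul_of_nonneg_left h2 (show 0 ≤ L ^ 2 by positivity)
    linarith
  have hdS' : latticeDistSq S x r ≤ κ * Real.log (1 + (r * s) ^ 2) := by
    refine hdS.trans ?_
    have h1 := hlogθ (r * s) hmrs le_rfl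
    have hrs0 : 0 < r * s := by positivity
    have h2 : 2 * Real.log (r * s) ≤ Real.log (1 + (r * s) ^ 2) := by
      rw [show 2 * Real.log (r * s) = Real.log ((r * s) ^ 2) by rw [Real.log_pow]; norm_num]
      exact Real.log_le_log (by positivity) (by linarith)
    have h3 : 0 ≤ Real.log (r * s) := Real.log_nonneg (by linarith)
    calc L ^ 2 * max (Real.log (θ / L)) 0 ≤ L ^ 2 * (5 * Real.log (r * s)) := by gcongr
      _ ≤ 3 * L ^ 2 * Real.log (1 + (r * s) ^ 2) := by
        have h4 := mul_le_mul_of_nonneg_left h2 (show 0 ≤ L ^ 2 by positivity)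
        have h5 := mul_nonneg (show 0 ≤ L ^ 2 by positivity) h3
        linarith
      _ ≤ _ := by gcongr; linarith
  have hs1 : s ≤ 1 := hss'.trans hs'1
  obtain ⟨i, hi1, hi2⟩ := exists_nat_pow_near_of_lt_one hs0 hs1
    (show (0 : ℝ) < 2⁻¹ by norm_num) (by norm_num)
  have hκ0 : 0 ≤ κ := le_trans (by positivity) hκ
  obtain ⟨j, hj1, hj2⟩ := exists_dyadic_mem_lcdLevelClass (σ := 2⁻¹ ^ i) hxI.1 hκ0 (by omega)
    (by positivity) (by rw [pow_succ] at hi1; linarith) hi2 hspread hmrs hdS'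
  refine ⟨S, hScard, i, ?_, j, hsρ.le.trans hi2, hj1.trans (hrs.trans hθ2), hj2⟩
  by_contra hiJ
  push Not at hiJ
  have : (2 : ℝ)⁻¹ ^ i ≤ 2⁻¹ ^ J := pow_le_pow_of_le_one (by norm_num) (by norm_num) hiJ
  linarith

/-! ### Net cardinality against small ball probability at one scale. -/

/-- Here `X = max(1, D/√n)`. Coordinates in `S` cost `O(X)` each; those outside lose a further `n²`,
which is affordable because they are few. -/
lemma card_latticeBox_le_scale {n : ℕ} (hn : 0 < n) (S : Finset (Fin n)) {δ D σ τ X : ℝ}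
    (hδ0 : 0 < δ) (hδ1 : δ < 1) (hσ : δ / √n ≤ σ) (hτ1 : 1 ≤ τ) (hτD : τ ≤ D)
    (hX : D / min D (√n) = X) :
    ((latticeBox S (3 * D * √n) (⌈√n * D / (σ * τ)⌉₊ + 1)).card : ℝ) ≤
      Real.exp n * (56 / δ * X) ^ n * ((n : ℝ) ^ 2) ^ Sᶜ.card := by
  have hn1 : (1 : ℝ) ≤ n := by exact_mod_cast hn
  have hsn1 : 1 ≤ √(n : ℝ) := Real.one_le_sqrt.2 hn1
  have hsq : √(n : ℝ) * √n = n := Real.mul_self_sqrt (by linarith)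
  have hsn2 : √(n : ℝ) ≤ n := by nlinarith
  have hD1 : 1 ≤ D := hτ1.trans hτD
  have hD0 : 0 < D := by linarith
  set μ := min D (√(n : ℝ)) with hμ
  have hμ1 : 1 ≤ μ := le_min hD1 hsn1
  have hμ0 : 0 < μ := by linarith
  have hμn : μ ≤ n := (min_le_right _ _).trans hsn2
  have hX1 : 1 ≤ X := by rw [← hX, one_le_div hμ0]; exact min_le_left _ _
  have hDX : D = X * μ := by rw [← hX]; field_simp
  have hσ0 : 0 < σ := lt_of_lt_of_le (by positivity) hσ
  have h8 : 2 * (1 + 3 * D * √n / n) ≤ 56 / δ * X := by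
    have h56 : 56 ≤ 56 / δ := by rw [le_div_iff₀ hδ0]; linarith
    have h1 : 3 * D * √n / n = 3 * (D / √n) := by
      rw [← hsq]; field_simp
      rw [Real.sq_sqrt (by positivity)]
    have h2 : D / √n ≤ X := by
      rw [← hX]
      gcongr
      exact min_le_right _ _
    rw [h1]
    nlinarith
  have h7 : 2 * ((⌈√n * D / (σ * τ)⌉₊ + 1 : ℕ) : ℝ) + 1 ≤ 56 / δ * X * n ^ 2 := by
    have h1 : (⌈√n * D / (σ * τ)⌉₊ : ℝ) ≤ √n * D / (σ * τ) + 1 := (Nat.ceil_lt_add_one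
      (by positivity)).le
    have h2 : √n * D / (σ * τ) ≤ X * n ^ 2 / δ := by
      have : δ / √n * 1 ≤ σ * τ := by gcongr
      calc √n * D / (σ * τ) ≤ √n * D / (δ / √n * 1) := by gcongr
        _ = √n * √n * D / δ := by field_simp
        _ = n * (X * μ) / δ := by rw [hsq, ← hDX]
        _ ≤ n * (X * n) / δ := by gcongr
        _ = _ := by ring
    have h3 : 1 ≤ X * n ^ 2 / δ := by
      rw [le_div_iff₀ hδ0]
      nlinarith [one_le_pow₀ hn1 (n := 2)]
    have h4 : 56 / δ * X * n ^ 2 = 56 * (X * n ^ 2 / δ) := by ring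
    push_cast
    rw [h4]
    linarith
  have h56X : 0 ≤ 56 / δ * X := by positivity
  refine (card_latticeBox_le hn S (by positivity) _).trans ?_
  have hcard : S.card + Sᶜ.card = n := by
    rw [Finset.card_add_card_compl, Fintype.card_fin]
  calc Real.exp n * (2 * (1 + 3 * D * √n / n)) ^ S.card *
        (2 * ((⌈√n * D / (σ * τ)⌉₊ + 1 : ℕ) : ℝ) + 1) ^ Sᶜ.card
      ≤ Real.exp n * (56 / δ * X) ^ S.card * (56 / δ * X * n ^ 2) ^ Sᶜ.card := by gcongr
    _ = Real.exp n * (56 / δ * X) ^ (S.card + Sᶜ.card) * ((n : ℝ) ^ 2) ^ Sᶜ.card := by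
        rw [mul_pow _ ((n : ℝ) ^ 2), pow_add]; ring
    _ = _ := by rw [hcard]

/-- Since `κ ≥ b²`, the Gaussian tail is at most `(1 + 4D²)⁻¹` and is absorbed by the main term. -/
lemma smallBall_bound_le {a b p₀ κ D τ G : ℝ} (hb : 0 < b)
    (hκb : b ^ 2 ≤ κ) (hτ : κ * Real.log (1 + 4 * D ^ 2) = τ ^ 2) (hτ1 : 1 ≤ τ) (hD1 : 1 ≤ D)
    (hG : 1 ≤ G) :
    (4 * p₀)⁻¹ * Real.pi * (24 * Real.pi / a * (G * τ / D)) +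
      2 * Real.exp (-(6 * Real.pi * (G * τ) / b) ^ 2) ≤
    ((4 * p₀)⁻¹ * Real.pi * (24 * Real.pi / a) + 1) * (G * τ / D) := by
  have h1 : Real.exp (-(6 * Real.pi * (G * τ) / b) ^ 2) ≤ (1 + 4 * D ^ 2)⁻¹ := by
    rw [Real.exp_neg]
    apply inv_anti₀ (by positivity)
    rw [← Real.log_le_iff_le_exp (by positivity)]
    have hlog : 0 ≤ Real.log (1 + 4 * D ^ 2) := Real.log_nonneg (by nlinarith)
    have h2 : b ^ 2 * Real.log (1 + 4 * D ^ 2) ≤ τ ^ 2 := by rw [← hτ]; gcongr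
    rw [div_pow, le_div_iff₀ (by positivity), mul_comm]
    refine h2.trans ?_
    have h3 : τ ≤ 6 * Real.pi * (G * τ) := by
      have h4 : τ ≤ G * τ := by nlinarith
      nlinarith [Real.pi_gt_three]
    gcongr
  have h2 : 2 * (1 + 4 * D ^ 2)⁻¹ ≤ G * τ / D := by
    rw [← div_eq_mul_inv, div_le_div_iff₀ (by positivity) (by positivity)]
    have : 1 ≤ G * τ := by nlinarith
    nlinarith
  have h3 : (4 * p₀)⁻¹ * Real.pi * (24 * Real.pi / a * (G * τ / D)) =
    (4 * p₀)⁻¹ * Real.pi * (24 * Real.pi / a) * (G * τ / D) := by ring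
  rw [h3, add_mul]
  linarith

/-- The factor `X^n` of the count meets `X^{-(n-1)}` from the small ball bound. The surviving `X ≤
D` and the `4D` choices for `1/r` make up `4D²`. -/
lemma measureReal_mem_lcdLevelClass_le_scale {n : ℕ} (hn : 0 < n) {Ω : Type*} [MeasurableSpace Ω]
    {P : Measure Ω} [IsProbabilityMeasure P] {μ : Measure ℝ} [IsProbabilityMeasure μ]
    {R : Ω → Matrix (Fin n) (Fin n) ℝ}
    (hind : iIndepFun (fun (p : Fin n × Fin n) ω => R ω p.1 p.2) P)
    (hmeas : ∀ i j, Measurable (fun ω => R ω i j)) (hμ : ∀ i j, P.map (fun ω => R ω i j) = μ)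
    (M : Matrix (Fin n) (Fin n) ℝ) {a b p₀ κ : ℝ} (ha : 0 < a) (hab : a ≤ b) (hp₀ : 0 < p₀)
    (hp₁ : p₀ ≤ 1 / 4) (hp : p₀ ≤ (μ.prod μ).real {p | a ≤ |p.1 - p.2| ∧ |p.1 - p.2| ≤ b})
    (hκ : 1 ≤ 4 * p₀ * κ) (hκb : b ^ 2 ≤ κ) {Z : Ω → EuclideanSpace ℝ (Fin n)}
    (hZ : ∀ ω, Z ω ∈ (spanFirstColumns (R ω + M))ᗮ) {δ D σ τ Λ q₀ : ℝ} (S : Finset (Fin n))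
    (hδ0 : 0 < δ) (hδ1 : δ < 1) (hσ : δ / √n ≤ σ)
    (hτ : κ * Real.log (1 + 4 * D ^ 2) = τ ^ 2) (hτ1 : 1 ≤ τ) (hτD : τ ≤ D)
    (hΛ : √n ≤ Λ) (hq : Λ / √n * τ ≤ q₀ * min D (√n)) :
    P.real {ω | ‖Matrix.toEuclideanCLM (n := Fin n) (𝕜 := ℝ) (R ω + M)‖ ≤ Λ ∧
        Z ω ∈ lcdLevelClass κ D σ S} ≤
      Real.exp (3 / 2 * n) * (56 / δ) ^ n * ((n : ℝ) ^ 2) ^ Sᶜ.card * (4 * D ^ 2) *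
        (((4 * p₀)⁻¹ * Real.pi * (24 * Real.pi / a) + 1) * q₀) ^ (n - 1) := by
  have hn1 : (1 : ℝ) ≤ n := by exact_mod_cast hn
  have hsn1 : 1 ≤ √(n : ℝ) := Real.one_le_sqrt.2 hn1
  have hsn0 : 0 < √(n : ℝ) := by linarith
  have hD1 : 1 ≤ D := hτ1.trans hτD
  have hD0 : 0 < D := by linarith
  have hσ0 : 0 < σ := lt_of_lt_of_le (by positivity) hσ
  have hb : 0 < b := ha.trans_le hab
  have hm1 : 1 ≤ min D (√(n : ℝ)) := le_min hD1 hsn1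
  obtain ⟨X, hX⟩ : ∃ X, D / min D (√n) = X := ⟨_, rfl⟩
  have hX1 : 1 ≤ X := by rw [← hX, one_le_div (by linarith)]; exact min_le_left _ _
  have hXD : X ≤ D := by rw [← hX]; exact div_le_self hD0.le hm1
  set K₂ := (4 * p₀)⁻¹ * Real.pi * (24 * Real.pi / a) + 1 with hK₂
  have hK₂0 : 0 < K₂ := by positivity
  set G := Λ / √n with hG
  have hG1 : 1 ≤ G := by rwa [hG, one_le_div hsn0]
  refine (measureReal_mem_lcdLevelClass_le hn hind hmeas hμ M ha hab hp₀ hp₁ hp hκ hZ S hτ hτ1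
    hτD hσ0 (hsn0.trans_le hΛ)).trans ?_
  have e1 : Λ * τ / (D * √n) = G * τ / D := by rw [hG]; field_simp
  have e2 : Λ * τ / √n = G * τ := by rw [hG]; field_simp
  rw [e1, e2]
  have hsb := smallBall_bound_le (a := a) (p₀ := p₀) hb hκb hτ hτ1 hD1 hG1
  have hGX : G * τ / D ≤ q₀ / X := by
    rw [← hX, div_div_eq_mul_div]
    exact div_le_div_of_nonneg_right hq hD0.le
  have hq₀ : 0 ≤ q₀ / X := le_trans (by positivity) hGX
  have hq : (4 * p₀)⁻¹ * Real.pi * (24 * Real.pi / a * (G * τ / D)) +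
      2 * Real.exp (-(6 * Real.pi * (G * τ) / b) ^ 2) ≤ K₂ * q₀ / X := by
    exact hsb.trans ((mul_le_mul_of_nonneg_left hGX hK₂0.le).trans_eq (by ring))
  have hceil : (⌈D / τ⌉₊ : ℝ) + 2 ≤ 4 * D := by
    have h1 : (⌈D / τ⌉₊ : ℝ) ≤ D / τ + 1 := (Nat.ceil_lt_add_one (by positivity)).le
    have h2 : D / τ ≤ D := div_le_self hD0.le hτ1
    linarith
  have hcard := card_latticeBox_le_scale hn S hδ0 hδ1 hσ hτ1 hτD hX
  obtain ⟨m, rfl⟩ : ∃ m, n = m + 1 := ⟨n - 1, by omega⟩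
  rw [Nat.add_sub_cancel]
  set N : ℝ := ((m + 1 : ℕ) : ℝ)
  have hK₂q : 0 ≤ K₂ * q₀ := by
    have : K₂ * q₀ = K₂ * (q₀ / X) * X := by field_simp
    rw [this]; positivity
  calc _ ≤ (Real.exp N * (56 / δ * X) ^ (m + 1) * (N ^ 2) ^ Sᶜ.card) * (4 * D) *
        (Real.exp (N / 2) * (K₂ * q₀ / X) ^ m) := by gcongr
    _ = Real.exp (3 / 2 * N) * (56 / δ) ^ (m + 1) * (N ^ 2) ^ Sᶜ.card * (4 * D * X) *
        (K₂ * q₀) ^ m := by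
      have : Real.exp (3 / 2 * N) = Real.exp N * Real.exp (N / 2) := by
        rw [← Real.exp_add]; congr 1; ring
      have h2 : X ^ m * (K₂ * q₀ / X) ^ m = (K₂ * q₀) ^ m := by
        rw [← mul_pow]; congr 1; field_simp
      rw [this, mul_pow, pow_succ X, ← h2]
      ring
    _ ≤ _ := by
      have : 4 * D * X ≤ 4 * D ^ 2 := by nlinarith
      gcongr

/-! ### Asymptotics of the parameters. -/

open Filter in
lemma eventually_mul_log_pow_le_rpow (K : ℝ) (p : ℕ) {α : ℝ} (hα : 0 < α) :
    ∀ᶠ n : ℕ in atTop, K * Real.log n ^ p ≤ (n : ℝ) ^ α := by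
  have h := (isLittleO_log_rpow_rpow_atTop p hα).bound (c := (|K| + 1)⁻¹) (by positivity)
  have h2 := tendsto_natCast_atTop_atTop (R := ℝ) |>.eventually h
  filter_upwards [h2, eventually_ge_atTop 1] with n hn hn1
  have hn1' : (1 : ℝ) ≤ n := by exact_mod_cast hn1
  have hlog : 0 ≤ Real.log n := Real.log_nonneg hn1'
  rw [Real.rpow_natCast, Real.norm_of_nonneg (by positivity), Real.norm_of_nonneg (by positivity),
    ← div_eq_inv_mul, le_div_iff₀ (by positivity)] at hn
  refine le_trans ?_ hn
  rw [mul_comm]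
  gcongr
  linarith [le_abs_self K]

/-- The size of the blocks of coordinates removed in the search for a spread vector. -/
noncomputable def blockSize (δ : ℝ) (n : ℕ) : ℕ := ⌊δ * n / (8 * Real.log n ^ 2)⌋₊

/-- The number of blocks of coordinates in the search for a spread vector. -/
noncomputable def blockCount (n : ℕ) : ℕ := ⌈2 * Real.log n⌉₊

open Filter in
lemma eventually_two_le_log : ∀ᶠ n : ℕ in atTop, 2 ≤ Real.log n :=
  (Real.tendsto_log_atTop.comp (tendsto_natCast_atTop_atTop (R := ℝ))).eventually_ge_atTop 2

-- The spread scale is of order `√n / log n`; the floor in `blockSize` costs a factor `2`.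
open Filter in
lemma eventually_le_sqrt_blockSize {δ : ℝ} (hδ0 : 0 < δ) :
    ∀ᶠ n : ℕ in atTop, √δ * √n / (16 * Real.log n) ≤ √(blockSize δ n) / 4 := by
  filter_upwards [eventually_two_le_log, eventually_mul_log_pow_le_rpow (16 / δ) 2 one_pos,
    eventually_ge_atTop 1] with n hl hn hn1
  rw [Real.rpow_one] at hn
  set ℓ := Real.log n
  have hℓ0 : 0 < ℓ := by linarith
  have h1 : 1 ≤ δ * n / (16 * ℓ ^ 2) := by
    rw [le_div_iff₀ (by positivity)]
    rw [div_mul_eq_mul_div, div_le_iff₀ hδ0] at hn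
    linarith
  have h2 : δ * n / (16 * ℓ ^ 2) ≤ blockSize δ n := by
    have h3 := Nat.sub_one_lt_floor (δ * n / (8 * ℓ ^ 2))
    have h4 : δ * n / (8 * ℓ ^ 2) = 2 * (δ * n / (16 * ℓ ^ 2)) := by field_simp; norm_num
    rw [blockSize]
    linarith
  have h5 := Real.sqrt_le_sqrt h2
  rw [Real.sqrt_div (by positivity), Real.sqrt_mul hδ0.le,
    show 16 * ℓ ^ 2 = (4 * ℓ) ^ 2 by ring, Real.sqrt_sq (by positivity)] at h5
  calc √δ * √n / (16 * ℓ) = √δ * √n / (4 * ℓ) / 4 := by field_simp; norm_num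
    _ ≤ _ := by gcongr

open Filter in
lemma eventually_const_le_sqrt_blockSize {δ : ℝ} (hδ0 : 0 < δ) (Y : ℝ) :
    ∀ᶠ n : ℕ in atTop, Y ≤ √(blockSize δ n) / 4 := by
  filter_upwards [eventually_two_le_log, eventually_le_sqrt_blockSize hδ0,
    eventually_mul_log_pow_le_rpow (16 * Y / √δ) 1 (half_pos one_pos)] with n hl hb hn
  rw [← Real.sqrt_eq_rpow, pow_one, div_mul_eq_mul_div,
    div_le_iff₀ (Real.sqrt_pos.2 hδ0)] at hn
  refine le_trans ?_ hb
  rw [le_div_iff₀ (by linarith)]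
  linarith

open Filter in
lemma eventually_mul_log_one_add_le_sq (κ : ℝ) :
    ∀ᶠ y : ℝ in atTop, κ * Real.log (1 + 4 * y ^ 2) ≤ y ^ 2 := by
  have h := (Real.isLittleO_log_id_atTop).bound (c := (|κ| * 4 + 4)⁻¹) (by positivity)
  have ht : Tendsto (fun y : ℝ => 1 + 4 * y ^ 2) atTop atTop :=
    tendsto_atTop_add_const_left _ _ ((tendsto_pow_atTop two_ne_zero).const_mul_atTop four_pos)
  filter_upwards [ht.eventually h, eventually_ge_atTop (1 : ℝ)] with y hy hy1
  have hlog : 0 ≤ Real.log (1 + 4 * y ^ 2) := Real.log_nonneg (by nlinarith)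
  rw [Real.norm_of_nonneg hlog, id, Real.norm_of_nonneg (by positivity), ← div_eq_inv_mul,
    le_div_iff₀ (by positivity)] at hy
  have h1 : κ * Real.log (1 + 4 * y ^ 2) ≤ |κ| * Real.log (1 + 4 * y ^ 2) := by
    gcongr; exact le_abs_self κ
  have h2 : 1 + 4 * y ^ 2 ≤ 4 * y ^ 2 + 4 * Real.log (1 + 4 * y ^ 2) := by
    have : (1 : ℝ) / 2 ≤ Real.log (1 + 4 * y ^ 2) := by
      have h3 : Real.log 2 ≤ Real.log (1 + 4 * y ^ 2) :=
        Real.log_le_log (by norm_num) (by nlinarith)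
      linarith [Real.log_two_gt_d9]
    linarith
  nlinarith

/-- The inequalities between the parameters that hold for large dimension. -/
structure ScaleConditions (δ C L κ q₀ K γ₀ : ℝ) (n : ℕ) : Prop where
  two_le_log : 2 ≤ Real.log n
  blockSize_ge : 16 ≤ blockSize δ n
  blockCount_le : blockCount n ≤ n
  sqrt_le : √n / δ ≤ (√(blockSize δ n) / 4) ^ 4
  log_lt : 5 * L ^ 2 * Real.log n < (1 / 2 * C * δ * (n : ℝ) ^ (1 - γ₀) / Real.log n) ^ 2
  small_scale : K * (n : ℝ) ^ (γ₀ - 1 / 2) * √(κ * Real.log (1 + 4 * n)) ≤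
    q₀ * (√(blockSize δ n) / 4)
  gap_le : ∀ y, √(blockSize δ n) / 4 ≤ y → κ * Real.log (1 + 4 * y ^ 2) ≤ y ^ 2
  le_scale : 37 ≤ 1 / 2 * C * √n / Real.log n
  one_le_mul_sqrt : 1 ≤ δ * √n

-- The conditions reduce to a power of `log n` being dominated by a positive power of `n`; `γ₀ < 1`
-- makes the exponent `1 - γ₀` positive.
open Filter in
lemma eventually_scaleConditions {δ C L κ q₀ K γ₀ : ℝ} (hδ0 : 0 < δ) (hC : 0 < C) (hL : 1 < L)
    (hκ : 0 ≤ κ) (hq₀ : 0 < q₀) (hK : 0 ≤ K) (hγ₀ : γ₀ < 1) :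
    ∀ᶠ n : ℕ in atTop, ScaleConditions δ C L κ q₀ K γ₀ n := by
  have hγ : 0 < 1 - γ₀ := by linarith
  obtain ⟨Y, hY⟩ := eventually_atTop.1 (eventually_mul_log_one_add_le_sq κ)
  filter_upwards [eventually_two_le_log, eventually_le_sqrt_blockSize hδ0,
    eventually_const_le_sqrt_blockSize hδ0 1, eventually_const_le_sqrt_blockSize hδ0 Y,
    eventually_mul_log_pow_le_rpow (2 ^ 16 / δ ^ 3) 4 (show (0 : ℝ) < 3 / 2 by norm_num),
    eventually_mul_log_pow_le_rpow (2 * (3 * L) / (C * δ)) 2 hγ,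
    eventually_mul_log_pow_le_rpow (32 * √κ * K / (q₀ * √δ)) 2 hγ,
    eventually_mul_log_pow_le_rpow (37 * 2 / C) 1 (half_pos one_pos),
    eventually_mul_log_pow_le_rpow (1 / δ) 0 (half_pos one_pos),
    eventually_mul_log_pow_le_rpow 3 1 one_pos, eventually_ge_atTop 2]
    with n hl hb hb1 hbY h4 h5 h6 h7 h8 h9 hn2
  have hn2' : (2 : ℝ) ≤ n := by exact_mod_cast hn2
  have hn0 : (0 : ℝ) < n := two_pos.trans_le hn2'
  set ℓ := Real.log n with hℓ
  have hℓ0 : 0 < ℓ := by linarith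
  set B := √(blockSize δ n : ℝ) / 4 with hB
  have hsn0 : 0 < √(n : ℝ) := Real.sqrt_pos.2 hn0
  have hsδ : 0 < √δ := Real.sqrt_pos.2 hδ0
  have hsq : √(n : ℝ) ^ 2 = n := Real.sq_sqrt hn0.le
  have hsqδ : √δ ^ 2 = δ := Real.sq_sqrt hδ0.le
  refine ⟨hl, ?_, ?_, ?_, ?_, ?_, fun y hy => hY y (hbY.trans hy), ?_, ?_⟩
  · have h1 : 4 ≤ √(blockSize δ n : ℝ) := by linarith
    have h2 := (Real.le_sqrt' (by norm_num)).1 h1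
    have h3 : (16 : ℝ) ≤ blockSize δ n := by linarith
    exact_mod_cast h3
  · rw [pow_one, Real.rpow_one] at h9
    refine Nat.ceil_le.2 ?_
    linarith
  · have h10 : (√δ * √n / (16 * ℓ)) ^ 4 ≤ B ^ 4 := by gcongr
    refine le_trans ?_ h10
    have e : (√δ * √n / (16 * ℓ)) ^ 4 = δ ^ 2 * (n : ℝ) ^ 2 / (2 ^ 16 * ℓ ^ 4) := by
      rw [div_pow, mul_pow, mul_pow, show √δ ^ 4 = (√δ ^ 2) ^ 2 by ring, hsqδ,
        show √(n : ℝ) ^ 4 = (√n ^ 2) ^ 2 by ring, hsq]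
      norm_num
    have e2 : (n : ℝ) ^ (3 / 2 : ℝ) * √n = n ^ 2 := by
      rw [Real.sqrt_eq_rpow, ← Real.rpow_add hn0, ← Real.rpow_natCast]
      norm_num
    rw [e, div_le_div_iff₀ hδ0 (by positivity), ← e2]
    rw [div_mul_eq_mul_div, div_le_iff₀ (by positivity)] at h4
    calc √n * (2 ^ 16 * ℓ ^ 4) ≤ √n * ((n : ℝ) ^ (3 / 2 : ℝ) * δ ^ 3) := by gcongr
      _ = _ := by ring
  · have h10 : 3 * L * ℓ ≤ 1 / 2 * C * δ * (n : ℝ) ^ (1 - γ₀) / ℓ := by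
      rw [le_div_iff₀ hℓ0]
      rw [div_mul_eq_mul_div, div_le_iff₀ (by positivity)] at h5
      linarith
    have h11 : (3 * L * ℓ) ^ 2 ≤ (1 / 2 * C * δ * (n : ℝ) ^ (1 - γ₀) / ℓ) ^ 2 := by gcongr
    refine lt_of_lt_of_le ?_ h11
    have h12 : 0 < L ^ 2 * ℓ := by positivity
    have h13 : (3 * L * ℓ) ^ 2 = 9 * ((L ^ 2 * ℓ) * ℓ) := by ring
    rw [h13]
    nlinarith
  · have h10 : √(κ * Real.log (1 + 4 * n)) ≤ √κ * (2 * ℓ) := by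
      rw [Real.sqrt_mul hκ]
      gcongr
      apply Real.sqrt_le_iff.2 ⟨by positivity, ?_⟩
      have h11 : Real.log (1 + 4 * n) ≤ Real.log ((n : ℝ) ^ 4) := by
        apply Real.log_le_log (by positivity)
        calc 1 + 4 * (n : ℝ) ≤ 2 ^ 3 * n := by linarith only [hn2']
          _ ≤ n ^ 3 * n := by gcongr
          _ = n ^ 4 := by ring
      rw [Real.log_pow] at h11
      push_cast at h11
      nlinarith
    have h12 : (n : ℝ) ^ (γ₀ - 1 / 2) * (n : ℝ) ^ (1 - γ₀) = √n := by
      rw [← Real.rpow_add hn0, Real.sqrt_eq_rpow]; congr 1; ring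
    refine le_trans ?_ (mul_le_mul_of_nonneg_left hb hq₀.le)
    rw [div_mul_eq_mul_div, div_le_iff₀ (by positivity)] at h6
    calc K * (n : ℝ) ^ (γ₀ - 1 / 2) * √(κ * Real.log (1 + 4 * n))
        ≤ K * (n : ℝ) ^ (γ₀ - 1 / 2) * (√κ * (2 * ℓ)) := by gcongr
      _ = (n : ℝ) ^ (γ₀ - 1 / 2) * (32 * √κ * K * ℓ ^ 2) / (16 * ℓ) := by field_simp; ring
      _ ≤ (n : ℝ) ^ (γ₀ - 1 / 2) * ((n : ℝ) ^ (1 - γ₀) * (q₀ * √δ)) / (16 * ℓ) := by gcongr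
      _ = ((n : ℝ) ^ (γ₀ - 1 / 2) * (n : ℝ) ^ (1 - γ₀)) * (q₀ * √δ) / (16 * ℓ) := by ring
      _ = q₀ * (√δ * √n / (16 * ℓ)) := by rw [h12]; ring
  · rw [pow_one, ← Real.sqrt_eq_rpow, div_mul_eq_mul_div, div_le_iff₀ hC] at h7
    rw [le_div_iff₀ hℓ0]
    linarith
  · rw [pow_zero, mul_one, ← Real.sqrt_eq_rpow, div_le_iff₀ hδ0] at h8
    linarith

/-- The removed coordinates number `O(δn / log n)`, the same order as the bound on `n - k`, so
`n^{2|Sᶜ|}` stays exponential in `n`. -/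
lemma blockCount_mul_blockSize_le {δ : ℝ} (hδ0 : 0 < δ) {n : ℕ} (hl : 2 ≤ Real.log n) :
    (blockCount n : ℝ) * blockSize δ n ≤ 3 / 8 * (δ * n / Real.log n) := by
  set ℓ := Real.log n
  have hℓ : 0 < ℓ := by linarith
  have h1 : (blockCount n : ℝ) ≤ 3 * ℓ := by
    have := (Nat.ceil_lt_add_one (show 0 ≤ 2 * ℓ by positivity)).le
    rw [blockCount]
    linarith
  have h2 : (blockSize δ n : ℝ) ≤ δ * n / (8 * ℓ ^ 2) := Nat.floor_le (by positivity)
  calc (blockCount n : ℝ) * blockSize δ n ≤ 3 * ℓ * (δ * n / (8 * ℓ ^ 2)) := by gcongr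
    _ = _ := by field_simp

/-- Holds because `2 log 2 ≥ 1`. -/
lemma inv_two_pow_blockCount_le {n : ℕ} (hn : 0 < n) : (2 : ℝ)⁻¹ ^ blockCount n ≤ (n : ℝ)⁻¹ := by
  have hn0 : (0 : ℝ) < n := Nat.cast_pos.2 hn
  have hl : 0 ≤ Real.log n := Real.log_natCast_nonneg n
  rw [inv_pow]
  apply inv_anti₀ hn0
  rw [← Real.log_le_log_iff hn0 (by positivity), Real.log_pow]
  have h1 : 2 * Real.log n ≤ blockCount n := Nat.le_ceil _
  have h2 := Real.log_two_gt_d9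
  nlinarith

lemma exists_lcdLevelClass_of_scaleConditions {δ C L κ q₀ K γ₀ γ D : ℝ} {n k : ℕ} (hδ0 : 0 < δ)
    (hδ1 : δ < 1) (hC : 0 < C) (hL : 1 < L) (hκ : 3 * L ^ 2 ≤ κ)
    (hs : ScaleConditions δ C L κ q₀ K γ₀ n) (hγ₀ : γ₀ < 1)
    (hγ2 : γ ≤ γ₀) (hD : 1 / 2 * C * √n / Real.log n < D)
    (hk : (n : ℝ) - δ * n / Real.log n ≤ k) (hkn : k ≤ n) {x : EuclideanSpace ℝ (Fin n)}
    (hxT : x ∈ levelSetTS D k n L)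
    (hxI : x ∈ incompVectors n δ (δ * (n : ℝ) ^ (1 / 2 - γ))) :
    ∃ S : Finset (Fin n), (Sᶜ.card : ℝ) * Real.log n ≤ 2 * n ∧ ∃ i < n, ∃ j : ℕ,
      δ / √n ≤ 2⁻¹ ^ i ∧ 2 ^ j * (√(blockSize δ n) / 4) ≤ 3 * D ∧
        x ∈ lcdLevelClass κ (2 ^ j * (√(blockSize δ n) / 4)) (2⁻¹ ^ i) S := by
  have hl := hs.two_le_log
  have hn : 0 < n := by
    rcases Nat.eq_zero_or_pos n with h | h
    · rw [h] at hl; norm_num at hl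
    · exact h
  have hn1 : (1 : ℝ) ≤ n := by exact_mod_cast hn
  have hn0 : (0 : ℝ) < n := by linarith
  set ℓ := Real.log n with hℓ
  have hℓ0 : 0 < ℓ := by linarith
  have hsn : 0 < √(n : ℝ) := Real.sqrt_pos.2 hn0
  have hsq : √(n : ℝ) * √n = n := Real.mul_self_sqrt hn0.le
  set ρ := δ * (n : ℝ) ^ (1 / 2 - γ) with hρ
  have hγ1 : γ < 1 := by linarith
  have hρle : δ / √n ≤ ρ := by
    rw [hρ, div_eq_mul_inv, Real.sqrt_eq_rpow, ← Real.rpow_neg hn0.le]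
    gcongr
    linarith
  have hρ0 : 0 < ρ := lt_of_lt_of_le (by positivity) hρle
  have hD37 : 37 ≤ D := hs.le_scale.trans hD.le
  have hJb := blockCount_mul_blockSize_le hδ0 hl
  have hδnl : δ * n / ℓ * ℓ = δ * n := by field_simp
  have hdl0 : 0 ≤ δ * n / ℓ := by positivity
  have hδn : δ * n < n := mul_lt_of_lt_one_left hn0 hδ1
  have hsum : (n : ℝ) - k + blockCount n * blockSize δ n ≤ 11 / 8 * (δ * n / ℓ) := by linarith
  have hsum' : (n : ℝ) - k + blockCount n * blockSize δ n ≤ δ * n := by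
    have := mul_le_mul_of_nonneg_left hl hdl0
    linarith
  have hJk : blockCount n * blockSize δ n ≤ k := by
    have : ((blockCount n * blockSize δ n : ℕ) : ℝ) ≤ k := by push_cast; linarith
    exact_mod_cast this
  have hJ : (2 : ℝ)⁻¹ ^ blockCount n ≤ ρ := by
    refine (inv_two_pow_blockCount_le hn).trans (le_trans ?_ hρle)
    have h1 : √(n : ℝ) * 1 ≤ √n * (δ * √n) :=
      mul_le_mul_of_nonneg_left hs.one_le_mul_sqrt hsn.le
    rw [le_div_iff₀ hsn, inv_mul_le_iff₀ hn0]
    calc √(n : ℝ) ≤ √n * √n * δ := by linarith only [h1]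
      _ = n * δ := by rw [hsq]
  have hρinv : ρ⁻¹ ≤ (√(blockSize δ n) / 4) ^ 4 := by
    refine le_trans ?_ hs.sqrt_le
    rw [show √(n : ℝ) / δ = (δ / √n)⁻¹ by rw [inv_div]]
    exact inv_anti₀ (by positivity) hρle
  have hm0 : 0 < √(blockSize δ n : ℝ) := Real.sqrt_pos.2 (by
    have := hs.blockSize_ge
    exact_mod_cast (by omega : 0 < blockSize δ n))
  have hmn : √(blockSize δ n : ℝ) / 4 ≤ n := by
    have h1 : (blockSize δ n : ℝ) ≤ n := by
      refine (Nat.floor_le (by positivity)).trans ?_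
      have h0 : 1 ≤ 8 * ℓ ^ 2 := by nlinarith only [hl]
      rw [div_le_iff₀ (by positivity)]
      exact hδn.le.trans (le_mul_of_one_le_right hn0.le h0)
    have h2 : √(blockSize δ n : ℝ) ≤ √n := Real.sqrt_le_sqrt h1
    have h3 : 1 ≤ √(n : ℝ) := Real.one_le_sqrt.2 hn1
    nlinarith only [h2, h3, hsq]
  -- The lower bound on `D` enters here: `Dρ ≳ n^{1-γ} / log n`, a positive power of `n` up to the
  -- logarithm.
  have hDρ : 5 * L ^ 2 * Real.log (√(blockSize δ n) / 4) < (D * ρ) ^ 2 := by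
    have h1 : Real.log (√(blockSize δ n) / 4) ≤ ℓ := Real.log_le_log (by positivity) hmn
    have h2 : 1 / 2 * C * δ * (n : ℝ) ^ (1 - γ₀) / ℓ ≤ D * ρ := by
      have h3 : (n : ℝ) ^ (1 - γ₀) ≤ √n * (n : ℝ) ^ (1 / 2 - γ) := by
        rw [Real.sqrt_eq_rpow, ← Real.rpow_add hn0]
        exact Real.rpow_le_rpow_of_exponent_le hn1 (by linarith)
      calc 1 / 2 * C * δ * (n : ℝ) ^ (1 - γ₀) / ℓ
          ≤ 1 / 2 * C * δ * (√n * (n : ℝ) ^ (1 / 2 - γ)) / ℓ := by gcongr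
        _ = 1 / 2 * C * √n / ℓ * ρ := by rw [hρ]; ring
        _ ≤ D * ρ := by gcongr
    calc 5 * L ^ 2 * Real.log (√(blockSize δ n) / 4) ≤ 5 * L ^ 2 * ℓ := by gcongr
      _ < _ := hs.log_lt
      _ ≤ _ := by gcongr
  obtain ⟨S, hS, i, hi, j, hij1, hij2, hmem⟩ := exists_mem_lcdLevelClass hxT hxI hkn hJk hsum' hJ
    hs.blockSize_ge hL (by linarith) hκ hρinv hDρ
  refine ⟨S, ?_, i, hi.trans_le hs.blockCount_le, j, hρle.trans hij1, hij2, hmem⟩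
  have h1 : S.card ≤ n := by simpa using S.card_le_univ
  rw [Finset.card_compl, Fintype.card_fin, Nat.cast_sub h1]
  have h2 : (k : ℝ) - blockCount n * blockSize δ n ≤ S.card := by
    have h3 : ((k - blockCount n * blockSize δ n : ℕ) : ℝ) ≤ S.card := by exact_mod_cast hS
    rw [Nat.cast_sub hJk] at h3
    push_cast at h3
    exact h3
  have h4 : (n : ℝ) - S.card ≤ 11 / 8 * (δ * n / ℓ) := by linarith
  calc ((n : ℝ) - S.card) * ℓ ≤ 11 / 8 * (δ * n / ℓ) * ℓ := by gcongr
    _ = 11 / 8 * (δ * n) := by rw [mul_assoc, hδnl]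
    _ ≤ 2 * n := by linarith

/-- The arithmetic behind the range of `D`. For `D' ≤ √n`, the scale is at least `√b/4 ≈ √n / log
n`, which beats `n^{γ₀-1/2} √(log n)`. For `D' > √n`, `τ² ≤ 3κ c₁ n^{2-2γ}`, and `c₁` is chosen so
that `Kτ ≤ q₀ n^{1-γ}`. -/
lemma opNorm_mul_threshold_le {δ C L κ q₀ K γ₀ γ c₁ D D' τ : ℝ} {n : ℕ} (hn : 1 ≤ n)
    (hκ : 1 ≤ κ) (hq₀ : 0 < q₀) (hK : 1 ≤ K)
    (hs : ScaleConditions δ C L κ q₀ K γ₀ n) (hγ2 : γ ≤ γ₀)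
    (hc₁ : c₁ ≤ q₀ ^ 2 / (3 * κ * K ^ 2)) (hD37 : 37 ≤ D)
    (hD : D < Real.exp (c₁ * (n : ℝ) ^ (2 - 2 * γ))) (hD'1 : √(blockSize δ n) / 4 ≤ D')
    (hD'2 : D' ≤ 3 * D) (hτ0 : 0 ≤ τ) (hτ : κ * Real.log (1 + 4 * D' ^ 2) = τ ^ 2) :
    K * (n : ℝ) ^ γ / √n * τ ≤ q₀ * min D' (√n) := by
  have hn1 : (1 : ℝ) ≤ n := by exact_mod_cast hn
  have hn0 : (0 : ℝ) < n := by linarith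
  have hsn : 0 < √(n : ℝ) := Real.sqrt_pos.2 hn0
  have hD'0 : 0 ≤ D' := le_trans (by positivity) hD'1
  have hpow : (n : ℝ) ^ γ / √n = (n : ℝ) ^ (γ - 1 / 2) := by
    rw [Real.sqrt_eq_rpow, ← Real.rpow_sub hn0]
  rw [mul_div_assoc, hpow]
  rcases le_or_gt D' (√n) with h | h
  · rw [min_eq_left h]
    have h1 : τ ≤ √(κ * Real.log (1 + 4 * n)) := by
      apply Real.le_sqrt_of_sq_le
      rw [← hτ]
      have : D' ^ 2 ≤ n := by
        calc D' ^ 2 ≤ √(n : ℝ) ^ 2 := by gcongr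
          _ = (n : ℝ) := Real.sq_sqrt hn0.le
      gcongr
    calc K * (n : ℝ) ^ (γ - 1 / 2) * τ
        ≤ K * (n : ℝ) ^ (γ₀ - 1 / 2) * √(κ * Real.log (1 + 4 * n)) := by gcongr
      _ ≤ _ := hs.small_scale
      _ ≤ _ := by gcongr
  · rw [min_eq_right h.le]
    have h1 : Real.log (1 + 4 * D' ^ 2) ≤ 3 * (c₁ * (n : ℝ) ^ (2 - 2 * γ)) := by
      -- The threshold `37` comes from here: `1 + 36 D² ≤ 37 D² ≤ D³`.
      have h2 : 1 + 4 * D' ^ 2 ≤ D ^ 3 := by nlinarith [pow_le_pow_left₀ hD'0 hD'2 2]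
      have h3 : Real.log D ≤ c₁ * (n : ℝ) ^ (2 - 2 * γ) := by
        rw [Real.log_le_iff_le_exp (by linarith)]; exact hD.le
      calc Real.log (1 + 4 * D' ^ 2) ≤ Real.log (D ^ 3) := Real.log_le_log (by positivity) h2
        _ = 3 * Real.log D := by rw [Real.log_pow]; norm_num
        _ ≤ _ := by linarith
    have h4 : K * τ ≤ q₀ * (n : ℝ) ^ (1 - γ) := by
      refine abs_le_of_sq_le_sq' ?_ (by positivity) |>.2
      have e : ((n : ℝ) ^ (1 - γ)) ^ 2 = (n : ℝ) ^ (2 - 2 * γ) := by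
        rw [← Real.rpow_natCast, ← Real.rpow_mul hn0.le]; congr 1; push_cast; ring
      rw [mul_pow, mul_pow, ← hτ, e]
      rw [le_div_iff₀ (by positivity)] at hc₁
      calc K ^ 2 * (κ * Real.log (1 + 4 * D' ^ 2))
          ≤ K ^ 2 * (κ * (3 * (c₁ * (n : ℝ) ^ (2 - 2 * γ)))) := by gcongr
        _ = c₁ * (3 * κ * K ^ 2) * (n : ℝ) ^ (2 - 2 * γ) := by ring
        _ ≤ _ := by gcongr
    calc K * (n : ℝ) ^ (γ - 1 / 2) * τ = (n : ℝ) ^ (γ - 1 / 2) * (K * τ) := by ring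
      _ ≤ (n : ℝ) ^ (γ - 1 / 2) * (q₀ * (n : ℝ) ^ (1 - γ)) := by gcongr
      _ = q₀ * ((n : ℝ) ^ (γ - 1 / 2) * (n : ℝ) ^ (1 - γ)) := by ring
      _ = q₀ * √n := by
        rw [← Real.rpow_add hn0, Real.sqrt_eq_rpow]; congr 2; ring

/-! ### Final numerical bounds and the union over classes. -/

lemma natCast_sq_pow_le_exp {n m : ℕ} (hn : 0 < n) (hm : (m : ℝ) * Real.log n ≤ 2 * n) :
    ((n : ℝ) ^ 2) ^ m ≤ Real.exp (4 * n) := by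
  have hn0 : (0 : ℝ) < n := Nat.cast_pos.2 hn
  rw [← pow_mul, ← Real.log_le_iff_le_exp (by positivity), Real.log_pow]
  push_cast
  linarith

lemma two_pow_le_exp (n : ℕ) : (2 : ℝ) ^ n ≤ Real.exp n := by
  have h : (2 : ℝ) ≤ Real.exp 1 := by linarith [Real.exp_one_gt_d9]
  calc (2 : ℝ) ^ n ≤ Real.exp 1 ^ n := by gcongr
    _ = Real.exp n := by rw [← Real.exp_nat_mul, mul_one]

lemma natCast_sq_le_exp (n : ℕ) : (n : ℝ) ^ 2 ≤ Real.exp (2 * n) := by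
  have h : (n : ℝ) ≤ Real.exp n := by linarith [Real.add_one_le_exp (n : ℝ)]
  calc (n : ℝ) ^ 2 ≤ Real.exp n ^ 2 := by gcongr
    _ = Real.exp (2 * n) := by rw [← Real.exp_nat_mul]; norm_num

/-- The exponent `16` in `H` is the sum of the costs `5, 1, 2, 3/2, 4, 2` for `144`, `2^n`, `n²`,
the count, the coordinates outside `S` and `D'²`, plus a slack `1/2`. Because the power is `n - 1 ≥
n/2`, `s` carries `H⁻²` and `e^{-4}` to produce `H^{-n}` and `e^{-2n}`. -/
lemma card_mul_level_bound_le {n m : ℕ} (hn : 2 ≤ n) {δ D D' H s : ℝ} (hδ0 : 0 < δ)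
    (hδ1 : δ < 1) (hm : (m : ℝ) * Real.log n ≤ 2 * n) (hD'0 : 0 ≤ D') (hD' : D' ≤ 3 * D)
    (hD : D ≤ Real.exp n) (hH : H = Real.exp 16 * (56 / δ))
    (hs : s = (H ^ 2)⁻¹ * Real.exp (-4)) :
    (2 ^ n * (n * (4 * n)) : ℝ) * (Real.exp (3 / 2 * n) * (56 / δ) ^ n * ((n : ℝ) ^ 2) ^ m *
      (4 * D' ^ 2) * s ^ (n - 1)) ≤ Real.exp (-2 * n) := by
  have hn2 : (2 : ℝ) ≤ n := by exact_mod_cast hn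
  have hH1 : 1 ≤ H := by
    have h1 : 1 ≤ Real.exp 16 := Real.one_le_exp (by norm_num)
    have h2 : 1 ≤ 56 / δ := by rw [one_le_div hδ0]; linarith
    rw [hH]; exact one_le_mul_of_one_le_of_one_le h1 h2
  have hs0 : 0 ≤ s := by rw [hs]; positivity
  have h1 := natCast_sq_pow_le_exp (by omega) hm
  have h2 : 4 * D' ^ 2 ≤ 36 * Real.exp (2 * n) := by
    have : D' ^ 2 ≤ (3 * Real.exp n) ^ 2 := by gcongr; linarith
    calc 4 * D' ^ 2 ≤ 4 * (3 * Real.exp n) ^ 2 := by gcongr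
      _ = 36 * Real.exp n ^ 2 := by ring
      _ = 36 * Real.exp (2 * n) := by rw [← Real.exp_nat_mul]; norm_num
  have h3 : (144 : ℝ) ≤ Real.exp (5 * n) := by
    calc (144 : ℝ) ≤ 2 ^ 10 := by norm_num
      _ ≤ Real.exp 10 := by simpa using two_pow_le_exp 10
      _ ≤ Real.exp (5 * n) := by gcongr; linarith
  have h4 : s ^ (n - 1) ≤ (H ^ n)⁻¹ * Real.exp (-2 * n) := by
    rw [hs, mul_pow, inv_pow, ← pow_mul, ← Real.exp_nat_mul]
    have e : ((n - 1 : ℕ) : ℝ) = n - 1 := by rw [Nat.cast_sub (by omega)]; simp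
    refine mul_le_mul (inv_anti₀ (by positivity) (pow_le_pow_right₀ hH1 (by omega)))
      (Real.exp_le_exp.2 ?_) (Real.exp_nonneg _) (by positivity)
    rw [e]; linarith
  have e16 : Real.exp 16 ^ n = Real.exp (5 * n) * Real.exp n * Real.exp (2 * n) *
      Real.exp (3 / 2 * n) * Real.exp (4 * n) * Real.exp (2 * n) * Real.exp (1 / 2 * n) := by
    simp only [← Real.exp_nat_mul, ← Real.exp_add]
    congr 1; ring
  calc (2 ^ n * (n * (4 * n)) : ℝ) * (Real.exp (3 / 2 * n) * (56 / δ) ^ n * ((n : ℝ) ^ 2) ^ m *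
        (4 * D' ^ 2) * s ^ (n - 1))
      ≤ (2 ^ n * (n * (4 * n)) : ℝ) * (Real.exp (3 / 2 * n) * (56 / δ) ^ n * Real.exp (4 * n) *
        (36 * Real.exp (2 * n)) * ((H ^ n)⁻¹ * Real.exp (-2 * n))) := by gcongr
    _ = 144 * 2 ^ n * (n : ℝ) ^ 2 * Real.exp (3 / 2 * n) * Real.exp (4 * n) * Real.exp (2 * n) *
        1 * ((56 / δ) ^ n * (H ^ n)⁻¹ * Real.exp (-2 * n)) := by ring
    _ ≤ Real.exp (5 * n) * Real.exp n * Real.exp (2 * n) * Real.exp (3 / 2 * n) *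
        Real.exp (4 * n) * Real.exp (2 * n) * Real.exp (1 / 2 * n) *
        ((56 / δ) ^ n * (H ^ n)⁻¹ * Real.exp (-2 * n)) := by
      gcongr
      · exact two_pow_le_exp n
      · exact natCast_sq_le_exp n
      · exact Real.one_le_exp (by positivity)
    _ = Real.exp 16 ^ n * (56 / δ) ^ n * (H ^ n)⁻¹ * Real.exp (-2 * n) := by rw [e16]; ring
    _ = Real.exp (-2 * n) := by
      rw [← mul_pow, ← hH, mul_inv_cancel₀ (by positivity), one_mul]

lemma lt_four_mul_of_two_pow_le {j n : ℕ} (hn : 2 ≤ n) (h : (2 : ℝ) ^ j ≤ 3 * Real.exp n) :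
    j < 4 * n := by
  have hn2 : (2 : ℝ) ≤ n := by exact_mod_cast hn
  have h5 := Real.log_le_log (by positivity) h
  rw [Real.log_pow, Real.log_mul (by norm_num) (Real.exp_pos _).ne', Real.log_exp] at h5
  have h6 : Real.log 3 ≤ 2 := by
    have := Real.log_le_sub_one_of_pos (show (0 : ℝ) < 3 by norm_num)
    linarith
  have h7 : (0.69 : ℝ) ≤ Real.log 2 := by linarith [Real.log_two_gt_d9]
  have h8 : (j : ℝ) * 0.69 ≤ j * Real.log 2 := by gcongr
  by_contra! h9
  have h10 : (4 : ℝ) * n ≤ j := by exact_mod_cast h9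
  linarith

/-- The probability of a single class of the decomposition of the level set, multiplied by the
number of classes, is at most `e^{-2n}`. -/
lemma card_mul_measureReal_mem_lcdLevelClass_le {δ C L κ q₀ K γ₀ γ c₁ D D' σ a b p₀ H : ℝ} {n : ℕ}
    (hn : 2 ≤ n) (hδ0 : 0 < δ) (hδ1 : δ < 1) {Ω : Type*} [MeasurableSpace Ω]
    {P : Measure Ω} [IsProbabilityMeasure P] {μ : Measure ℝ} [IsProbabilityMeasure μ]
    {R : Ω → Matrix (Fin n) (Fin n) ℝ}
    (hind : iIndepFun (fun (p : Fin n × Fin n) ω => R ω p.1 p.2) P)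
    (hmeas : ∀ i j, Measurable (fun ω => R ω i j)) (hμ : ∀ i j, P.map (fun ω => R ω i j) = μ)
    (M : Matrix (Fin n) (Fin n) ℝ) (ha : 0 < a) (hab : a ≤ b) (hp₀ : 0 < p₀)
    (hp₁ : p₀ ≤ 1 / 4) (hp : p₀ ≤ (μ.prod μ).real {p | a ≤ |p.1 - p.2| ∧ |p.1 - p.2| ≤ b})
    (hκ : 1 ≤ 4 * p₀ * κ) (hκb : b ^ 2 ≤ κ) (hκ1 : 1 ≤ κ)
    (hK : 1 ≤ K) (hH : H = Real.exp 16 * (56 / δ))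
    (hq₀ : q₀ = (H ^ 2)⁻¹ * Real.exp (-4) / ((4 * p₀)⁻¹ * Real.pi * (24 * Real.pi / a) + 1))
    (hc₁ : c₁ ≤ q₀ ^ 2 / (3 * κ * K ^ 2))
    (hs : ScaleConditions δ C L κ q₀ K γ₀ n) (hγ1 : 1 / 2 < γ) (hγ2 : γ ≤ γ₀) (hD37 : 37 ≤ D)
    (hD : D < Real.exp (c₁ * (n : ℝ) ^ (2 - 2 * γ))) (hDn : D ≤ Real.exp n)
    {Z : Ω → EuclideanSpace ℝ (Fin n)} (hZ : ∀ ω, Z ω ∈ (spanFirstColumns (R ω + M))ᗮ)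
    (S : Finset (Fin n)) (hS : (Sᶜ.card : ℝ) * Real.log n ≤ 2 * n) (hσ : δ / √n ≤ σ)
    (hB1 : 1 ≤ √(blockSize δ n) / 4) (hD'1 : √(blockSize δ n) / 4 ≤ D') (hD'2 : D' ≤ 3 * D) :
    (2 ^ n * (n * (4 * n)) : ℝ) *
      P.real {ω | ‖Matrix.toEuclideanCLM (n := Fin n) (𝕜 := ℝ) (R ω + M)‖ ≤ K * (n : ℝ) ^ γ ∧
        Z ω ∈ lcdLevelClass κ D' σ S} ≤ Real.exp (-2 * n) := by
  have hn2 : (2 : ℝ) ≤ n := by exact_mod_cast hn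
  have hn0 : (0 : ℝ) < n := by linarith
  have hK₂0 : 0 < (4 * p₀)⁻¹ * Real.pi * (24 * Real.pi / a) + 1 := by positivity
  have hH0 : 0 < H := by rw [hH]; positivity
  have hq₀0 : 0 < q₀ := by rw [hq₀]; positivity
  have hKq : ((4 * p₀)⁻¹ * Real.pi * (24 * Real.pi / a) + 1) * q₀ =
      (H ^ 2)⁻¹ * Real.exp (-4) := by
    rw [hq₀, mul_div_cancel₀ _ hK₂0.ne']
  have hΛn : √n ≤ K * (n : ℝ) ^ γ := by
    rw [Real.sqrt_eq_rpow]
    exact (Real.rpow_le_rpow_of_exponent_le (by linarith) hγ1.le).trans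
      (le_mul_of_one_le_left (by positivity) hK)
  have hD'0 : 1 ≤ D' := hB1.trans hD'1
  have hlog : 1 ≤ Real.log (1 + 4 * D' ^ 2) := by
    rw [Real.le_log_iff_exp_le (by positivity)]
    nlinarith only [Real.exp_one_lt_d9, hD'0]
  obtain ⟨τ, hτ0, hτ⟩ : ∃ τ, 0 ≤ τ ∧ κ * Real.log (1 + 4 * D' ^ 2) = τ ^ 2 :=
    ⟨√(κ * Real.log (1 + 4 * D' ^ 2)), Real.sqrt_nonneg _, (Real.sq_sqrt (by positivity)).symm⟩
  have hτ1 : 1 ≤ τ := by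
    have : 1 ≤ τ ^ 2 := by rw [← hτ]; exact one_le_mul_of_one_le_of_one_le hκ1 hlog
    exact (one_le_sq_iff₀ hτ0).1 this
  have hτD : τ ≤ D' := by
    have : τ ^ 2 ≤ D' ^ 2 := by rw [← hτ]; exact hs.gap_le D' hD'1
    exact abs_le_of_sq_le_sq' this (by linarith) |>.2
  have hq := opNorm_mul_threshold_le (by omega) hκ1 hq₀0 hK hs hγ2 hc₁ hD37 hD hD'1 hD'2 hτ0 hτ
  have h := measureReal_mem_lcdLevelClass_le_scale (by omega) hind hmeas hμ M ha hab hp₀ hp₁ hp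
    hκ hκb hZ S hδ0 hδ1 hσ hτ hτ1 hτD hΛn hq
  rw [hKq] at h
  exact (mul_le_mul_of_nonneg_left h (by positivity)).trans
    (card_mul_level_bound_le hn hδ0 hδ1 hS (by linarith) hD'2 hDn hH rfl)

/-- The probability that the random normal vector lies in the level set while the operator norm
is bounded is at most `e^{-2n}`. -/
lemma measureReal_opNorm_le_inter_levelSetTS_le {δ C L κ q₀ K γ₀ γ c₁ D a b p₀ H : ℝ} {n k : ℕ}
    (hδ0 : 0 < δ) (hδ1 : δ < 1) (hC : 0 < C) (hL : 1 < L)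
    {Ω : Type*} [MeasurableSpace Ω]
    {P : Measure Ω} [IsProbabilityMeasure P] {μ : Measure ℝ} [IsProbabilityMeasure μ]
    {R : Ω → Matrix (Fin n) (Fin n) ℝ}
    (hind : iIndepFun (fun (p : Fin n × Fin n) ω => R ω p.1 p.2) P)
    (hmeas : ∀ i j, Measurable (fun ω => R ω i j)) (hμ : ∀ i j, P.map (fun ω => R ω i j) = μ)
    (M : Matrix (Fin n) (Fin n) ℝ) (ha : 0 < a) (hab : a ≤ b) (hp₀ : 0 < p₀)
    (hp₁ : p₀ ≤ 1 / 4) (hp : p₀ ≤ (μ.prod μ).real {p | a ≤ |p.1 - p.2| ∧ |p.1 - p.2| ≤ b})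
    (hκ : 1 ≤ 4 * p₀ * κ) (hκb : b ^ 2 ≤ κ) (hκL : 3 * L ^ 2 ≤ κ) (hκ1 : 1 ≤ κ)
    (hK : 1 ≤ K) (hH : H = Real.exp 16 * (56 / δ))
    (hq₀ : q₀ = (H ^ 2)⁻¹ * Real.exp (-4) / ((4 * p₀)⁻¹ * Real.pi * (24 * Real.pi / a) + 1))
    (hc₁ : c₁ ≤ q₀ ^ 2 / (3 * κ * K ^ 2)) (hc₁1 : c₁ ≤ 1)
    (hs : ScaleConditions δ C L κ q₀ K γ₀ n) (hγ₀ : γ₀ < 1) (hγ1 : 1 / 2 < γ)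
    (hγ2 : γ ≤ γ₀) (hD : 1 / 2 * C * √n / Real.log n < D)
    (hD2 : D < Real.exp (c₁ * (n : ℝ) ^ (2 - 2 * γ)))
    (hk : (n : ℝ) - δ * n / Real.log n ≤ k) (hkn : k ≤ n) {Z : Ω → EuclideanSpace ℝ (Fin n)}
    (hZ : ∀ ω, Z ω ∈ (spanFirstColumns (R ω + M))ᗮ) :
    P.real {ω | ‖Matrix.toEuclideanCLM (n := Fin n) (𝕜 := ℝ) (R ω + M)‖ ≤ K * (n : ℝ) ^ γ ∧
      Z ω ∈ levelSetTS D k n L ∩ incompVectors n δ (δ * (n : ℝ) ^ (1 / 2 - γ))} ≤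
      Real.exp (-2 * n) := by
  have hl := hs.two_le_log
  have hn : 2 ≤ n := by
    by_contra! h
    interval_cases n <;> norm_num at hl
  have hn2 : (2 : ℝ) ≤ n := by exact_mod_cast hn
  have hn0 : (0 : ℝ) < n := by linarith
  have hD37 : 37 ≤ D := hs.le_scale.trans hD.le
  obtain ⟨B, hB⟩ : ∃ B, √(blockSize δ n : ℝ) / 4 = B := ⟨_, rfl⟩
  have hB1 : 1 ≤ B := by
    have h1 : (4 : ℝ) ≤ √(blockSize δ n : ℝ) := by
      apply Real.le_sqrt_of_sq_le
      have : (16 : ℝ) ≤ blockSize δ n := by exact_mod_cast hs.blockSize_ge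
      linarith
    rw [← hB]; linarith
  have hDn : D ≤ Real.exp n := by
    -- Uses `c₁ ≤ 1` and `2 - 2γ < 1`; this keeps the number of dyadic scales below `4n`.
    refine hD2.le.trans (Real.exp_le_exp.2 ?_)
    calc c₁ * (n : ℝ) ^ (2 - 2 * γ) ≤ 1 * (n : ℝ) ^ (1 : ℝ) := by
          gcongr
          · linarith
          · linarith
      _ = n := by rw [Real.rpow_one, one_mul]
  let E : Finset (Fin n) × ℕ × ℕ → Set Ω := fun t =>
    {ω | ‖Matrix.toEuclideanCLM (n := Fin n) (𝕜 := ℝ) (R ω + M)‖ ≤ K * (n : ℝ) ^ γ ∧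
      Z ω ∈ lcdLevelClass κ (2 ^ t.2.2 * B) (2⁻¹ ^ t.2.1) t.1}
  let T : Finset (Finset (Fin n) × ℕ × ℕ) :=
    (Finset.univ ×ˢ Finset.range n ×ˢ Finset.range (4 * n)).filter fun t =>
      ((t.1ᶜ.card : ℝ) * Real.log n ≤ 2 * n ∧ δ / √n ≤ 2⁻¹ ^ t.2.1 ∧ 2 ^ t.2.2 * B ≤ 3 * D)
  have hT : (T.card : ℝ) ≤ 2 ^ n * (n * (4 * n)) := by
    have h : T.card ≤ 2 ^ n * (n * (4 * n)) := by
      refine (Finset.card_filter_le _ _).trans_eq ?_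
      simp [Finset.card_product]
    exact_mod_cast h
  have hsubset : {ω | ‖Matrix.toEuclideanCLM (n := Fin n) (𝕜 := ℝ) (R ω + M)‖ ≤ K * (n : ℝ) ^ γ ∧
      Z ω ∈ levelSetTS D k n L ∩ incompVectors n δ (δ * (n : ℝ) ^ (1 / 2 - γ))} ⊆
      ⋃ t ∈ T, E t := by
    rintro ω ⟨h1, h2, h3⟩
    obtain ⟨S, hS, i, hi, j, hij1, hij2, hmem⟩ := exists_lcdLevelClass_of_scaleConditions hδ0 hδ1
      hC hL hκL hs hγ₀ hγ2 hD hk hkn h2 h3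
    rw [hB] at hij2 hmem
    have hj : j < 4 * n := by
      apply lt_four_mul_of_two_pow_le hn
      have : (2 : ℝ) ^ j ≤ 2 ^ j * B := le_mul_of_one_le_right (by positivity) hB1
      linarith only [this, hij2, hDn]
    refine Set.mem_biUnion (x := (S, i, j)) ?_ ⟨h1, hmem⟩
    exact Finset.mem_filter.2 ⟨by simp [hi, hj], hS, hij1, hij2⟩
  have hbound : ∀ t ∈ T, P.real (E t) ≤ (2 ^ n * (n * (4 * n)) : ℝ)⁻¹ * Real.exp (-2 * n) := by
    intro t ht
    obtain ⟨-, hS, hi, hj⟩ := Finset.mem_filter.1 ht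
    rw [← div_eq_inv_mul, le_div_iff₀' (by positivity)]
    exact card_mul_measureReal_mem_lcdLevelClass_le hn hδ0 hδ1 hind hmeas hμ M ha hab hp₀ hp₁ hp hκ
      hκb hκ1 hK hH hq₀ hc₁ hs hγ1 hγ2 hD37 hD2 hDn hZ t.1 hS hi (by rwa [hB])
      (by rw [hB]; exact le_mul_of_one_le_left (by linarith) (one_le_pow₀ one_le_two)) hj
  calc _ ≤ P.real (⋃ t ∈ T, E t) := measureReal_mono hsubset (measure_ne_top _ _)
    _ ≤ ∑ t ∈ T, P.real (E t) := measureReal_biUnion_finset_le _ _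
    _ ≤ T.card • ((2 ^ n * (n * (4 * n)) : ℝ)⁻¹ * Real.exp (-2 * n)) :=
        Finset.sum_le_card_nsmul _ _ _ hbound
    _ ≤ (2 ^ n * (n * (4 * n)) : ℝ) * ((2 ^ n * (n * (4 * n)) : ℝ)⁻¹ * Real.exp (-2 * n)) := by
        rw [nsmul_eq_mul]; gcongr
    _ = Real.exp (-2 * n) := mul_inv_cancel_left₀ (by positivity) _

theorem lemma6p8 {Ω₀ : Type*} [MeasurableSpace Ω₀] (P₀ : Measure Ω₀) [IsProbabilityMeasure P₀]
    (ξ : Ω₀ → ℝ) (hξ : Measurable ξ) (hsub : IsSubgaussian P₀ ξ)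
    (hmean : ∫ ω, ξ ω ∂P₀ = 0) (hvar : variance ξ P₀ = 1)
    (L δ C : ℝ) (hL : 1 < L) (hδ0 : 0 < δ) (hδ1 : δ < 1) (hC : 0 < C) :
    ∃ c₁ : ℝ, 0 < c₁ ∧ ∃ c₂ : ℝ, 0 < c₂ ∧ ∀ γ₀ : ℝ, γ₀ < 1 → ∃ n₀ : ℕ,
      ∀ γ : ℝ, 1 / 2 < γ → γ ≤ γ₀ → ∀ n : ℕ, n₀ < n →
      ∀ D : ℝ, 1 / 2 * C * √(n : ℝ) / Real.log n < D →
        D < Real.exp (c₁ * (n : ℝ) ^ (2 - 2 * γ)) →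
      ∀ k : ℕ, (n : ℝ) - δ * n / Real.log n ≤ k → k ≤ n →
      ∀ {Ω : Type*} [MeasurableSpace Ω] (P : Measure Ω) [IsProbabilityMeasure P]
        (R : Ω → Matrix (Fin n) (Fin n) ℝ) (M : Matrix (Fin n) (Fin n) ℝ)
        (Z : Ω → EuclideanSpace ℝ (Fin n)),
        iIndepFun (fun (p : Fin n × Fin n) (ω : Ω) => R ω p.1 p.2) P →
        (∀ i j, Measurable (fun ω => R ω i j)) →
        (∀ i j, IdentDistrib (fun ω => R ω i j) ξ P P₀) →
        ‖Matrix.toEuclideanCLM (n := Fin n) (𝕜 := ℝ) M‖ ≤ (n : ℝ) ^ γ →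
        Measurable Z →
        (∀ ω, ‖Z ω‖ = 1) →
        (∀ ω, Z ω ∈ (spanFirstColumns (R ω + M))ᗮ) →
        P.real {ω | Z ω ∈ levelSetTS D k n L ∩ incompVectors n δ (δ * (n : ℝ) ^ (1 / 2 - γ))}
          < Real.exp (-c₂ * n) := by

  obtain ⟨a, b, p₀, ha, hab, hp₀, hp₁, hp⟩ :=
    exists_symmetrized_mass P₀ ξ hξ (by rw [hvar]; exact one_ne_zero)
  obtain ⟨c, hc, hmgf⟩ := hsub.exists_hasSubgaussianMGF hξ hmean
  -- The threshold `κ` must make the characteristic function decay integrable, control the Gaussian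
  -- tail, and dominate the LCD threshold after the loss of scale; the sum of all requirements
  -- serves.
  obtain ⟨κ, hκ, hκb, hκL, hκ1⟩ : ∃ κ : ℝ, 1 ≤ 4 * p₀ * κ ∧ b ^ 2 ≤ κ ∧ 3 * L ^ 2 ≤ κ ∧ 1 ≤ κ := by
    refine ⟨(4 * p₀)⁻¹ + b ^ 2 + 3 * L ^ 2 + 1, ?_, ?_, ?_, ?_⟩
    · have h1 : 4 * p₀ * (4 * p₀)⁻¹ = 1 := mul_inv_cancel₀ (by positivity)
      have h2 : 0 ≤ 4 * p₀ * (b ^ 2 + 3 * L ^ 2 + 1) := by positivity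
      linarith
    all_goals
      have h1 : 0 ≤ (4 * p₀)⁻¹ := by positivity
      nlinarith [sq_nonneg b, sq_nonneg L]
  -- The first term bounds the random part, as `√n ≤ n^γ`; the `1` is for `M`.
  obtain ⟨K, hK⟩ : ∃ K, K = 3 * √(48 * c) + 1 := ⟨_, rfl⟩
  have hK1 : 1 ≤ K := by
    have := Real.sqrt_nonneg (48 * (c : ℝ))
    linarith
  obtain ⟨H, hH⟩ : ∃ H, H = Real.exp 16 * (56 / δ) := ⟨_, rfl⟩
  have hH0 : 0 < H := by rw [hH]; positivity
  obtain ⟨q₀, hq₀⟩ : ∃ q₀, q₀ = (H ^ 2)⁻¹ * Real.exp (-4) /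
    ((4 * p₀)⁻¹ * Real.pi * (24 * Real.pi / a) + 1) := ⟨_, rfl⟩
  have hq₀0 : 0 < q₀ := by rw [hq₀]; positivity
  have hc₁0 : 0 < min 1 (q₀ ^ 2 / (3 * κ * K ^ 2)) := lt_min one_pos (by positivity)
  -- Neither constant involves `γ₀`, which only affects `n₀`. The choice `c₂ = 1` works because two
  -- events of probability at most `e^{-2n}` give `2e^{-2n} < e^{-n}`.
  refine ⟨min 1 (q₀ ^ 2 / (3 * κ * K ^ 2)), hc₁0, 1, one_pos, fun γ₀ hγ₀ => ?_⟩
  obtain ⟨n₀, hn₀⟩ := Filter.eventually_atTop.1 (eventually_scaleConditions (κ := κ) (q₀ := q₀)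
    (K := K) hδ0 hC hL (by linarith) hq₀0 (by linarith) hγ₀)
  refine ⟨n₀, fun γ hγ1 hγ2 n hn D hD hD2 k hk hkn Ω _ P _ R M Z hind hmeas hid hM _ _ hZ => ?_⟩
  have hs := hn₀ n hn.le
  have hn0 : 0 < n := by omega
  have hn1 : (1 : ℝ) ≤ n := by exact_mod_cast hn0
  have : IsProbabilityMeasure (P₀.map ξ) := Measure.isProbabilityMeasure_map hξ.aemeasurable
  have h1 := measureReal_opNorm_le_inter_levelSetTS_le (P := P) (R := R) (M := M) hδ0 hδ1 hC hL
    hind hmeas (fun i j => (hid i j).map_eq) ha hab hp₀ hp₁ hp hκ hκb hκL hκ1 hK1 hH hq₀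
    (min_le_right _ _) (min_le_left _ _) hs hγ₀ hγ1 hγ2 hD hD2 hk hkn hZ
  have h2 := measureReal_norm_gt_le hn0 hind hc
    (fun i j => hmgf.congr_identDistrib (hid i j).symm)
  have hsubset : {ω | Z ω ∈ levelSetTS D k n L ∩ incompVectors n δ (δ * (n : ℝ) ^ (1 / 2 - γ))} ⊆
      {ω | ‖Matrix.toEuclideanCLM (n := Fin n) (𝕜 := ℝ) (R ω + M)‖ ≤ K * (n : ℝ) ^ γ ∧
        Z ω ∈ levelSetTS D k n L ∩ incompVectors n δ (δ * (n : ℝ) ^ (1 / 2 - γ))} ∪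
      {ω | 3 * √(48 * c) * √n < ‖Matrix.toEuclideanCLM (n := Fin n) (𝕜 := ℝ) (R ω)‖} := by
    intro ω hω
    rcases le_or_gt ‖Matrix.toEuclideanCLM (n := Fin n) (𝕜 := ℝ) (R ω)‖ (3 * √(48 * c) * √n)
      with h | h
    · refine Or.inl ⟨?_, hω⟩
      have h3 : √(n : ℝ) ≤ (n : ℝ) ^ γ := by
        rw [Real.sqrt_eq_rpow]
        exact Real.rpow_le_rpow_of_exponent_le hn1 hγ1.le
      rw [map_add]
      calc _ ≤ _ := norm_add_le _ _
        _ ≤ 3 * √(48 * c) * √n + (n : ℝ) ^ γ := add_le_add h hM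
        _ ≤ 3 * √(48 * c) * (n : ℝ) ^ γ + (n : ℝ) ^ γ := by gcongr
        _ = K * (n : ℝ) ^ γ := by rw [hK]; ring
    · exact Or.inr h
  calc _ ≤ _ := measureReal_mono hsubset (measure_ne_top _ _)
    _ ≤ _ := measureReal_union_le _ _
    _ ≤ Real.exp (-2 * n) + Real.exp (-2 * n) := add_le_add h1 h2
    _ = 2 * Real.exp (-n) * Real.exp (-n) := by
      rw [mul_assoc, ← Real.exp_add, ← two_mul]; congr 2; ring
    _ < 1 * Real.exp (-n) := by
      gcongr
      rw [Real.exp_neg, ← div_eq_mul_inv, div_lt_one (Real.exp_pos _)]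
      have : Real.exp 1 ≤ Real.exp n := Real.exp_le_exp.2 hn1
      linarith [Real.exp_one_gt_d9]
    _ = Real.exp (-1 * n) := by rw [one_mul, neg_one_mul]
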